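/- Let $r_{\rm hc}\ge 0$ and let $v:(0,\infty)\to\mathbb R\cup\{+\infty\}$ be equal to $+\infty$ on $(0,r_{\rm hc}]$ and a (finite) $C^2$ function on $(r_{\rm hc},\infty)$. Assume that there are $r_{\rm hc}<z_{\min}<z_{\max}<2z_{\min}$, $\alpha_1,\alpha_2>0$ and $s>2$ such that (monotonicity being understood in the weak sense): (i) $z_{\max}$ is the unique minimizer of $v$ and $v(z_{\max})<0$; $v$ is decreasing on $(0,z_{\max})$ and increasing and non-positive on $(z_{\max},\infty)$; (ii) $v(z)\ge-\alpha_1z^{-s}$ for all $z>0$, and $v(z)+v(z_{\max})-2\alpha_1\sum_{n=2}^\infty(nz)^{-s}>0$ for all $0<z<z_{\min}$; (iii) $v''$ is decreasing on $[z_{\min},z_{\max}]$ and increasing and non-positive on $[2z_{\min},\infty)$; (iv) $v''(z)\ge-\alpha_2z^{-s-2}$ for all $z>r_{\rm hc}$, and $v''(z_{\max})+\sum_{n=2}^\infty n^2v''(nz_{\min})>0$. Let $m\in\{1,2,3,\ldots\}\cup\{\infty\}$ and $0\le p<|v(z_{\max})|/z_{\max}$. For $N\ge1$ put $$E_N=\inf_{z_1,\ldots,z_{N-1}>0}\Bigl(\sum_{1\le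 i<j\le N,\ j-i\le m}v(z_i+\cdots+z_{j-1})+p\sum_{j=1}^{N-1}z_j\Bigr).$$ Then the map $r\mapsto pr+\sum_{k=1}^mv(kr)$ on $(0,\infty)$ has a unique minimizer $a$, and $e_0:=pa+\sum_{k=1}^mv(ka)=\lim_{N\to\infty}E_N/N$. Let $\mathcal D_0$ be the set of sequences $(z_j)_{j\in\mathbb N}\in(r_{\rm hc},\infty)^{\mathbb N}$ with at most finitely many entries different from $a$, let $\mathcal D=\{(z_j)_{j\in\mathbb N}\in(r_{\rm hc},\infty)^{\mathbb N}:\sum_j(z_j-a)^2<\infty\}$, equipped with the $\ell^2$-metric, and for $z\in\mathcal D_0$ define $$\mathcal E_{\rm surf}(z)=\sum_{j=1}^\infty\Bigl(pz_j+\sum_{k=1}^mv(z_j+\cdots+z_{j+k-1})-e_0\Bigr).$$ Then: (a) $\mathcal E_{\rm surf}$ extends to a continuous functional on $\mathcal D$ (again denoted $\mathcal E_{\rm surf}$). (b) $\mathcal E_{\rm surf}$ is strictly convex on $\mathcal D\cap[z_{\min},z_{\max}]^{\mathbb N}$. (c) $\mathcal E_{\rm surf}$ has a unique minimizer on $\mathcal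 D$, and it lies in $\mathcal D\cap[z_{\min},z_{\max}]^{\mathbb N}$. (d) The limit $e_{\rm surf}=\lim_{N\to\infty}(E_N-Ne_0)$ exists and $$e_{\rm surf}=2\min_{\mathcal D}\mathcal E_{\rm surf}-pa-\sum_{k=1}^mk\,v(ka).$$ -/

import Mathlib

open Filter Topology

noncomputable section

namespace AtomChain

/-- The pair potential `(0, ∞) → ℝ ∪ {+∞}`: it is `+∞` on `(0, rhc]` and is given by the
real function `v` on `(rhc, ∞)`. The values of `v` outside `(rhc, ∞)` play no role. -/
def pairPotential (rhc : ℝ) (v : ℝ → ℝ) (r : ℝ) : EReal :=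
  if r ≤ rhc then ⊤ else (v r : EReal)

/-- The standing assumption on the pair potential. Since the potential is `+∞` on `(0, rhc]`,
monotonicity and lower bounds only have to be required on `(rhc, ∞)`. -/
structure IsAdmissible (v : ℝ → ℝ) (rhc zmin zmax α₁ α₂ s : ℝ) : Prop where
  rhc_nonneg : 0 ≤ rhc
  rhc_lt_zmin : rhc < zmin
  zmin_lt_zmax : zmin < zmax
  zmax_lt : zmax < 2 * zmin
  α₁_pos : 0 < α₁
  α₂_pos : 0 < α₂
  two_lt_s : 2 < s
  contDiffOn : ContDiffOn ℝ 2 v (Set.Ioi rhc)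
  -- shape of `v`
  zmax_unique_min : ∀ r, rhc < r → r ≠ zmax → v zmax < v r
  v_zmax_neg : v zmax < 0
  antitone : AntitoneOn v (Set.Ioo rhc zmax)
  monotone : MonotoneOn v (Set.Ioi zmax)
  nonpos : ∀ r, zmax < r → v r ≤ 0
  -- growth of `v`
  lower_bound : ∀ r, rhc < r → -α₁ * r ^ (-s) ≤ v r
  repulsion : ∀ r, rhc < r → r < zmin →
    0 < v r + v zmax - 2 * α₁ * ∑' n : ℕ, (((n : ℝ) + 2) * r) ^ (-s)
  -- shape of `v''`
  deriv2_antitone : AntitoneOn (deriv (deriv v)) (Set.Icc zmin zmax)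
  deriv2_monotone : MonotoneOn (deriv (deriv v)) (Set.Ici (2 * zmin))
  deriv2_nonpos : ∀ r, 2 * zmin ≤ r → deriv (deriv v) r ≤ 0
  -- growth of `v''`
  deriv2_lower_bound : ∀ r, rhc < r → -α₂ * r ^ (-s - 2) ≤ deriv (deriv v) r
  deriv2_sum_pos :
    0 < deriv (deriv v) zmax +
      ∑' n : ℕ, ((n : ℝ) + 2) ^ 2 * deriv (deriv v) (((n : ℝ) + 2) * zmin)

open Classical in
/-- `∑_{k=1}^m f k`, where `m` may be `∞`. -/
def sumTo (m : ℕ∞) (f : ℕ → ℝ) : ℝ :=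
  ∑' k : ℕ, if 1 ≤ k ∧ (k : ℕ∞) ≤ m then f k else 0

open Classical in
/-- The Gibbs energy of `N` particles with spacings `z 0, …, z (N - 2)`: particles are labelled
`0, …, N - 1`, and `i < j` interact if `j - i ≤ m`. Later entries of `z` do not enter. -/
def chainEnergy (rhc : ℝ) (v : ℝ → ℝ) (m : ℕ∞) (p : ℝ) (N : ℕ) (z : ℕ → ℝ) : EReal :=
  (∑ j ∈ Finset.range N, ∑ i ∈ Finset.range j,
    if ((j - i : ℕ) : ℕ∞) ≤ m then pairPotential rhc v (∑ l ∈ Finset.Ico i j, z l) else 0)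
  + ((p * ∑ l ∈ Finset.range (N - 1), z l : ℝ) : EReal)

/-- `E_N`, the infimum of the Gibbs energy over all positive spacings. -/
def minEnergy (rhc : ℝ) (v : ℝ → ℝ) (m : ℕ∞) (p : ℝ) (N : ℕ) : EReal :=
  ⨅ z ∈ {z : ℕ → ℝ | ∀ j, 0 < z j}, chainEnergy rhc v m p N z

/-- `p r + ∑_{k=1}^m v(k r)` for `r > rhc`. -/
def bulkEnergy (v : ℝ → ℝ) (m : ℕ∞) (p r : ℝ) : ℝ :=
  p * r + sumTo m (fun k => v (k * r))

/-- The map `r ↦ p r + ∑_{k=1}^m v(k r)` on `(0, ∞)`, with value `+∞` for `r ≤ rhc`, where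
already the term `k = 1` is infinite. -/
def bulkEnergyExt (rhc : ℝ) (v : ℝ → ℝ) (m : ℕ∞) (p r : ℝ) : EReal :=
  if r ≤ rhc then ⊤ else (bulkEnergy v m p r : EReal)

/-- `h(z₁, …, z_m) = p z₁ + ∑_{k=1}^m v(z₁ + ⋯ + z_k)`; the spacing `z_j` is `z (j - 1)`. -/
def headEnergy (v : ℝ → ℝ) (m : ℕ∞) (p : ℝ) (z : ℕ → ℝ) : ℝ :=
  p * z 0 + sumTo m (fun k => v (∑ i ∈ Finset.range k, z i))

/-- The sequences in `(rhc, ∞)^ℕ` with at most finitely many entries different from `a`. -/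
def finiteStrains (rhc a : ℝ) : Set (ℕ → ℝ) :=
  {z | (∀ j, rhc < z j) ∧ {j | z j ≠ a}.Finite}

/-- The surface functional `∑_j (h(z_j, z_{j+1}, …) - e₀)`; on `finiteStrains rhc a` with
`e₀ = bulkEnergy v m p a` only finitely many terms are nonzero. -/
def surfaceEnergy (v : ℝ → ℝ) (m : ℕ∞) (p e₀ : ℝ) (z : ℕ → ℝ) : ℝ :=
  ∑' j : ℕ, (headEnergy v m p (fun i => z (j + i)) - e₀)

/-- The sequences in `(rhc, ∞)^ℕ` with square summable strain `z - a`. -/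
def squareSummableStrains (rhc a : ℝ) : Set (ℕ → ℝ) :=
  {z | (∀ j, rhc < z j) ∧ Summable (fun j => (z j - a) ^ 2)}

/-- The set `squareSummableStrains rhc a` as a type of its own, which carries the `ℓ²` metric
(and not the topology of pointwise convergence). -/
def StrainSpace (rhc a : ℝ) : Type := {z : ℕ → ℝ // z ∈ squareSummableStrains rhc a}

/-- The strain `z - a` as an element of `ℓ²(ℕ)`. -/
def StrainSpace.strain {rhc a : ℝ} (z : StrainSpace rhc a) : lp (fun _ : ℕ => ℝ) 2 :=
  ⟨fun j => z.1 j - a, memℓp_gen (by simpa using z.2.2)⟩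

theorem StrainSpace.strain_injective (rhc a : ℝ) :
    Function.Injective (StrainSpace.strain : StrainSpace rhc a → lp (fun _ : ℕ => ℝ) 2) := by
  intro z w h
  apply Subtype.ext
  funext j
  have hj : z.1 j - a = w.1 j - a := congrArg (fun f : lp (fun _ : ℕ => ℝ) 2 => f j) h
  linarith

/-- The `ℓ²` metric `dist z w = ‖z - w‖_{ℓ²}`. -/
instance (rhc a : ℝ) : MetricSpace (StrainSpace rhc a) :=
  MetricSpace.induced StrainSpace.strain (StrainSpace.strain_injective rhc a) inferInstance

end AtomChain

end

noncomputable section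

namespace AtomChain

/-! ### Analysis of the pair potential -/

/-! Every energy is reduced to finite chains whose spacings lie in `[zmin, zmax]`, where it is
uniformly convex with constants independent of the length.

Confinement to the box. If the shortest spacing is below `zmin`, delete one of its end particles: by
the repulsion hypothesis its interactions cost more than nothing, even allowing for pairs that come
into range because labels shift (`chain_remove_le`). Reattach it at the left end at distance `zmax`,
which gains at least `-(v zmax + p * zmax) > 0` (`chain_cons_le`). This gain is fixed, so a
configuration closer than that to the infimum has no short spacing, and no iteration is needed.
Spacings above `zmax` can be clipped, because sums of two or more spacings exceed `2 * zmin > zmax`,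
where `v` increases (`chain_clip_le`).

Convexity. In the box the `k`-th neighbour term has second derivative at least `c_k`, with `c_k ≤ 0`
for `k ≥ 2`. By Cauchy-Schwarz the windows of length `k` have at most `k²` times the squared `ℓ²`
norm of the spacings, so the modulus is `∑ k² c_k`, positive by assumption (`chain_box_convexity`).

Lipschitz bound. The bulk minimizer `a` satisfies `p + ∑ k v'(ka) = 0`. In the expansion of a chain
around spacing `a` the linear terms therefore cancel up to boundary terms, and the energy is
Lipschitz in `ℓ²` on bounded strains, uniformly in the length (`chain_lipschitz`). This gives the
continuous extension to square summable strains and, with convexity, a uniform bound on the strain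
of finite minimizers (`exists_strain_bound`). Midpoint convexity makes minimizing sequences in the
box Cauchy in `ℓ²`, hence a minimizer exists.

Surface energy. A chain with bounded strain contains by pigeonhole a long block with little strain
(`exists_cut`). Flattening it to `a` changes the energy by `o(1)`, and cutting there leaves two
half-infinite chains. If `Q = ∑ (k - 1) v(ka)` is the interaction across a particle of the lattice,
the chain equals two surface energies plus bulk minus `Q`, up to `o(1)` (`tendsto_chain_glue`).
Conversely, gluing a near-minimizer to its mirror image gives the upper bound. The limit is `2 μ -
(e₀ + Q)` with `μ` the surface infimum, and `e₀ + Q = p a + ∑ k v(ka)`. -/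

theorem quadratic_convexity {f f' f'' : ℝ → ℝ} {D : Set ℝ} (hD : Convex ℝ D)
    (hf : ∀ x ∈ D, HasDerivAt f (f' x) x) (hf' : ∀ x ∈ D, HasDerivAt f' (f'' x) x)
    {c : ℝ} (hc : ∀ x ∈ D, c ≤ f'' x) {x y : ℝ} (hx : x ∈ D) (hy : y ∈ D)
    {t u : ℝ} (ht : 0 ≤ t) (hu : 0 ≤ u) (htu : t + u = 1) :
    f (t * x + u * y) ≤ t * f x + u * f y - c / 2 * (t * u * (x - y) ^ 2) := by
  have h1 : ∀ x ∈ D, HasDerivAt (fun x => f x - c / 2 * x ^ 2) (f' x - c * x) x := by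
    intro x hx
    have := (hf x hx).sub ((hasDerivAt_pow 2 x).const_mul (c / 2))
    refine this.congr_deriv ?_
    simp; ring
  have h2 : ∀ x ∈ D, HasDerivAt (fun x => f' x - c * x) (f'' x - c) x := by
    intro x hx
    have := (hf' x hx).sub ((hasDerivAt_id x).const_mul c)
    refine this.congr_deriv ?_
    simp
  have hconv : ConvexOn ℝ D (fun x => f x - c / 2 * x ^ 2) := by
    refine convexOn_of_hasDerivWithinAt2_nonneg hD
      (fun x hx => (h1 x hx).continuousAt.continuousWithinAt)
      (fun x hx => (h1 x (interior_subset hx)).hasDerivWithinAt)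
      (fun x hx => (h2 x (interior_subset hx)).hasDerivWithinAt) ?_
    intro x hx
    linarith [hc x (interior_subset hx)]
  have h := hconv.2 hx hy ht hu htu
  simp only [smul_eq_mul] at h
  have hu' : u = 1 - t := by linarith
  subst hu'
  nlinarith [h]

/-- Decay known only beyond `R` extends down to any `r > ρ`, since `f x * x ^ t` is continuous on
the compact interval `[r, R]`. -/
theorem exists_rpow_bound {f : ℝ → ℝ} {ρ R A t : ℝ} (hρ : 0 ≤ ρ)
    (hf : ContinuousOn f (Set.Ioi ρ)) (hA : ∀ x, R ≤ x → |f x| ≤ A * x ^ (-t)) {r : ℝ}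
    (hr : ρ < r) : ∃ C, 0 ≤ C ∧ ∀ x, r ≤ x → |f x| ≤ C * x ^ (-t) := by
  have hc : ContinuousOn (fun x => f x * x ^ t) (Set.Icc r R) := by
    refine (hf.mono fun x hx => lt_of_lt_of_le hr hx.1).mul ?_
    intro x hx
    exact (Real.continuousAt_rpow_const x t (Or.inl (by linarith [hx.1]))).continuousWithinAt
  obtain ⟨B, hB⟩ := isCompact_Icc.exists_bound_of_continuousOn hc
  refine ⟨max (max A B) 0, le_max_right _ _, fun x hx => ?_⟩
  have hx0 : 0 < x := by linarith
  have hpos : 0 < x ^ (-t) := Real.rpow_pos_of_pos hx0 _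
  by_cases hxR : x ≤ R
  · have h := hB x ⟨hx, hxR⟩
    rw [Real.norm_eq_abs, abs_mul, abs_of_pos (Real.rpow_pos_of_pos hx0 t)] at h
    have h2 : |f x| = |f x| * x ^ t * x ^ (-t) := by
      rw [mul_assoc, ← Real.rpow_add hx0]; simp
    rw [h2]
    exact mul_le_mul_of_nonneg_right (h.trans ((le_max_right A B).trans (le_max_left _ _))) hpos.le
  · exact (hA x (not_le.1 hxR).le).trans
      (mul_le_mul_of_nonneg_right ((le_max_left A B).trans (le_max_left _ _)) hpos.le)

section
variable {v : ℝ → ℝ} {rhc zmin zmax α₁ α₂ s : ℝ}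

theorem IsAdmissible.zmin_pos (hv : IsAdmissible v rhc zmin zmax α₁ α₂ s) : 0 < zmin :=
  lt_of_le_of_lt hv.rhc_nonneg hv.rhc_lt_zmin

theorem IsAdmissible.zmax_pos (hv : IsAdmissible v rhc zmin zmax α₁ α₂ s) : 0 < zmax :=
  hv.zmin_pos.trans hv.zmin_lt_zmax

theorem IsAdmissible.contDiffOn_deriv (hv : IsAdmissible v rhc zmin zmax α₁ α₂ s) :
    ContDiffOn ℝ 1 (deriv v) (Set.Ioi rhc) :=
  ((contDiffOn_succ_iff_deriv_of_isOpen (n := 1) isOpen_Ioi).1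
    (by simpa [one_add_one_eq_two] using hv.contDiffOn)).2.2

theorem IsAdmissible.continuousOn_deriv2 (hv : IsAdmissible v rhc zmin zmax α₁ α₂ s) :
    ContinuousOn (deriv (deriv v)) (Set.Ioi rhc) :=
  (((contDiffOn_succ_iff_deriv_of_isOpen (n := 0) isOpen_Ioi).1
    (by simpa using hv.contDiffOn_deriv)).2.2).continuousOn

theorem IsAdmissible.hasDerivAt (hv : IsAdmissible v rhc zmin zmax α₁ α₂ s) {x : ℝ}
    (hx : rhc < x) : HasDerivAt v (deriv v x) x :=
  ((hv.contDiffOn.differentiableOn (by norm_num)).differentiableAt (Ioi_mem_nhds hx)).hasDerivAt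

theorem IsAdmissible.hasDerivAt_deriv (hv : IsAdmissible v rhc zmin zmax α₁ α₂ s) {x : ℝ}
    (hx : rhc < x) : HasDerivAt (deriv v) (deriv (deriv v) x) x :=
  ((hv.contDiffOn_deriv.differentiableOn (by norm_num)).differentiableAt
    (Ioi_mem_nhds hx)).hasDerivAt

theorem IsAdmissible.continuousOn (hv : IsAdmissible v rhc zmin zmax α₁ α₂ s) :
    ContinuousOn v (Set.Ioi rhc) := hv.contDiffOn.continuousOn

theorem IsAdmissible.zmax_le (hv : IsAdmissible v rhc zmin zmax α₁ α₂ s) {x : ℝ}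
    (hx : rhc < x) : v zmax ≤ v x := by
  rcases eq_or_ne x zmax with rfl | h
  · exact le_rfl
  · exact (hv.zmax_unique_min x hx h).le

theorem IsAdmissible.mono_of_zmax_le (hv : IsAdmissible v rhc zmin zmax α₁ α₂ s) {x y : ℝ}
    (hx : zmax ≤ x) (hxy : x ≤ y) : v x ≤ v y := by
  rcases hx.eq_or_lt with rfl | h
  · exact hv.zmax_le (by linarith [hv.rhc_lt_zmin, hv.zmin_lt_zmax])
  · exact hv.monotone h (lt_of_lt_of_le h hxy) hxy

theorem IsAdmissible.anti_of_le_zmax (hv : IsAdmissible v rhc zmin zmax α₁ α₂ s) {x y : ℝ}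
    (hx : rhc < x) (hxy : x ≤ y) (hy : y ≤ zmax) : v y ≤ v x := by
  rcases hy.eq_or_lt with rfl | h
  · exact hv.zmax_le hx
  · exact hv.antitone ⟨hx, lt_of_le_of_lt hxy h⟩ ⟨lt_of_lt_of_le hx hxy, h⟩ hxy

theorem IsAdmissible.nonpos_of_zmax_le (hv : IsAdmissible v rhc zmin zmax α₁ α₂ s) {x : ℝ}
    (hx : zmax ≤ x) : v x ≤ 0 := by
  rcases hx.eq_or_lt with rfl | h
  · exact hv.v_zmax_neg.le
  · exact hv.nonpos x h

theorem IsAdmissible.lt_zmax_of_pos (hv : IsAdmissible v rhc zmin zmax α₁ α₂ s) {x : ℝ}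
    (hx : 0 < v x) : x < zmax := by
  by_contra h
  exact absurd (hv.nonpos_of_zmax_le (not_lt.1 h)) (not_le.2 hx)

theorem IsAdmissible.exists_bound (hv : IsAdmissible v rhc zmin zmax α₁ α₂ s) {r : ℝ}
    (hr : rhc < r) : ∃ C, 0 ≤ C ∧ ∀ x, r ≤ x → |v x| ≤ C * x ^ (-s) := by
  refine exists_rpow_bound (R := zmax) (A := α₁) hv.rhc_nonneg hv.continuousOn ?_ hr
  intro x hx
  rw [abs_of_nonpos (hv.nonpos_of_zmax_le hx)]
  linarith [hv.lower_bound x (by linarith [hv.rhc_lt_zmin, hv.zmin_lt_zmax])]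

theorem IsAdmissible.exists_bound_deriv2 (hv : IsAdmissible v rhc zmin zmax α₁ α₂ s) {r : ℝ}
    (hr : rhc < r) : ∃ C, 0 ≤ C ∧ ∀ x, r ≤ x → |deriv (deriv v) x| ≤ C * x ^ (-s - 2) := by
  have := exists_rpow_bound (R := 2 * zmin) (A := α₂) (t := s + 2) hv.rhc_nonneg
    hv.continuousOn_deriv2 ?_ hr
  · simpa only [neg_add'] using this
  intro x hx
  rw [abs_of_nonpos (hv.deriv2_nonpos x hx), neg_add']
  linarith [hv.deriv2_lower_bound x (by linarith [hv.rhc_lt_zmin, hv.zmin_pos])]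

theorem IsAdmissible.deriv_nonneg (hv : IsAdmissible v rhc zmin zmax α₁ α₂ s) {x : ℝ}
    (hx : zmax < x) : 0 ≤ deriv v x := by
  rw [← derivWithin_of_isOpen isOpen_Ioi (s := Set.Ioi zmax) hx]
  exact hv.monotone.derivWithin_nonneg

theorem IsAdmissible.antitoneOn_deriv (hv : IsAdmissible v rhc zmin zmax α₁ α₂ s) :
    AntitoneOn (deriv v) (Set.Ici (2 * zmin)) := by
  have hlt : ∀ x, 2 * zmin ≤ x → rhc < x := fun x hx => by
    linarith [hv.rhc_lt_zmin, hv.zmin_pos]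
  refine antitoneOn_of_deriv_nonpos (convex_Ici _)
    (fun x hx => (hv.hasDerivAt_deriv (hlt x hx)).continuousAt.continuousWithinAt)
    (fun x hx => (hv.hasDerivAt_deriv
      (hlt x (interior_subset hx))).differentiableAt.differentiableWithinAt)
    (fun x hx => hv.deriv2_nonpos x (interior_subset hx))

/-- No decay of `v'` is assumed. Beyond `2 * zmin` the derivative is nonincreasing and nonnegative,
so it is at most the mean slope of `v` over `[x/2, x]`, which the lower bound on `v` controls by a
multiple of `x ^ (-s - 1)`. -/
theorem IsAdmissible.exists_bound_deriv (hv : IsAdmissible v rhc zmin zmax α₁ α₂ s) {r : ℝ}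
    (hr : rhc < r) : ∃ C, 0 ≤ C ∧ ∀ x, r ≤ x → |deriv v x| ≤ C * x ^ (-s - 1) := by
  have hz := hv.zmin_pos
  -- The threshold `4 * zmin` keeps `x / 2` in the concave region `[2 * zmin, ∞)`.
  have := exists_rpow_bound (R := 4 * zmin) (A := α₁ * 2 ^ (s + 1)) (t := s + 1) hv.rhc_nonneg
    (hv.contDiffOn_deriv.continuousOn) ?_ hr
  · simpa only [neg_add'] using this
  intro x hx
  have hx0 : 0 < x := by linarith
  rw [abs_of_nonneg (hv.deriv_nonneg (by linarith [hv.zmax_lt]))]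
  have hlt : ∀ y, x / 2 ≤ y → rhc < y := fun y hy => by linarith [hv.rhc_lt_zmin]
  obtain ⟨ξ, hξ, hξ'⟩ := exists_hasDerivAt_eq_slope v (deriv v) (a := x / 2) (b := x)
    (by linarith) (fun y hy => (hv.hasDerivAt (hlt y hy.1)).continuousAt.continuousWithinAt)
    (fun y hy => hv.hasDerivAt (hlt y hy.1.le))
  have h1 : deriv v x ≤ deriv v ξ :=
    hv.antitoneOn_deriv (Set.mem_Ici.2 (by linarith [hξ.1])) (Set.mem_Ici.2 (by linarith)) hξ.2.le
  have h2 := hv.lower_bound (x / 2) (hlt _ le_rfl)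
  have h3 := hv.nonpos_of_zmax_le (x := x) (by linarith [hv.zmax_lt])
  have h4 : (x / 2) ^ (-s) = 2 ^ s * x ^ (-s) := by
    rw [Real.div_rpow hx0.le (by norm_num), Real.rpow_neg (by norm_num : (0:ℝ) ≤ 2)]
    field_simp
  have h5 : x ^ (-(s + 1)) = x ^ (-s) / x := by
    rw [neg_add, Real.rpow_add hx0, Real.rpow_neg_one]; rfl
  have h6 : (2:ℝ) ^ (s + 1) = 2 ^ s * 2 := by
    rw [Real.rpow_add (by norm_num), Real.rpow_one]
  rw [h5, h6]
  refine h1.trans ?_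
  rw [hξ', div_le_iff₀ (by linarith)]
  have : α₁ * (2 ^ s * 2) * (x ^ (-s) / x) * (x - x / 2) = α₁ * (2 ^ s * x ^ (-s)) := by
    field_simp; ring
  rw [this, ← h4]
  linarith

end

/-! ### Finite chains with a family of potentials -/

/-- The length of the window of `k` consecutive spacings that starts at `i`. -/
def win (z : ℕ → ℝ) (i k : ℕ) : ℝ := ∑ l ∈ Finset.range k, z (i + l)

/-- The energy of `N` particles with spacings `z`, where particles whose labels differ by `k`
interact through `V k`. -/
def chain (V : ℕ → ℝ → ℝ) (p : ℝ) (N : ℕ) (z : ℕ → ℝ) : ℝ :=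
  ∑ j ∈ Finset.range N, ∑ i ∈ Finset.range j, V (j - i) (win z i (j - i))
    + p * ∑ l ∈ Finset.range (N - 1), z l

theorem sum_pairs_eq (f : ℕ → ℕ → ℝ) (hf : ∀ i, f i 0 = 0) (N : ℕ) :
    ∑ j ∈ Finset.range N, ∑ i ∈ Finset.range j, f i (j - i)
      = ∑ k ∈ Finset.range N, ∑ i ∈ Finset.range (N - k), f i k := by
  induction N with
  | zero => simp
  | succ N ih =>
    rw [Finset.sum_range_succ, ih]
    have h1 : ∀ k ∈ Finset.range (N + 1), ∑ i ∈ Finset.range (N + 1 - k), f i k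
        = ∑ i ∈ Finset.range (N - k), f i k + f (N - k) k := by
      intro k hk
      rw [Nat.succ_sub (Finset.mem_range_succ_iff.1 hk), Finset.sum_range_succ]
    rw [Finset.sum_congr rfl h1, Finset.sum_add_distrib]
    congr 1
    · rw [Finset.sum_range_succ]; simp
    · rw [← Finset.sum_range_reflect, Finset.sum_range_succ', hf, add_zero]
      refine Finset.sum_congr rfl fun i hi => ?_
      have hi' := Finset.mem_range.1 hi
      congr 1 <;> omega

theorem sum_pairs_eq' (f : ℕ → ℕ → ℝ) (hf : ∀ i, f i 0 = 0) (N : ℕ) :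
    ∑ j ∈ Finset.range N, ∑ i ∈ Finset.range j, f i (j - i)
      = ∑ i ∈ Finset.range N, ∑ k ∈ Finset.range (N - i), f i k := by
  rw [sum_pairs_eq f hf]
  refine Finset.sum_comm' fun k i => ?_
  simp only [Finset.mem_range]
  omega

theorem chain_eq {V : ℕ → ℝ → ℝ} (hV : ∀ x, V 0 x = 0) (p : ℝ) (N : ℕ) (z : ℕ → ℝ) :
    chain V p N z = ∑ k ∈ Finset.range N, ∑ i ∈ Finset.range (N - k), V k (win z i k)
      + p * ∑ l ∈ Finset.range (N - 1), z l := by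
  rw [chain, sum_pairs_eq (fun i k => V k (win z i k)) fun i => hV _]

theorem chain_eq' {V : ℕ → ℝ → ℝ} (hV : ∀ x, V 0 x = 0) (p : ℝ) (N : ℕ) (z : ℕ → ℝ) :
    chain V p N z = ∑ i ∈ Finset.range N, ∑ k ∈ Finset.range (N - i), V k (win z i k)
      + p * ∑ l ∈ Finset.range (N - 1), z l := by
  rw [chain, sum_pairs_eq' (fun i k => V k (win z i k)) fun i => hV _]

theorem chain_congr (V : ℕ → ℝ → ℝ) (p : ℝ) {N : ℕ} {z w : ℕ → ℝ}
    (h : ∀ l, l + 1 < N → z l = w l) : chain V p N z = chain V p N w := by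
  unfold chain win
  congr 1
  · refine Finset.sum_congr rfl fun j hj => Finset.sum_congr rfl fun i hi => ?_
    rw [Finset.sum_congr rfl fun l hl => h (i + l) ?_]
    simp only [Finset.mem_range] at hj hi hl
    omega
  · rw [Finset.sum_congr rfl fun l hl => h l ?_]
    simp only [Finset.mem_range] at hl
    omega

/-! ### Windows and their `ℓ²` estimates -/

theorem win_one (z : ℕ → ℝ) (i : ℕ) : win z i 1 = z i := by simp [win]

theorem win_add (z : ℕ → ℝ) (i k l : ℕ) : win z i (k + l) = win z i k + win z (i + k) l := by
  simp [win, Finset.sum_range_add, add_assoc]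

theorem win_linear (z w : ℕ → ℝ) (t u : ℝ) (i k : ℕ) :
    win (fun l => t * z l + u * w l) i k = t * win z i k + u * win w i k := by
  simp [win, Finset.sum_add_distrib, Finset.mul_sum]

theorem win_sub (z w : ℕ → ℝ) (i k : ℕ) :
    win (fun l => z l - w l) i k = win z i k - win w i k := by
  simp [win]

theorem win_const (a : ℝ) (i k : ℕ) : win (fun _ => a) i k = k * a := by
  simp [win]

theorem mul_le_win {z : ℕ → ℝ} {r : ℝ} {i k : ℕ} (h : ∀ l, l < k → r ≤ z (i + l)) :
    k * r ≤ win z i k := by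
  have := Finset.card_nsmul_le_sum (Finset.range k) (fun l => z (i + l)) r
    (fun l hl => h l (Finset.mem_range.1 hl))
  simpa [win] using this

theorem win_le_win {z w : ℕ → ℝ} {i k : ℕ} (h : ∀ l, l < k → z (i + l) ≤ w (i + l)) :
    win z i k ≤ win w i k :=
  Finset.sum_le_sum fun l hl => h l (Finset.mem_range.1 hl)

theorem win_congr {z w : ℕ → ℝ} {i j k : ℕ} (h : ∀ l, l < k → z (i + l) = w (j + l)) :
    win z i k = win w j k :=
  Finset.sum_congr rfl fun l hl => h l (Finset.mem_range.1 hl)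

/-- One factor `k` is Cauchy-Schwarz inside a window, the other counts the windows that contain a
given spacing. -/
theorem sum_win_sq_le (ζ : ℕ → ℝ) (L k : ℕ) :
    ∑ i ∈ Finset.range (L + 1 - k), win ζ i k ^ 2
      ≤ (k : ℝ) ^ 2 * ∑ l ∈ Finset.range L, ζ l ^ 2 := by
  have h1 : ∀ i ∈ Finset.range (L + 1 - k),
      win ζ i k ^ 2 ≤ k * ∑ l ∈ Finset.range k, ζ (i + l) ^ 2 := by
    intro i _
    have := sq_sum_le_card_mul_sum_sq (s := Finset.range k) (f := fun l => ζ (i + l))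
    simpa [win] using this
  refine (Finset.sum_le_sum h1).trans ?_
  rw [← Finset.mul_sum, Finset.sum_comm, sq, mul_assoc]
  refine mul_le_mul_of_nonneg_left ?_ (Nat.cast_nonneg k)
  have h2 : ∀ l ∈ Finset.range k, ∑ i ∈ Finset.range (L + 1 - k), ζ (i + l) ^ 2
      ≤ ∑ l ∈ Finset.range L, ζ l ^ 2 := by
    intro l hl
    have hl' := Finset.mem_range.1 hl
    have : ∑ i ∈ Finset.range (L + 1 - k), ζ (i + l) ^ 2
        = ∑ i ∈ (Finset.range (L + 1 - k)).image (· + l), ζ i ^ 2 := by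
      rw [Finset.sum_image]
      intro x _ y _ h
      simpa using h
    rw [this]
    refine Finset.sum_le_sum_of_subset_of_nonneg ?_ fun _ _ _ => sq_nonneg _
    intro i hi
    simp only [Finset.mem_image, Finset.mem_range] at hi ⊢
    obtain ⟨j, hj, rfl⟩ := hi
    omega
  have := Finset.sum_le_card_nsmul _ _ _ h2
  simpa using this

theorem abs_le_sqrt_sum_sq (ζ : ℕ → ℝ) {L l : ℕ} (hl : l < L) :
    |ζ l| ≤ √(∑ l ∈ Finset.range L, ζ l ^ 2) := by
  apply Real.abs_le_sqrt
  exact Finset.single_le_sum (f := fun l => ζ l ^ 2) (fun _ _ => sq_nonneg _)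
    (Finset.mem_range.2 hl)

theorem abs_sum_range_le (ζ : ℕ → ℝ) (L : ℕ) :
    |∑ l ∈ Finset.range L, ζ l| ≤ L * √(∑ l ∈ Finset.range L, ζ l ^ 2) := by
  refine (Finset.abs_sum_le_sum_abs _ _).trans ?_
  have := Finset.sum_le_card_nsmul (Finset.range L) (fun l => |ζ l|) _
    (fun l hl => abs_le_sqrt_sum_sq ζ (Finset.mem_range.1 hl))
  simpa using this

theorem abs_sum_sub_sum_le (ζ : ℕ → ℝ) {L M l : ℕ} (h : l + M ≤ L) :
    |∑ i ∈ Finset.range M, ζ (i + l) - ∑ i ∈ Finset.range L, ζ i|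
      ≤ (L - M : ℕ) * √(∑ l ∈ Finset.range L, ζ l ^ 2) := by
  have h1 : ∑ i ∈ Finset.range M, ζ (i + l)
      = ∑ i ∈ (Finset.range M).image (· + l), ζ i := by
    rw [Finset.sum_image]
    intro x _ y _ h
    simpa using h
  have hsub : (Finset.range M).image (· + l) ⊆ Finset.range L := by
    intro i hi
    simp only [Finset.mem_image, Finset.mem_range] at hi ⊢
    obtain ⟨j, hj, rfl⟩ := hi
    omega
  rw [h1, ← Finset.sum_sdiff hsub, sub_add_cancel_right, abs_neg]
  refine (Finset.abs_sum_le_sum_abs _ _).trans ?_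
  have := Finset.sum_le_card_nsmul (Finset.range L \ (Finset.range M).image (· + l))
    (fun l => |ζ l|) _
    (fun l hl => abs_le_sqrt_sum_sq ζ (Finset.mem_range.1 (Finset.sdiff_subset hl)))
  rw [Finset.card_sdiff_of_subset hsub, Finset.card_image_of_injective _
    (add_left_injective l)] at this
  simpa using this

/-- Apart from the ends, each spacing lies in exactly `k` windows of length `k`. Each of the `k`
shifts misses at most `k` end entries, each bounded by the `ℓ²` norm, so the error does not depend
on `L`. -/
theorem abs_sum_win_sub_le (ζ : ℕ → ℝ) (L k : ℕ) :
    |∑ i ∈ Finset.range (L + 1 - k), win ζ i k - k * ∑ l ∈ Finset.range L, ζ l|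
      ≤ (k : ℝ) ^ 2 * √(∑ l ∈ Finset.range L, ζ l ^ 2) := by
  set d := √(∑ l ∈ Finset.range L, ζ l ^ 2) with hd
  have hd0 : 0 ≤ d := Real.sqrt_nonneg _
  rcases Nat.lt_or_ge L k with hk | hk
  -- With `k > L` there are no windows; the whole of `k` times the sum is error, and it has at most
  -- `k` entries.
  · rw [Nat.sub_eq_zero_of_le (by omega), Finset.sum_range_zero, zero_sub, abs_neg, abs_mul,
      Nat.abs_cast, sq, mul_assoc]
    refine mul_le_mul_of_nonneg_left ((abs_sum_range_le ζ L).trans ?_) (Nat.cast_nonneg k)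
    exact mul_le_mul_of_nonneg_right (Nat.cast_le.2 hk.le) hd0
  · unfold win
    have hconst : (k : ℝ) * ∑ l ∈ Finset.range L, ζ l
        = ∑ _l ∈ Finset.range k, ∑ l ∈ Finset.range L, ζ l := by simp
    rw [Finset.sum_comm, hconst, ← Finset.sum_sub_distrib]
    refine (Finset.abs_sum_le_sum_abs _ _).trans ?_
    have h2 : ∀ l ∈ Finset.range k,
        |∑ i ∈ Finset.range (L + 1 - k), ζ (i + l) - ∑ i ∈ Finset.range L, ζ i| ≤ k * d := by
      intro l hl
      have hl' := Finset.mem_range.1 hl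
      refine (abs_sum_sub_sum_le ζ (by omega)).trans ?_
      exact mul_le_mul_of_nonneg_right (Nat.cast_le.2 (by omega)) hd0
    have := Finset.sum_le_card_nsmul _ _ _ h2
    rw [sq, mul_assoc]
    simpa using this

/-- The modulus is `∑ k² c k`: nearest neighbours contribute `c 1` exactly, and for `k ≥ 2` the loss
`c k ≤ 0` multiplies a sum of squared windows bounded by `sum_win_sq_le`. -/
theorem chain_strong_convexity {V : ℕ → ℝ → ℝ} (hV : ∀ x, V 0 x = 0) {p : ℝ} {c : ℕ → ℝ}
    (hc : ∀ k, 2 ≤ k → c k ≤ 0) (hcs : Summable fun k : ℕ => (k : ℝ) ^ 2 * c k)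
    {L : ℕ} {z w : ℕ → ℝ} {t u : ℝ} (ht : 0 ≤ t) (hu : 0 ≤ u)
    (h : ∀ k i, 1 ≤ k → i + k ≤ L → V k (t * win z i k + u * win w i k)
      ≤ t * V k (win z i k) + u * V k (win w i k)
        - c k / 2 * (t * u * (win z i k - win w i k) ^ 2)) :
    chain V p (L + 1) (fun l => t * z l + u * w l)
      ≤ t * chain V p (L + 1) z + u * chain V p (L + 1) w
        - (∑' k : ℕ, (k : ℝ) ^ 2 * c k) / 2
          * (t * u * ∑ l ∈ Finset.range L, (z l - w l) ^ 2) := by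
  set S := ∑ l ∈ Finset.range L, (z l - w l) ^ 2 with hS
  have hS0 : 0 ≤ S := Finset.sum_nonneg fun _ _ => sq_nonneg _
  have hk : ∀ k ∈ Finset.range (L + 1), ∑ i ∈ Finset.range (L + 1 - k),
      V k (win (fun l => t * z l + u * w l) i k)
      ≤ t * ∑ i ∈ Finset.range (L + 1 - k), V k (win z i k)
        + u * ∑ i ∈ Finset.range (L + 1 - k), V k (win w i k)
        - (k : ℝ) ^ 2 * c k / 2 * (t * u * S) := by
    intro k hk
    rcases Nat.eq_zero_or_pos k with rfl | hk1
    · simp [hV]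
    have hle : ∑ i ∈ Finset.range (L + 1 - k), V k (win (fun l => t * z l + u * w l) i k)
        ≤ t * ∑ i ∈ Finset.range (L + 1 - k), V k (win z i k)
        + u * ∑ i ∈ Finset.range (L + 1 - k), V k (win w i k)
        - c k / 2 * (t * u *
          ∑ i ∈ Finset.range (L + 1 - k), win (fun l => z l - w l) i k ^ 2) := by
      simp only [Finset.mul_sum, ← Finset.sum_add_distrib, ← Finset.sum_sub_distrib]
      refine Finset.sum_le_sum fun i hi => ?_
      rw [win_linear, win_sub]
      have hi' := Finset.mem_range.1 hi
      exact h k i hk1 (by omega)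
    refine hle.trans ?_
    rcases Nat.lt_or_ge k 2 with hk2 | hk2
    · obtain rfl : k = 1 := by omega
      simp [win_one, hS]
    · have h1 := sum_win_sq_le (fun l => z l - w l) L k
      have h2 : 0 ≤ t * u := mul_nonneg ht hu
      have h3 := mul_le_mul_of_nonneg_left h1 h2
      have h4 := mul_le_mul_of_nonpos_left h3 (by linarith [hc k hk2] : c k / 2 ≤ 0)
      rw [← hS] at h4
      nlinarith [h4]
  have hsum := Finset.sum_le_sum hk
  have hts : (∑' k : ℕ, (k : ℝ) ^ 2 * c k) * S
      ≤ (∑ k ∈ Finset.range (L + 1), (k : ℝ) ^ 2 * c k) * S := by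
    -- The tail of the series may be added because its terms are nonpositive. For `L = 0` the tail
    -- would include `k = 1`, whose sign is not given, but then `S = 0`.
    rcases Nat.eq_zero_or_pos L with rfl | hL
    · simp [hS]
    · refine mul_le_mul_of_nonneg_right ?_ hS0
      rw [← hcs.sum_add_tsum_nat_add (L + 1)]
      have : ∑' k : ℕ, ((k + (L + 1) : ℕ) : ℝ) ^ 2 * c (k + (L + 1)) ≤ 0 :=
        tsum_nonpos fun k => mul_nonpos_of_nonneg_of_nonpos (sq_nonneg _) (hc _ (by omega))
      linarith
  rw [Finset.sum_sub_distrib, Finset.sum_add_distrib, ← Finset.mul_sum, ← Finset.mul_sum,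
    ← Finset.sum_mul, ← Finset.sum_div] at hsum
  have hts' := mul_le_mul_of_nonneg_left hts (mul_nonneg ht hu)
  simp only [chain_eq hV, Nat.add_sub_cancel]
  have hlin : ∑ l ∈ Finset.range L, (t * z l + u * w l)
      = t * ∑ l ∈ Finset.range L, z l + u * ∑ l ∈ Finset.range L, w l := by
    rw [Finset.sum_add_distrib, Finset.mul_sum, Finset.mul_sum]
  rw [hlin]
  linarith

/-- The linear part is `∑ D k * T k + p * σ`, where `T k` sums the windows of length `k`. Since `p =
-∑ k * D k`, it equals `∑ D k * (T k - k * σ)`, a boundary term bounded uniformly in `L`. The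
quadratic remainder is handled by Cauchy-Schwarz. The constant is thus independent of the length. -/
theorem chain_lipschitz {V : ℕ → ℝ → ℝ} (hV : ∀ x, V 0 x = 0) {p a : ℝ} {D B : ℕ → ℝ}
    (hB : ∀ k, 0 ≤ B k) (hDs : Summable fun k : ℕ => (k : ℝ) ^ 2 * |D k|)
    (hBs : Summable fun k : ℕ => (k : ℝ) ^ 2 * B k) (hp : p + ∑' k : ℕ, k * D k = 0)
    {L : ℕ} {z w : ℕ → ℝ} {M : ℝ} (hM : 0 ≤ M)
    (hz : ∑ l ∈ Finset.range L, (z l - a) ^ 2 ≤ M ^ 2)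
    (hw : ∑ l ∈ Finset.range L, (w l - a) ^ 2 ≤ M ^ 2)
    (h : ∀ k i, 1 ≤ k → i + k ≤ L →
      |V k (win z i k) - V k (win w i k) - D k * (win z i k - win w i k)|
      ≤ B k * (|win z i k - win w i k| * (|win z i k - k * a| + |win w i k - k * a|))) :
    |chain V p (L + 1) z - chain V p (L + 1) w|
      ≤ (∑' k : ℕ, (k : ℝ) ^ 2 * |D k| + 2 * M * ∑' k : ℕ, (k : ℝ) ^ 2 * B k)
        * √(∑ l ∈ Finset.range L, (z l - w l) ^ 2) := by
  set d := √(∑ l ∈ Finset.range L, (z l - w l) ^ 2) with hd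
  have hd0 : 0 ≤ d := Real.sqrt_nonneg _
  set ζ : ℕ → ℝ := fun l => z l - w l with hζ
  set T : ℕ → ℝ := fun k => ∑ i ∈ Finset.range (L + 1 - k), win ζ i k with hT
  set σ : ℝ := ∑ l ∈ Finset.range L, ζ l with hσ
  have hT0 : ∀ k, k ∉ Finset.range (L + 1) → T k = 0 := by
    intro k hk
    have : L + 1 - k = 0 := by simp at hk; omega
    simp [hT, this]
  have hDabs : Summable fun k : ℕ => (k : ℝ) * D k := by
    refine Summable.of_norm_bounded hDs fun k => ?_
    rw [Real.norm_eq_abs, abs_mul, Nat.abs_cast]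
    refine mul_le_mul_of_nonneg_right ?_ (abs_nonneg _)
    exact_mod_cast Nat.le_self_pow two_ne_zero k
  -- the linear part
  have hbound : ∀ k : ℕ, |D k * (T k - k * σ)| ≤ (k : ℝ) ^ 2 * |D k| * d := by
    intro k
    rw [abs_mul]
    calc |D k| * |T k - k * σ| ≤ |D k| * ((k : ℝ) ^ 2 * d) :=
          mul_le_mul_of_nonneg_left (abs_sum_win_sub_le ζ L k) (abs_nonneg _)
      _ = _ := by ring
  have hDT : HasSum (fun k => D k * T k) (∑ k ∈ Finset.range (L + 1), D k * T k) :=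
    hasSum_sum_of_ne_finset_zero fun k hk => by rw [hT0 k hk, mul_zero]
  have hlin : |∑ k ∈ Finset.range (L + 1), D k * T k + p * σ|
      ≤ (∑' k : ℕ, (k : ℝ) ^ 2 * |D k|) * d := by
    have h1 : HasSum (fun k : ℕ => D k * (T k - k * σ))
        (∑ k ∈ Finset.range (L + 1), D k * T k + p * σ) := by
      have h2 := hDT.sub (hDabs.hasSum.mul_right σ)
      have h3 : (∑ k ∈ Finset.range (L + 1), D k * T k + p * σ)
          = ∑ k ∈ Finset.range (L + 1), D k * T k - (∑' k : ℕ, k * D k) * σ := by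
        rw [eq_neg_of_add_eq_zero_left hp]; ring
      rw [h3]
      refine h2.congr_fun ?_
      intro k; ring
    rw [← h1.tsum_eq, ← tsum_mul_right]
    have := tsum_of_norm_bounded (f := fun k : ℕ => D k * (T k - k * σ))
      (hDs.mul_right d).hasSum hbound
    simpa using this
  -- the remainder
  have hrem : ∀ k ∈ Finset.range (L + 1),
      |∑ i ∈ Finset.range (L + 1 - k), V k (win z i k)
        - ∑ i ∈ Finset.range (L + 1 - k), V k (win w i k) - D k * T k|
      ≤ (k : ℝ) ^ 2 * B k * (2 * M * d) := by
    intro k hk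
    rcases Nat.eq_zero_or_pos k with rfl | hk1
    · simp [hV, hT, win]
    have hCS : ∀ y : ℕ → ℝ, ∑ l ∈ Finset.range L, (y l - a) ^ 2 ≤ M ^ 2 →
        ∑ i ∈ Finset.range (L + 1 - k), |win ζ i k| * |win (fun l => y l - a) i k|
          ≤ (k : ℝ) ^ 2 * (M * d) := by
      intro y hy
      refine (Real.sum_mul_le_sqrt_mul_sqrt _ _ _).trans ?_
      simp only [sq_abs]
      have h1 : √(∑ i ∈ Finset.range (L + 1 - k), win ζ i k ^ 2) ≤ k * d := by
        apply Real.sqrt_le_iff.2 ⟨by positivity, ?_⟩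
        rw [mul_pow, hd, Real.sq_sqrt (Finset.sum_nonneg fun _ _ => sq_nonneg _)]
        exact sum_win_sq_le ζ L k
      have h2 : √(∑ i ∈ Finset.range (L + 1 - k), win (fun l => y l - a) i k ^ 2) ≤ k * M := by
        apply Real.sqrt_le_iff.2 ⟨by positivity, ?_⟩
        rw [mul_pow]
        exact (sum_win_sq_le _ L k).trans (mul_le_mul_of_nonneg_left hy (sq_nonneg _))
      calc _ ≤ (k * d) * (k * M) := mul_le_mul h1 h2 (Real.sqrt_nonneg _) (by positivity)
        _ = _ := by ring
    rw [hT]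
    simp only [Finset.mul_sum, ← Finset.sum_sub_distrib]
    refine (Finset.abs_sum_le_sum_abs _ _).trans ?_
    calc ∑ i ∈ Finset.range (L + 1 - k),
          |V k (win z i k) - V k (win w i k) - D k * win ζ i k|
        ≤ ∑ i ∈ Finset.range (L + 1 - k), B k * (|win ζ i k| * |win (fun l => z l - a) i k|
            + |win ζ i k| * |win (fun l => w l - a) i k|) := by
          refine Finset.sum_le_sum fun i hi => ?_
          have hi' := Finset.mem_range.1 hi
          have := h k i hk1 (by omega)
          rw [hζ, win_sub, win_sub z (fun _ => a), win_sub w (fun _ => a), win_const, ← mul_add]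
          exact this
      _ ≤ B k * ((k : ℝ) ^ 2 * (M * d) + (k : ℝ) ^ 2 * (M * d)) := by
          rw [← Finset.mul_sum, Finset.sum_add_distrib]
          exact mul_le_mul_of_nonneg_left (add_le_add (hCS z hz) (hCS w hw)) (hB k)
      _ = _ := by ring
  have hremsum : |∑ k ∈ Finset.range (L + 1), (∑ i ∈ Finset.range (L + 1 - k), V k (win z i k)
        - ∑ i ∈ Finset.range (L + 1 - k), V k (win w i k) - D k * T k)|
      ≤ (∑' k : ℕ, (k : ℝ) ^ 2 * B k) * (2 * M * d) := by
    refine (Finset.abs_sum_le_sum_abs _ _).trans ((Finset.sum_le_sum hrem).trans ?_)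
    rw [← Finset.sum_mul]
    refine mul_le_mul_of_nonneg_right ?_ (by positivity)
    exact hBs.sum_le_tsum _ fun k _ => mul_nonneg (sq_nonneg _) (hB k)
  have hsplit : chain V p (L + 1) z - chain V p (L + 1) w
      = ∑ k ∈ Finset.range (L + 1), (∑ i ∈ Finset.range (L + 1 - k), V k (win z i k)
        - ∑ i ∈ Finset.range (L + 1 - k), V k (win w i k) - D k * T k)
        + (∑ k ∈ Finset.range (L + 1), D k * T k + p * σ) := by
    have : σ = ∑ l ∈ Finset.range L, z l - ∑ l ∈ Finset.range L, w l := by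
      simp [hσ, hζ]
    rw [chain_eq hV, chain_eq hV, Finset.sum_sub_distrib, Finset.sum_sub_distrib, this,
      Nat.add_sub_cancel]
    ring
  rw [hsplit]
  refine (abs_add_le _ _).trans ((add_le_add hremsum hlin).trans (le_of_eq ?_))
  ring

/-- Both pieces share particle `n`, so the cross terms are the pairs strictly on either side of it:
`n - 1 - i` and `n + 1 + q`, at label distance `i + q + 2`. -/
theorem chain_split {V : ℕ → ℝ → ℝ} (p : ℝ) (n n' : ℕ) (z : ℕ → ℝ) :
    chain V p (n + n' + 1) z = chain V p (n + 1) z + chain V p (n' + 1) (fun l => z (n + l))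
      + ∑ i ∈ Finset.range n, ∑ q ∈ Finset.range n',
        V (i + q + 2) (win z (n - 1 - i) (i + q + 2)) := by
  have hlen : ∑ l ∈ Finset.range (n + n'), z l
      = ∑ l ∈ Finset.range n, z l + ∑ l ∈ Finset.range n', z (n + l) :=
    Finset.sum_range_add z n n'
  have hin : ∀ q ∈ Finset.range n', ∑ i ∈ Finset.range (n + 1 + q),
      V (n + 1 + q - i) (win z i (n + 1 + q - i))
      = ∑ i ∈ Finset.range n, V (i + q + 2) (win z (n - 1 - i) (i + q + 2))
        + ∑ i ∈ Finset.range (q + 1),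
          V (q + 1 - i) (win (fun l => z (n + l)) i (q + 1 - i)) := by
    intro q _
    rw [show n + 1 + q = n + (q + 1) by omega, Finset.sum_range_add]
    congr 1
    · rw [← Finset.sum_range_reflect]
      refine Finset.sum_congr rfl fun i hi => ?_
      have hi' := Finset.mem_range.1 hi
      rw [show n + (q + 1) - (n - 1 - i) = i + q + 2 by omega]
    · refine Finset.sum_congr rfl fun i hi => ?_
      rw [show n + (q + 1) - (n + i) = q + 1 - i by omega]
      congr 1
      exact win_congr fun l _ => by rw [add_assoc]
  unfold chain
  rw [show n + n' + 1 = n + 1 + n' by omega, Finset.sum_range_add, Finset.sum_congr rfl hin,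
    Finset.sum_add_distrib, show n + 1 + n' - 1 = n + n' by omega, hlen,
    Finset.sum_range_succ' (fun j => ∑ i ∈ Finset.range j,
      V (j - i) (win (fun l => z (n + l)) i (j - i))) n', Finset.sum_comm (s := Finset.range n')]
  simp only [Finset.range_zero, Finset.sum_empty, Nat.add_sub_cancel]
  ring

theorem win_reflect (z : ℕ → ℝ) {n i k : ℕ} (h : i + k ≤ n) :
    win (fun l => z (n - 1 - l)) i k = win z (n - k - i) k := by
  unfold win
  rw [← Finset.sum_range_reflect]
  refine Finset.sum_congr rfl fun l hl => ?_
  have hl' := Finset.mem_range.1 hl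
  exact congrArg z (by omega)

theorem chain_reflect {V : ℕ → ℝ → ℝ} (hV : ∀ x, V 0 x = 0) (p : ℝ) (n : ℕ) (z : ℕ → ℝ) :
    chain V p (n + 1) (fun l => z (n - 1 - l)) = chain V p (n + 1) z := by
  rw [chain_eq hV, chain_eq hV]
  congr 1
  · refine Finset.sum_congr rfl fun k _ => ?_
    rw [← Finset.sum_range_reflect]
    refine Finset.sum_congr rfl fun i hi => ?_
    have hi' := Finset.mem_range.1 hi
    rw [win_reflect z (by omega)]
    congr 2
    omega
  · rw [Nat.add_sub_cancel, Finset.sum_range_reflect]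

/-- A head energy contains all interactions to the right of its particle. Those ending at particle
`n` or before build the finite chain; the others jump over particle `n`. -/
theorem sum_head {V : ℕ → ℝ → ℝ} (hV : ∀ x, V 0 x = 0) (p : ℝ) (n : ℕ) (z : ℕ → ℝ)
    (hs : ∀ j, Summable fun k => V k (win z j k)) :
    ∑ j ∈ Finset.range n, (p * z j + ∑' k, V k (win z j k))
      = chain V p (n + 1) z + ∑ i ∈ Finset.range n,
        ∑' q, V (i + q + 2) (win z (n - 1 - i) (i + q + 2)) := by
  have h1 : ∀ j ∈ Finset.range n, p * z j + ∑' k, V k (win z j k)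
      = p * z j + ∑ k ∈ Finset.range (n + 1 - j), V k (win z j k)
        + ∑' q, V (q + (n + 1 - j)) (win z j (q + (n + 1 - j))) := by
    intro j _
    rw [← (hs j).sum_add_tsum_nat_add (n + 1 - j)]
    ring
  rw [Finset.sum_congr rfl h1, Finset.sum_add_distrib, Finset.sum_add_distrib, chain_eq' hV,
    Finset.sum_range_succ _ n, Nat.add_sub_cancel_left, Finset.range_one, Finset.sum_singleton, hV,
    Nat.add_sub_cancel, ← Finset.mul_sum]
  have h2 : ∑ j ∈ Finset.range n, ∑' q, V (q + (n + 1 - j)) (win z j (q + (n + 1 - j)))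
      = ∑ i ∈ Finset.range n, ∑' q, V (i + q + 2) (win z (n - 1 - i) (i + q + 2)) := by
    rw [← Finset.sum_range_reflect]
    refine Finset.sum_congr rfl fun i hi => tsum_congr fun q => ?_
    have hi' := Finset.mem_range.1 hi
    rw [show q + (n + 1 - (n - 1 - i)) = i + q + 2 by omega]
  rw [h2]
  ring

/-- The weight `n + 1` counts the pairs with sum `n`. -/
theorem hasSum_antidiagonal {f : ℕ → ℝ} (hf : Summable fun n : ℕ => ((n : ℝ) + 1) * f n) :
    HasSum (fun x : ℕ × ℕ => f (x.1 + x.2)) (∑' n : ℕ, ((n : ℝ) + 1) * f n) := by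
  have habs : Summable fun n : ℕ => ((n : ℝ) + 1) * |f n| := by
    refine hf.abs.congr fun n => ?_
    rw [abs_mul, abs_of_nonneg (by positivity : (0 : ℝ) ≤ (n : ℝ) + 1)]
  have hcount : ∀ (g : ℕ → ℝ) (n : ℕ),
      HasSum (fun c : Finset.HasAntidiagonal.antidiagonal n => g (c.1.1 + c.1.2)) (((n : ℝ) + 1) * g n) := by
    intro g n
    have h1 : ∀ c : Finset.HasAntidiagonal.antidiagonal n, g (c.1.1 + c.1.2) = g n := fun c => by
      rw [Finset.HasAntidiagonal.mem_antidiagonal.1 c.2]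
    simp only [h1]
    have := hasSum_fintype (fun _ : Finset.HasAntidiagonal.antidiagonal n => g n)
    simpa using this
  have hsum : Summable fun x : ℕ × ℕ => f (x.1 + x.2) := by
    rw [← Finset.HasAntidiagonal.sigmaAntidiagonalEquivProd.summable_iff, ← summable_abs_iff]
    refine (summable_sigma_of_nonneg fun _ => abs_nonneg _).2 ⟨fun n => ?_, ?_⟩
    · exact (hcount (fun n => |f n|) n).summable
    · refine habs.congr fun n => ?_
      exact ((hcount (fun n => |f n|) n).tsum_eq).symm
  rw [← Finset.HasAntidiagonal.sigmaAntidiagonalEquivProd.hasSum_iff]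
  have h2 : Summable ((fun x : ℕ × ℕ => f (x.1 + x.2))
      ∘ Finset.HasAntidiagonal.sigmaAntidiagonalEquivProd) :=
    (Finset.HasAntidiagonal.sigmaAntidiagonalEquivProd.summable_iff).2 hsum
  have h3 := h2.hasSum.sigma (fun n => hcount f n)
  rw [h3.tsum_eq]
  exact h2.hasSum

/-! ### Rearrangements of finite chains -/

open Classical in
/-- The potential between particles whose labels differ by `k`. -/
def cutoff (v : ℝ → ℝ) (m : ℕ∞) (k : ℕ) (x : ℝ) : ℝ :=
  if 1 ≤ k ∧ (k : ℕ∞) ≤ m then v x else 0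

theorem cutoff_zero (v : ℝ → ℝ) (m : ℕ∞) (x : ℝ) : cutoff v m 0 x = 0 := by simp [cutoff]

theorem cutoff_of_le (v : ℝ → ℝ) {m : ℕ∞} {k : ℕ} (h : 1 ≤ k) (hk : (k : ℕ∞) ≤ m) (x : ℝ) :
    cutoff v m k x = v x := if_pos ⟨h, hk⟩

theorem cutoff_of_not_le (v : ℝ → ℝ) {m : ℕ∞} {k : ℕ} (hk : ¬ (k : ℕ∞) ≤ m) (x : ℝ) :
    cutoff v m k x = 0 := if_neg fun h => hk h.2

theorem cutoff_one (v : ℝ → ℝ) {m : ℕ∞} (hm : 1 ≤ m) (x : ℝ) : cutoff v m 1 x = v x :=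
  cutoff_of_le v le_rfl (by simpa using hm) x

theorem cutoff_cases (v : ℝ → ℝ) (m : ℕ∞) (k : ℕ) :
    (∀ x, cutoff v m k x = v x) ∨ (∀ x, cutoff v m k x = 0) := by
  by_cases h : 1 ≤ k ∧ (k : ℕ∞) ≤ m
  · exact Or.inl fun x => if_pos h
  · exact Or.inr fun x => if_neg h

section
variable {v : ℝ → ℝ} {rhc zmin zmax α₁ α₂ s : ℝ}

/-- Clipped windows of length at least two are still at least `2 * zmin > zmax`, where `v` is
nondecreasing, so shortening lowers every term. The nearest-neighbour gain at one site `j` is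
retained because strictness of the minimum will need it. -/
theorem chain_clip_le (hv : IsAdmissible v rhc zmin zmax α₁ α₂ s) {m : ℕ∞} (hm : 1 ≤ m) {p : ℝ}
    (hp : 0 ≤ p) {N : ℕ} {z : ℕ → ℝ} (hz : ∀ l, l + 1 < N → zmin ≤ z l) {j : ℕ} (hj : j + 1 < N) :
    chain (cutoff v m) p N (fun l => min (z l) zmax) + (v (z j) - v (min (z j) zmax))
      ≤ chain (cutoff v m) p N z := by
  have hzmin := hv.zmin_pos
  have hzmm := hv.zmin_lt_zmax
  have hterm : ∀ k i, i + k < N →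
      0 ≤ cutoff v m k (win z i k) - cutoff v m k (win (fun l => min (z l) zmax) i k) := by
    intro k i hik
    rcases Nat.lt_or_ge k 2 with hk | hk
    · interval_cases k
      · simp [cutoff_zero]
      · rw [cutoff_one v hm, cutoff_one v hm, win_one, win_one, sub_nonneg]
        have := hz i hik
        rcases le_total (z i) zmax with h | h
        · rw [min_eq_left h]
        · rw [min_eq_right h]
          exact hv.zmax_le (by linarith [hv.rhc_lt_zmin])
    · rcases cutoff_cases v m k with h | h
      · rw [h, h, sub_nonneg]
        refine hv.mono_of_zmax_le ?_ (win_le_win fun l _ => min_le_left _ _)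
        have h1 : (k : ℝ) * zmin ≤ win (fun l => min (z l) zmax) i k :=
          mul_le_win fun l hl => le_min (hz _ (by omega)) hzmm.le
        have h2 : (2 : ℝ) ≤ k := by exact_mod_cast hk
        nlinarith [hv.zmax_lt]
      · rw [h, h, sub_zero]
  have hV : ∀ x, cutoff v m 0 x = 0 := cutoff_zero v m
  have hlen : p * ∑ l ∈ Finset.range (N - 1), min (z l) zmax
      ≤ p * ∑ l ∈ Finset.range (N - 1), z l :=
    mul_le_mul_of_nonneg_left (Finset.sum_le_sum fun l _ => min_le_left _ _) hp
  have hsum : v (z j) - v (min (z j) zmax)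
      ≤ ∑ k ∈ Finset.range N, ∑ i ∈ Finset.range (N - k), (cutoff v m k (win z i k)
        - cutoff v m k (win (fun l => min (z l) zmax) i k)) := by
    have h1 : ∑ i ∈ Finset.range (N - 1), (cutoff v m 1 (win z i 1)
        - cutoff v m 1 (win (fun l => min (z l) zmax) i 1)) ≤ _ :=
      Finset.single_le_sum (f := fun k => ∑ i ∈ Finset.range (N - k), (cutoff v m k (win z i k)
        - cutoff v m k (win (fun l => min (z l) zmax) i k)))
        (fun k _ => Finset.sum_nonneg fun i hi => hterm k i (by
          have := Finset.mem_range.1 hi; omega)) (Finset.mem_range.2 (by omega : 1 < N))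
    refine le_trans ?_ h1
    have h2 := Finset.single_le_sum (f := fun i => cutoff v m 1 (win z i 1)
        - cutoff v m 1 (win (fun l => min (z l) zmax) i 1))
        (fun i hi => hterm 1 i (by have := Finset.mem_range.1 hi; omega))
        (Finset.mem_range.2 (by omega : j < N - 1))
    refine le_trans (le_of_eq ?_) h2
    simp only [cutoff_one v hm, win_one]
  rw [chain_eq hV, chain_eq hV]
  simp only [Finset.sum_sub_distrib] at hsum
  linarith

/-- Put the spacing `y` in front of the spacings `z`. -/
def consSpacing (y : ℝ) (z : ℕ → ℝ) : ℕ → ℝ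
  | 0 => y
  | l + 1 => z l

/-- The new particle sees its neighbour at distance `zmax` and all others further away, where `v ≤
0`. -/
theorem chain_cons_le (hv : IsAdmissible v rhc zmin zmax α₁ α₂ s) {m : ℕ∞} (hm : 1 ≤ m) (p : ℝ)
    {n : ℕ} {z : ℕ → ℝ} (hz : ∀ l, l < n → 0 ≤ z l) :
    chain (cutoff v m) p (n + 2) (consSpacing zmax z)
      ≤ chain (cutoff v m) p (n + 1) z + (v zmax + p * zmax) := by
  have h := chain_split (V := cutoff v m) p 1 n (consSpacing zmax z)
  rw [show 1 + n + 1 = n + 2 by omega] at h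
  have h1 : (fun l => consSpacing zmax z (1 + l)) = z := by
    funext l; rw [add_comm]; rfl
  have h2 : chain (cutoff v m) p (1 + 1) (consSpacing zmax z) = v zmax + p * zmax := by
    simp [chain, Finset.sum_range_succ, win, consSpacing, cutoff_one v hm]
  have h3 : ∑ i ∈ Finset.range 1, ∑ q ∈ Finset.range n,
      cutoff v m (i + q + 2) (win (consSpacing zmax z) (1 - 1 - i) (i + q + 2)) ≤ 0 := by
    refine Finset.sum_nonpos fun i hi => Finset.sum_nonpos fun q hq => ?_
    have hq' := Finset.mem_range.1 hq
    obtain rfl : i = 0 := by simpa using hi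
    rcases cutoff_cases v m (0 + q + 2) with h | h
    · rw [h]
      refine hv.nonpos_of_zmax_le ?_
      rw [show 0 + q + 2 = 1 + (q + 1) by omega, win_add, win_one]
      have : ((q + 1 : ℕ) : ℝ) * 0 ≤ win (consSpacing zmax z) (1 - 1 - 0 + 1) (q + 1) :=
        mul_le_win fun l hl => by
          rw [show 1 - 1 - 0 + 1 + l = l + 1 by omega]
          exact hz l (by omega)
      simp only [mul_zero] at this
      have h0 : consSpacing zmax z (1 - 1 - 0) = zmax := rfl
      linarith
    · rw [h]
  rw [h, h1, h2]
  linarith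

/-! ### Removal of a particle next to a short spacing -/

/-- The position of the particle `i` if particle `0` sits at the origin. -/
def position (z : ℕ → ℝ) (i : ℕ) : ℝ := ∑ l ∈ Finset.range i, z l

theorem win_eq_position (z : ℕ → ℝ) (i k : ℕ) : win z i k = position z (i + k) - position z i := by
  simp [win, position, Finset.sum_range_add]

theorem position_succ (z : ℕ → ℝ) (i : ℕ) : position z (i + 1) = position z i + z i :=
  Finset.sum_range_succ _ _

/-- The positions after the removal of particle `j`. -/
def removedPosition (z : ℕ → ℝ) (j i : ℕ) : ℝ := if i < j then position z i else position z (i + 1)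

/-- The spacings after the removal of particle `j`. -/
def removeParticle (z : ℕ → ℝ) (j l : ℕ) : ℝ :=
  removedPosition z j (l + 1) - removedPosition z j l

theorem position_removeParticle (z : ℕ → ℝ) (j i : ℕ) :
    position (removeParticle z j) i = removedPosition z j i - removedPosition z j 0 :=
  Finset.sum_range_sub _ _

theorem removeParticle_of_le (z : ℕ → ℝ) {j l : ℕ} (h : j ≤ l) :
    removeParticle z j l = z (l + 1) := by
  rw [removeParticle, removedPosition, removedPosition, if_neg (by omega), if_neg (by omega),
    position_succ z (l + 1)]
  ring

theorem lt_removeParticle {z : ℕ → ℝ} {ρ : ℝ} (hρ : 0 ≤ ρ) {j l : ℕ} (hl : ρ < z l)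
    (hl' : ρ < z (l + 1)) : ρ < removeParticle z j l := by
  rw [removeParticle, removedPosition, removedPosition]
  split_ifs <;> simp only [position_succ] <;> first | omega | linarith

theorem chain_eq_position (V : ℕ → ℝ → ℝ) (p : ℝ) (N : ℕ) (z : ℕ → ℝ) :
    chain V p N z = ∑ j ∈ Finset.range N, ∑ i ∈ Finset.range j,
      V (j - i) (position z j - position z i) + p * position z (N - 1) := by
  rw [chain]
  congr 1
  refine Finset.sum_congr rfl fun j _ => Finset.sum_congr rfl fun i hi => ?_
  rw [win_eq_position, Nat.add_sub_cancel' (Finset.mem_range.1 hi).le]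

/-- Used for the interactions of one particle with one side of the chain. If that side may be empty,
the bound still holds provided `β ≤ 0`. -/
theorem le_sum_of_rpow_bound {r : ℝ} (hα : 0 ≤ α₁) (hs : 1 < s) (hr : 0 < r) {β : ℝ} {f : ℕ → ℝ}
    {R : ℕ} (h0 : 1 ≤ R ∨ β ≤ 0) (hβ : 0 < R → β ≤ f 0)
    (hf : ∀ n, n + 1 < R → -α₁ * (((n : ℝ) + 2) * r) ^ (-s) ≤ f (n + 1)) :
    β - α₁ * ∑' n : ℕ, (((n : ℝ) + 2) * r) ^ (-s) ≤ ∑ n ∈ Finset.range R, f n := by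
  have hsum : Summable fun n : ℕ => (((n : ℝ) + 2) * r) ^ (-s) := by
    have h1 : Summable fun n : ℕ => ((n + 2 : ℕ) : ℝ) ^ (-s) * r ^ (-s) :=
      ((summable_nat_add_iff 2).2 (Real.summable_nat_rpow.2 (by linarith))).mul_right _
    refine h1.congr fun n => ?_
    rw [Real.mul_rpow (by positivity) hr.le]
    push_cast
    rfl
  have hnn : ∀ n : ℕ, 0 ≤ (((n : ℝ) + 2) * r) ^ (-s) := fun n => by positivity
  rcases Nat.eq_zero_or_pos R with rfl | hR
  · have h1 : β ≤ 0 := by simpa using h0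
    have h2 : 0 ≤ α₁ * ∑' n : ℕ, (((n : ℝ) + 2) * r) ^ (-s) := mul_nonneg hα (tsum_nonneg hnn)
    simp only [Finset.range_zero, Finset.sum_empty]
    linarith
  · obtain ⟨R, rfl⟩ : ∃ R', R = R' + 1 := ⟨R - 1, by omega⟩
    rw [Finset.sum_range_succ']
    have h1 := hsum.sum_le_tsum (Finset.range R) fun n _ => hnn n
    have h2 : -α₁ * ∑ n ∈ Finset.range R, (((n : ℝ) + 2) * r) ^ (-s)
        ≤ ∑ n ∈ Finset.range R, f (n + 1) := by
      rw [Finset.mul_sum]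
      exact Finset.sum_le_sum fun n hn => hf n (by have := Finset.mem_range.1 hn; omega)
    have h3 := mul_le_mul_of_nonneg_left h1 hα
    linarith [hβ hR]

/-- Removing a particle lowers the label distance of pairs across it by one. For a fixed left
particle at most one pair then enters the range, the one whose new distance is exactly `m`; for `m =
∞` there is none. -/
theorem cutoff_sub_sum (v : ℝ → ℝ) (m : ℕ∞) {i : ℕ} (hi : 1 ≤ i) (R : ℕ) (e : ℕ → ℝ) :
    (∑ q ∈ Finset.range R, (cutoff v m (i + q + 1) (e q) - cutoff v m (i + q) (e q)) = 0) ∨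
    ((i : ℕ∞) ≤ m ∧ ∃ q, q < R ∧
      ∑ q ∈ Finset.range R, (cutoff v m (i + q + 1) (e q) - cutoff v m (i + q) (e q)) = -v (e q)) := by
  classical
  by_cases hex : ∃ q, q < R ∧ ((i + q : ℕ) : ℕ∞) = m
  · obtain ⟨q, hq, hqm⟩ := hex
    refine Or.inr ⟨?_, q, hq, ?_⟩
    · rw [← hqm]; exact_mod_cast Nat.le_add_right i q
    · rw [Finset.sum_eq_single_of_mem q (Finset.mem_range.2 hq)]
      · rw [cutoff_of_le v (by omega) hqm.le, cutoff_of_not_le v, zero_sub]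
        rw [← hqm, Nat.cast_le]; omega
      · intro b _ hb
        subst hqm
        simp only [cutoff, Nat.cast_le]
        by_cases h : b < q
        · rw [if_pos (by omega), if_pos (by omega), sub_self]
        · rw [if_neg (by omega), if_neg (by omega), sub_self]
  · left
    refine Finset.sum_eq_zero fun q hq => ?_
    have hne : ((i + q : ℕ) : ℕ∞) ≠ m := fun h => hex ⟨q, Finset.mem_range.1 hq, h⟩
    by_cases h : ((i + q : ℕ) : ℕ∞) ≤ m
    · have h2 : ((i + q + 1 : ℕ) : ℕ∞) ≤ m := by
        have := Order.add_one_le_of_lt (lt_of_le_of_ne h hne)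
        exact_mod_cast this
      rw [cutoff_of_le v (by omega) h, cutoff_of_le v (by omega) h2, sub_self]
    · have h2 : ¬ ((i + q + 1 : ℕ) : ℕ∞) ≤ m := fun h' => h (le_trans (by
        exact_mod_cast Nat.le_succ _) h')
      rw [cutoff_of_not_le v h, cutoff_of_not_le v h2, sub_self]

/-- With `r = z j` the shortest spacing, particle `j` has interactions at least `v r` plus a tail on
the right and `v zmax` plus a tail on the left. Their sum is positive by the repulsion hypothesis,
and the length does not grow. -/
theorem chain_remove_le (hv : IsAdmissible v rhc zmin zmax α₁ α₂ s) {m : ℕ∞} (hm : 1 ≤ m) {p : ℝ}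
    (hp : 0 ≤ p) {j R : ℕ} (hR : 1 ≤ R) {z : ℕ → ℝ} (hz : ∀ l, l < j + R → rhc < z l)
    (hmin : ∀ l, l < j + R → z j ≤ z l) (hj : z j < zmin) :
    chain (cutoff v m) p (j + R) (removeParticle z j) ≤ chain (cutoff v m) p (j + 1 + R) z := by
  set r := z j with hr
  set x := position z with hx
  set V := cutoff v m with hV
  have hrhc : rhc < r := hz j (by omega)
  have hr0 : 0 < r := lt_of_le_of_lt hv.rhc_nonneg hrhc
  have hs1 : 1 < s := by linarith [hv.two_lt_s]
  have hdist : ∀ i k, i + k ≤ j + R → (k : ℝ) * r ≤ x (i + k) - x i := by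
    intro i k hik
    rw [hx, ← win_eq_position]
    exact mul_le_win fun l hl => hmin _ (by omega)
  -- single interactions are bounded below
  have hlow : ∀ d (k : ℕ), 1 ≤ k → (k : ℝ) * r ≤ d → -α₁ * ((k : ℝ) * r) ^ (-s) ≤ v d := by
    intro d k hk hd
    have hk1 : (1 : ℝ) ≤ k := by exact_mod_cast hk
    have hkr : r ≤ k * r := by nlinarith
    have h1 := hv.lower_bound d (by linarith)
    have h2 : d ^ (-s) ≤ ((k : ℝ) * r) ^ (-s) :=
      Real.rpow_le_rpow_of_nonpos (by positivity) hd (by linarith)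
    nlinarith [hv.α₁_pos]
  have hneg : ∀ k : ℕ, -α₁ * ((k : ℝ) * r) ^ (-s) ≤ 0 := fun k => by
    have : 0 ≤ α₁ * ((k : ℝ) * r) ^ (-s) := mul_nonneg hv.α₁_pos.le (by positivity)
    linarith
  have hlowV : ∀ d (k : ℕ), 1 ≤ k → (k : ℝ) * r ≤ d → -α₁ * ((k : ℝ) * r) ^ (-s) ≤ V k d := by
    intro d k hk hd
    rcases cutoff_cases v m k with h | h
    · rw [hV, h]; exact hlow d k hk hd
    · rw [hV, h]; exact hneg k
  -- the interactions of particle `j` with the particles on its left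
  have hpair : ∀ i (β : ℝ), i < j → β ≤ 0 → β ≤ V (i + 1) (x j - x (j - 1 - i)) →
      β ≤ V (i + 1) (x j - x (j - 1 - i)) + ∑ q ∈ Finset.range R,
        (V (i + 1 + q + 1) (x (j + 1 + q) - x (j - 1 - i))
          - V (i + 1 + q) (x (j + 1 + q) - x (j - 1 - i))) := by
    intro i β hi hβ hβV
    rcases cutoff_sub_sum v m (i := i + 1) (by omega) R
      (fun q => x (j + 1 + q) - x (j - 1 - i)) with h | ⟨him, q, hq, h⟩
    · rw [hV] at hβV ⊢
      linarith
    · rw [hV] at hβV ⊢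
      rw [h]
      rcases le_or_gt (v (x (j + 1 + q) - x (j - 1 - i))) 0 with h0 | h0
      · linarith
      · have h1 : (i + 1 : ℕ) * r ≤ x j - x (j - 1 - i) := by
          have := hdist (j - 1 - i) (i + 1) (by omega)
          rwa [show j - 1 - i + (i + 1) = j by omega] at this
        have h2 : ((1 + q : ℕ) : ℝ) * r ≤ x (j + 1 + q) - x j := by
          have := hdist j (1 + q) (by omega)
          rwa [← add_assoc] at this
        have h3 : r ≤ x j - x (j - 1 - i) := by
          push_cast at h1
          have : (0 : ℝ) ≤ i := Nat.cast_nonneg i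
          nlinarith
        have h4 : x j - x (j - 1 - i) ≤ x (j + 1 + q) - x (j - 1 - i) := by
          have : 0 ≤ ((1 + q : ℕ) : ℝ) * r := by positivity
          linarith
        have h5 := hv.anti_of_le_zmax (by linarith) h4 (hv.lt_zmax_of_pos h0).le
        rw [cutoff_of_le v (by omega) him]
        linarith
  have hleft : v zmax - α₁ * ∑' n : ℕ, (((n : ℝ) + 2) * r) ^ (-s)
      ≤ ∑ i ∈ Finset.range j, (V (i + 1) (x j - x (j - 1 - i)) + ∑ q ∈ Finset.range R,
        (V (i + 1 + q + 1) (x (j + 1 + q) - x (j - 1 - i))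
          - V (i + 1 + q) (x (j + 1 + q) - x (j - 1 - i)))) := by
    -- The left side is empty when `j = 0`, which is harmless because `v zmax < 0`; on the right `1
    -- ≤ R` provides the neighbour at distance `r`.
    refine le_sum_of_rpow_bound hv.α₁_pos.le hs1 hr0 (Or.inr hv.v_zmax_neg.le) ?_ ?_
    · intro hj0
      refine hpair 0 _ hj0 hv.v_zmax_neg.le ?_
      rw [hV, zero_add, cutoff_one v hm]
      refine hv.zmax_le ?_
      have := hdist (j - 1 - 0) 1 (by omega)
      rw [show j - 1 - 0 + 1 = j by omega] at this
      push_cast at this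
      linarith
    · intro n hn
      have h1 : ((n : ℝ) + 2) * r = ((n + 1 + 1 : ℕ) : ℝ) * r := by push_cast; ring
      rw [h1]
      refine hpair (n + 1) _ hn (hneg _) (hlowV _ _ (by omega) ?_)
      have := hdist (j - 1 - (n + 1)) (n + 1 + 1) (by omega)
      rwa [show j - 1 - (n + 1) + (n + 1 + 1) = j by omega] at this
  have hright : v r - α₁ * ∑' n : ℕ, (((n : ℝ) + 2) * r) ^ (-s)
      ≤ ∑ q ∈ Finset.range R, V (q + 1) (x (j + 1 + q) - x j) := by
    refine le_sum_of_rpow_bound hv.α₁_pos.le hs1 hr0 (Or.inl hR) ?_ ?_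
    · intro _
      rw [hV, zero_add, cutoff_one v hm, add_zero, hx, position_succ, add_sub_cancel_left]
    · intro n hn
      have h1 : ((n : ℝ) + 2) * r = ((n + 1 + 1 : ℕ) : ℝ) * r := by push_cast; ring
      rw [h1]
      refine hlowV _ _ (by omega) ?_
      have := hdist j (n + 1 + 1) (by omega)
      rwa [show j + (n + 1 + 1) = j + 1 + (n + 1) by omega] at this
  have hrep := hv.repulsion r hrhc hj
  -- decomposition of the energies
  have hdec : ∑ b ∈ Finset.range (j + 1 + R), ∑ a ∈ Finset.range b, V (b - a) (x b - x a)
      = ∑ b ∈ Finset.range j, ∑ a ∈ Finset.range b, V (b - a) (x b - x a)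
        + ∑ i ∈ Finset.range j, V (i + 1) (x j - x (j - 1 - i))
        + ∑ q ∈ Finset.range R, V (q + 1) (x (j + 1 + q) - x j)
        + ∑ i ∈ Finset.range j, ∑ q ∈ Finset.range R,
            V (i + 1 + q + 1) (x (j + 1 + q) - x (j - 1 - i))
        + ∑ q ∈ Finset.range R, ∑ a ∈ Finset.range q,
            V (q - a) (x (j + 1 + q) - x (j + 1 + a)) := by
    have h1 : ∀ q ∈ Finset.range R,
        ∑ a ∈ Finset.range (j + 1 + q), V (j + 1 + q - a) (x (j + 1 + q) - x a)
        = ∑ i ∈ Finset.range j, V (i + 1 + q + 1) (x (j + 1 + q) - x (j - 1 - i))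
          + V (q + 1) (x (j + 1 + q) - x j)
          + ∑ a ∈ Finset.range q, V (q - a) (x (j + 1 + q) - x (j + 1 + a)) := by
      intro q _
      rw [Finset.sum_range_add, Finset.sum_range_succ, ← Finset.sum_range_reflect]
      congr 1
      · congr 1
        · refine Finset.sum_congr rfl fun i hi => ?_
          have hi' := Finset.mem_range.1 hi
          rw [show j + 1 + q - (j - 1 - i) = i + 1 + q + 1 by omega]
        · rw [show j + 1 + q - j = q + 1 by omega]
      · refine Finset.sum_congr rfl fun a _ => ?_
        rw [show j + 1 + q - (j + 1 + a) = q - a by omega]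
    have h2 : ∑ a ∈ Finset.range j, V (j - a) (x j - x a)
        = ∑ i ∈ Finset.range j, V (i + 1) (x j - x (j - 1 - i)) := by
      rw [← Finset.sum_range_reflect]
      refine Finset.sum_congr rfl fun i hi => ?_
      have hi' := Finset.mem_range.1 hi
      rw [show j - (j - 1 - i) = i + 1 by omega]
    rw [Finset.sum_range_add, Finset.sum_range_succ, Finset.sum_congr rfl h1, h2,
      Finset.sum_add_distrib, Finset.sum_add_distrib, Finset.sum_comm (s := Finset.range R)]
    ring
  have hdec' : ∑ b ∈ Finset.range (j + R), ∑ a ∈ Finset.range b,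
        V (b - a) (removedPosition z j b - removedPosition z j a)
      = ∑ b ∈ Finset.range j, ∑ a ∈ Finset.range b, V (b - a) (x b - x a)
        + ∑ i ∈ Finset.range j, ∑ q ∈ Finset.range R,
            V (i + 1 + q) (x (j + 1 + q) - x (j - 1 - i))
        + ∑ q ∈ Finset.range R, ∑ a ∈ Finset.range q,
            V (q - a) (x (j + 1 + q) - x (j + 1 + a)) := by
    have hp1 : ∀ b, b < j → removedPosition z j b = x b := fun b hb => if_pos hb
    have hp2 : ∀ q, removedPosition z j (j + q) = x (j + 1 + q) := fun q => by
      rw [removedPosition, if_neg (by omega), show j + q + 1 = j + 1 + q by omega]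
    have h1 : ∀ q ∈ Finset.range R, ∑ a ∈ Finset.range (j + q),
          V (j + q - a) (removedPosition z j (j + q) - removedPosition z j a)
        = ∑ i ∈ Finset.range j, V (i + 1 + q) (x (j + 1 + q) - x (j - 1 - i))
          + ∑ a ∈ Finset.range q, V (q - a) (x (j + 1 + q) - x (j + 1 + a)) := by
      intro q _
      rw [Finset.sum_range_add, ← Finset.sum_range_reflect]
      congr 1
      · refine Finset.sum_congr rfl fun i hi => ?_
        have hi' := Finset.mem_range.1 hi
        rw [hp2, hp1 _ (by omega), show j + q - (j - 1 - i) = i + 1 + q by omega]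
      · refine Finset.sum_congr rfl fun a _ => ?_
        rw [hp2, hp2, show j + q - (j + a) = q - a by omega]
    have h2 : ∀ b ∈ Finset.range j, ∑ a ∈ Finset.range b,
        V (b - a) (removedPosition z j b - removedPosition z j a)
        = ∑ a ∈ Finset.range b, V (b - a) (x b - x a) := by
      intro b hb
      have hb' := Finset.mem_range.1 hb
      refine Finset.sum_congr rfl fun a ha => ?_
      have ha' := Finset.mem_range.1 ha
      rw [hp1 b hb', hp1 a (by omega)]
    rw [Finset.sum_range_add, Finset.sum_congr rfl h1, Finset.sum_congr rfl h2,
      Finset.sum_add_distrib, Finset.sum_comm (s := Finset.range R)]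
    ring
  have hlen : position (removeParticle z j) (j + R - 1) ≤ x (j + R) := by
    rw [position_removeParticle, removedPosition, if_neg (by omega),
      show j + R - 1 + 1 = j + R by omega]
    have h0 : 0 ≤ removedPosition z j 0 := by
      rw [removedPosition]
      split_ifs
      · simp [position]
      · have := hdist 0 1 (by omega)
        have h00 : x 0 = 0 := by simp [hx, position]
        push_cast at this
        rw [← hx]
        linarith
    linarith
  rw [chain_eq_position, chain_eq_position]
  have hpos : ∀ b a, position (removeParticle z j) b - position (removeParticle z j) a
      = removedPosition z j b - removedPosition z j a := fun b a => by
    rw [position_removeParticle, position_removeParticle]; ring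
  simp only [hpos]
  rw [hdec', hdec, show j + 1 + R - 1 = j + R by omega]
  simp only [Finset.sum_add_distrib, Finset.sum_sub_distrib] at hleft
  have := mul_le_mul_of_nonneg_left hlen hp
  linarith

end

/-! ### Relocation of a particle to the end of the chain -/

section
variable {v : ℝ → ℝ} {rhc zmin zmax α₁ α₂ s : ℝ}

theorem exists_chain_add_le (hv : IsAdmissible v rhc zmin zmax α₁ α₂ s) {m : ℕ∞} (hm : 1 ≤ m)
    {p : ℝ} (hp : 0 ≤ p) {N j : ℕ} (hjN : j + 1 < N) {z : ℕ → ℝ}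
    (hz : ∀ l, l + 1 < N → rhc < z l) (hmin : ∀ l, l + 1 < N → z j ≤ z l) (hj : z j < zmin) :
    chain (cutoff v m) p N (consSpacing zmax (removeParticle z j)) - (v zmax + p * zmax)
      ≤ chain (cutoff v m) p N z := by
  obtain ⟨R, rfl⟩ : ∃ R, N = j + 1 + (R + 1) := ⟨N - (j + 2), by omega⟩
  have h1 := chain_remove_le hv hm hp (j := j) (R := R + 1) (by omega)
    (fun l hl => hz l (by omega)) (fun l hl => hmin l (by omega)) hj
  have h2 := chain_cons_le hv hm p (n := j + R) (z := removeParticle z j) (fun l hl =>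
    hv.rhc_nonneg.trans
      (lt_removeParticle hv.rhc_nonneg (hz l (by omega)) (hz (l + 1) (by omega))).le)
  rw [show j + 1 + (R + 1) = j + R + 2 by omega] at h1 ⊢
  rw [show j + (R + 1) = j + R + 1 by omega] at h1
  linarith

/-! ### Uniform bounds for the family of potentials -/

theorem summable_pow_mul_rpow {r C t : ℝ} {d : ℕ} (hr : 0 < r) (ht : 1 + d < t) :
    Summable fun k : ℕ => (k : ℝ) ^ d * (C * ((k : ℝ) * r) ^ (-t)) := by
  have h1 : Summable fun k : ℕ => (k : ℝ) ^ (d - t) * (C * r ^ (-t)) :=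
    (Real.summable_nat_rpow.2 (by linarith)).mul_right _
  refine h1.congr_cofinite ?_
  rw [Nat.cofinite_eq_atTop]
  filter_upwards [eventually_gt_atTop 0] with k hk
  have hk' : (0 : ℝ) < k := by exact_mod_cast hk
  rw [Real.mul_rpow hk'.le hr.le, sub_eq_add_neg, Real.rpow_add hk', Real.rpow_natCast]
  ring

theorem abs_cutoff_le {f : ℝ → ℝ} {C t r : ℝ} (hC : 0 ≤ C) (ht : 0 ≤ t) (hr : 0 < r)
    (hf : ∀ x, r ≤ x → |f x| ≤ C * x ^ (-t)) (m : ℕ∞) {k : ℕ} {x : ℝ}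
    (hx : (k : ℝ) * r ≤ x) : |cutoff f m k x| ≤ C * ((k : ℝ) * r) ^ (-t) := by
  rcases Nat.eq_zero_or_pos k with rfl | hk
  · rw [cutoff_zero, abs_zero]; positivity
  have hk1 : (1 : ℝ) ≤ k := by exact_mod_cast hk
  rcases cutoff_cases f m k with h | h
  · rw [h]
    refine (hf x (by nlinarith)).trans (mul_le_mul_of_nonneg_left ?_ hC)
    exact Real.rpow_le_rpow_of_nonpos (by positivity) hx (by linarith)
  · rw [h, abs_zero]; positivity

theorem IsAdmissible.exists_decay (hv : IsAdmissible v rhc zmin zmax α₁ α₂ s) (m : ℕ∞) {r : ℝ}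
    (hr : rhc < r) : ∃ G : ℕ → ℝ, (∀ k, 0 ≤ G k) ∧ (Summable fun k : ℕ => (k : ℝ) * G k) ∧
      ∀ (k : ℕ) (x : ℝ), (k : ℝ) * r ≤ x → |cutoff v m k x| ≤ G k := by
  have hr0 : 0 < r := lt_of_le_of_lt hv.rhc_nonneg hr
  obtain ⟨C, hC, hb⟩ := hv.exists_bound hr
  refine ⟨fun k => C * ((k : ℝ) * r) ^ (-s), fun k => by positivity, ?_, fun k x hx =>
    abs_cutoff_le hC (by linarith [hv.two_lt_s]) hr0 hb m hx⟩
  have := summable_pow_mul_rpow (C := C) (t := s) (d := 1) hr0 (by norm_num; exact hv.two_lt_s)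
  simpa using this

theorem IsAdmissible.exists_decay_deriv (hv : IsAdmissible v rhc zmin zmax α₁ α₂ s) (m : ℕ∞)
    {r : ℝ} (hr : rhc < r) : ∃ G : ℕ → ℝ, (∀ k, 0 ≤ G k) ∧
      (Summable fun k : ℕ => (k : ℝ) ^ 2 * G k) ∧
      ∀ (k : ℕ) (x : ℝ), (k : ℝ) * r ≤ x → |cutoff (deriv v) m k x| ≤ G k := by
  have hr0 : 0 < r := lt_of_le_of_lt hv.rhc_nonneg hr
  obtain ⟨C, hC, hb⟩ := hv.exists_bound_deriv hr
  simp only [← neg_add'] at hb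
  refine ⟨fun k => C * ((k : ℝ) * r) ^ (-(s + 1)), fun k => by positivity, ?_, fun k x hx =>
    abs_cutoff_le hC (by linarith [hv.two_lt_s]) hr0 hb m hx⟩
  exact summable_pow_mul_rpow hr0 (by push_cast; linarith [hv.two_lt_s])

/-- Mean value inequality applied to `v ξ - v'(ka) ξ`: between `x` and `y` its derivative is at most
`B k` times the distance to `k * a`, because `v''` decays like `x ^ (-s - 2)`. -/
theorem IsAdmissible.exists_taylor (hv : IsAdmissible v rhc zmin zmax α₁ α₂ s) (m : ℕ∞)
    {r a : ℝ} (hr : rhc < r) (hra : r ≤ a) : ∃ B : ℕ → ℝ, (∀ k, 0 ≤ B k) ∧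
      (Summable fun k : ℕ => (k : ℝ) ^ 2 * B k) ∧
      ∀ (k : ℕ) (x y : ℝ), 1 ≤ k → (k : ℝ) * r ≤ x → (k : ℝ) * r ≤ y →
        |cutoff v m k x - cutoff v m k y - cutoff (deriv v) m k (k * a) * (x - y)|
          ≤ B k * (|x - y| * (|x - k * a| + |y - k * a|)) := by
  have hr0 : 0 < r := lt_of_le_of_lt hv.rhc_nonneg hr
  obtain ⟨C, hC, hb⟩ := hv.exists_bound_deriv2 hr
  simp only [← neg_add'] at hb
  refine ⟨fun k => C * ((k : ℝ) * r) ^ (-(s + 2)), fun k => by positivity, ?_, ?_⟩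
  · exact summable_pow_mul_rpow hr0 (by push_cast; linarith [hv.two_lt_s])
  intro k x y hk hx hy
  have hk1 : (1 : ℝ) ≤ k := by exact_mod_cast hk
  have hkr : r ≤ k * r := by nlinarith
  have hka : k * r ≤ k * a := by nlinarith
  set B := C * ((k : ℝ) * r) ^ (-(s + 2)) with hB
  have hB0 : 0 ≤ B := by positivity
  by_cases hkm : (k : ℕ∞) ≤ m
  swap
  · simp only [cutoff_of_not_le _ hkm]
    simp only [sub_self, zero_mul, abs_zero]
    positivity
  simp only [cutoff_of_le _ hk hkm]
  have hd2 : ∀ ξ ∈ Set.Ici ((k : ℝ) * r), ‖deriv (deriv v) ξ‖ ≤ B := by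
    intro ξ hξ
    refine (hb ξ (hkr.trans hξ)).trans (mul_le_mul_of_nonneg_left ?_ hC)
    exact Real.rpow_le_rpow_of_nonpos (by positivity) hξ (by linarith [hv.two_lt_s])
  have hd1 : ∀ ξ ∈ Set.Ici ((k : ℝ) * r), |deriv v ξ - deriv v (k * a)| ≤ B * |ξ - k * a| := by
    intro ξ hξ
    exact (convex_Ici ((k : ℝ) * r)).norm_image_sub_le_of_norm_deriv_le
      (fun η hη => (hv.hasDerivAt_deriv (by linarith [Set.mem_Ici.1 hη])).differentiableAt)
      hd2 hka hξ
  have hseg : Set.uIcc y x ⊆ Set.Ici ((k : ℝ) * r) := fun ξ hξ =>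
    (le_inf hy hx).trans hξ.1
  have hder : ∀ ξ ∈ Set.uIcc y x, HasDerivWithinAt (fun ξ => v ξ - deriv v (k * a) * ξ)
      (deriv v ξ - deriv v (k * a)) (Set.uIcc y x) ξ := by
    intro ξ hξ
    have h1 := hv.hasDerivAt (x := ξ) (by linarith [Set.mem_Ici.1 (hseg hξ)])
    have h2 := h1.sub ((hasDerivAt_id ξ).const_mul (deriv v (k * a)))
    refine (h2.congr_deriv ?_).hasDerivWithinAt
    ring
  have := (convex_uIcc y x).norm_image_sub_le_of_norm_hasDerivWithin_le
    (C := B * (|x - k * a| + |y - k * a|)) hder ?_ Set.left_mem_uIcc Set.right_mem_uIcc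
  · rw [Real.norm_eq_abs, Real.norm_eq_abs] at this
    calc _ = |v x - deriv v (k * a) * x - (v y - deriv v (k * a) * y)| := by congr 1; ring
      _ ≤ _ := this
      _ = _ := by ring
  · intro ξ hξ
    refine (hd1 ξ (hseg hξ)).trans (mul_le_mul_of_nonneg_left ?_ hB0)
    rcases Set.mem_uIcc.1 hξ with ⟨h1, h2⟩ | ⟨h1, h2⟩
    · rcases abs_cases (ξ - k * a) with h | h <;>
      linarith [le_abs_self (x - k * a), neg_abs_le (y - k * a), abs_nonneg (x - k * a),
        abs_nonneg (y - k * a)]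
    · rcases abs_cases (ξ - k * a) with h | h <;>
      linarith [le_abs_self (y - k * a), neg_abs_le (x - k * a), abs_nonneg (x - k * a),
        abs_nonneg (y - k * a)]

/-- The convexity constants of the potentials between `k`-th neighbours. -/
def convexityConst (v : ℝ → ℝ) (zmin zmax : ℝ) : ℕ → ℝ
  | 0 => 0
  | 1 => deriv (deriv v) zmax
  | k + 2 => deriv (deriv v) (((k : ℝ) + 2) * zmin)

/-- The convexity constant of the chain. -/
def convexityModulus (v : ℝ → ℝ) (zmin zmax : ℝ) : ℝ :=
  ∑' k : ℕ, (k : ℝ) ^ 2 * convexityConst v zmin zmax k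

theorem IsAdmissible.convexityConst_nonpos (hv : IsAdmissible v rhc zmin zmax α₁ α₂ s) {k : ℕ}
    (hk : 2 ≤ k) : convexityConst v zmin zmax k ≤ 0 := by
  obtain ⟨k, rfl⟩ : ∃ l, k = l + 2 := ⟨k - 2, by omega⟩
  refine hv.deriv2_nonpos _ ?_
  have : (0 : ℝ) ≤ k := Nat.cast_nonneg k
  nlinarith [hv.zmin_pos]

theorem IsAdmissible.summable_convexityConst (hv : IsAdmissible v rhc zmin zmax α₁ α₂ s) :
    Summable fun k : ℕ => (k : ℝ) ^ 2 * convexityConst v zmin zmax k := by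
  obtain ⟨C, hC, hb⟩ := hv.exists_bound_deriv2 hv.rhc_lt_zmin
  simp only [← neg_add'] at hb
  have h1 := summable_pow_mul_rpow (C := C) (t := s + 2) (d := 2) hv.zmin_pos
    (by push_cast; linarith [hv.two_lt_s])
  rw [← summable_nat_add_iff 2] at h1 ⊢
  refine Summable.of_norm_bounded h1 fun k => ?_
  rw [Real.norm_eq_abs, abs_mul, abs_of_nonneg (sq_nonneg _)]
  refine mul_le_mul_of_nonneg_left ?_ (sq_nonneg _)
  have h2 := hb (((k : ℝ) + 2) * zmin) (by
    have : (0 : ℝ) ≤ k := Nat.cast_nonneg k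
    nlinarith [hv.zmin_pos])
  push_cast
  exact h2

theorem IsAdmissible.convexityModulus_pos (hv : IsAdmissible v rhc zmin zmax α₁ α₂ s) :
    0 < convexityModulus v zmin zmax := by
  rw [convexityModulus, ← hv.summable_convexityConst.sum_add_tsum_nat_add 2]
  have := hv.deriv2_sum_pos
  simpa [Finset.sum_range_succ, convexityConst] using this

/-- The minimum of `v''` is at `zmax` on the box and at `k * zmin` on `[k * zmin, ∞)` for `k ≥ 2`.
For a switched-off interaction the inequality holds since the constant is nonpositive. -/
theorem IsAdmissible.cutoff_convexity (hv : IsAdmissible v rhc zmin zmax α₁ α₂ s) {m : ℕ∞}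
    (hm : 1 ≤ m) {k : ℕ} {x y t u : ℝ} (ht : 0 ≤ t) (hu : 0 ≤ u) (htu : t + u = 1)
    (hx : (k : ℝ) * zmin ≤ x) (hx' : x ≤ k * zmax) (hy : (k : ℝ) * zmin ≤ y)
    (hy' : y ≤ k * zmax) : cutoff v m k (t * x + u * y)
      ≤ t * cutoff v m k x + u * cutoff v m k y
        - convexityConst v zmin zmax k / 2 * (t * u * (x - y) ^ 2) := by
  have hz := hv.zmin_pos
  match k with
  | 0 => simp [cutoff_zero, convexityConst]
  | 1 =>
    simp only [cutoff_one v hm]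
    simp only [Nat.cast_one, one_mul] at hx hy hx' hy'
    exact quadratic_convexity (convex_Icc zmin zmax)
      (fun x hx => hv.hasDerivAt (lt_of_lt_of_le hv.rhc_lt_zmin hx.1))
      (fun x hx => hv.hasDerivAt_deriv (lt_of_lt_of_le hv.rhc_lt_zmin hx.1))
      (fun x hx => hv.deriv2_antitone hx ⟨hv.zmin_lt_zmax.le, le_rfl⟩ hx.2)
      ⟨hx, hx'⟩ ⟨hy, hy'⟩ ht hu htu
  | k + 2 =>
    rcases cutoff_cases v m (k + 2) with h | h
    · simp only [h]
      have hk : 2 * zmin ≤ ((k : ℝ) + 2) * zmin := by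
        have : (0 : ℝ) ≤ k := Nat.cast_nonneg k
        nlinarith
      push_cast at hx hy
      exact quadratic_convexity (convex_Ici (((k : ℝ) + 2) * zmin))
        (fun x hx => hv.hasDerivAt (by linarith [Set.mem_Ici.1 hx, hv.rhc_lt_zmin]))
        (fun x hx => hv.hasDerivAt_deriv (by linarith [Set.mem_Ici.1 hx, hv.rhc_lt_zmin]))
        (fun x hx => hv.deriv2_monotone (Set.mem_Ici.2 hk)
          (Set.mem_Ici.2 (hk.trans hx)) hx) hx hy ht hu htu
    · simp only [h]
      have h1 := hv.convexityConst_nonpos (k := k + 2) (by omega)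
      have h2 : 0 ≤ t * u * (x - y) ^ 2 := by positivity
      nlinarith

theorem chain_box_convexity (hv : IsAdmissible v rhc zmin zmax α₁ α₂ s) {m : ℕ∞}
    (hm : 1 ≤ m) (p : ℝ) {L : ℕ} {z w : ℕ → ℝ} {t u : ℝ} (ht : 0 ≤ t) (hu : 0 ≤ u)
    (htu : t + u = 1) (hz : ∀ l, l < L → z l ∈ Set.Icc zmin zmax)
    (hw : ∀ l, l < L → w l ∈ Set.Icc zmin zmax) :
    chain (cutoff v m) p (L + 1) (fun l => t * z l + u * w l)
      ≤ t * chain (cutoff v m) p (L + 1) z + u * chain (cutoff v m) p (L + 1) w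
        - convexityModulus v zmin zmax / 2
          * (t * u * ∑ l ∈ Finset.range L, (z l - w l) ^ 2) := by
  refine chain_strong_convexity (cutoff_zero v m) (fun k hk => hv.convexityConst_nonpos hk)
    hv.summable_convexityConst ht hu fun k i _ hik => ?_
  have hub : ∀ y : ℕ → ℝ, (∀ l, l < L → y l ∈ Set.Icc zmin zmax) → win y i k ≤ k * zmax := by
    intro y hy
    rw [← win_const zmax i k]
    exact win_le_win fun l hl => (hy _ (by omega)).2
  exact hv.cutoff_convexity hm ht hu htu (mul_le_win fun l hl => (hz _ (by omega)).1) (hub z hz)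
    (mul_le_win fun l hl => (hw _ (by omega)).1) (hub w hw)

end

/-! ### The bulk energy -/

section
variable {v : ℝ → ℝ} {rhc zmin zmax α₁ α₂ s : ℝ}

theorem bulkEnergy_eq (v : ℝ → ℝ) (m : ℕ∞) (p r : ℝ) :
    bulkEnergy v m p r = p * r + ∑' k : ℕ, cutoff v m k (k * r) := rfl

theorem IsAdmissible.summable_cutoff (hv : IsAdmissible v rhc zmin zmax α₁ α₂ s) (m : ℕ∞) {r : ℝ}
    (hr : rhc < r) {x : ℕ → ℝ} (hx : ∀ k : ℕ, (k : ℝ) * r ≤ x k) :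
    Summable fun k : ℕ => cutoff v m k (x k) := by
  obtain ⟨G, hG0, hG, hb⟩ := hv.exists_decay m hr
  rw [← summable_nat_add_iff 1]
  refine Summable.of_norm_bounded ((summable_nat_add_iff 1).2 hG) fun k => ?_
  refine (hb (k + 1) _ (hx _)).trans ?_
  have : (1 : ℝ) ≤ ((k + 1 : ℕ) : ℝ) := by exact_mod_cast Nat.succ_pos k
  nlinarith [hG0 (k + 1)]

theorem IsAdmissible.hasDerivAt_bulkEnergy (hv : IsAdmissible v rhc zmin zmax α₁ α₂ s) (m : ℕ∞)
    (p : ℝ) {x : ℝ} (hx : rhc < x) : HasDerivAt (bulkEnergy v m p)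
      (p + ∑' k : ℕ, (k : ℝ) * cutoff (deriv v) m k (k * x)) x := by
  obtain ⟨r, hr, hrx⟩ := exists_between hx
  have hr0 : 0 < r := lt_of_le_of_lt hv.rhc_nonneg hr
  obtain ⟨G, hG0, hG, hb⟩ := hv.exists_decay_deriv m hr
  have hle : ∀ y ∈ Set.Ioi r, ∀ k : ℕ, (k : ℝ) * r ≤ k * y := fun y hy k =>
    mul_le_mul_of_nonneg_left (le_of_lt hy) (Nat.cast_nonneg k)
  have h := hasDerivAt_tsum_of_isPreconnected (u := fun k : ℕ => (k : ℝ) ^ 2 * G k)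
    (g := fun (k : ℕ) y => cutoff v m k (k * y))
    (g' := fun (k : ℕ) y => (k : ℝ) * cutoff (deriv v) m k (k * y)) hG isOpen_Ioi
    (convex_Ioi r).isPreconnected ?_ ?_ hrx (hv.summable_cutoff m hr (hle x hrx)) hrx
  · have h1 := ((hasDerivAt_id x).const_mul p).add h
    simp only [mul_one] at h1
    exact h1
  · intro k y hy
    rcases Nat.eq_zero_or_pos k with rfl | hk
    · simp only [cutoff_zero, mul_zero]
      exact hasDerivAt_const _ _
    by_cases hkm : (k : ℕ∞) ≤ m
    · simp only [cutoff_of_le _ hk hkm]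
      have hk1 : (1 : ℝ) ≤ k := by exact_mod_cast hk
      have hky : rhc < k * y := by
        have : r < y := hy
        nlinarith
      have h1 := (hv.hasDerivAt hky).comp y ((hasDerivAt_id y).const_mul (k : ℝ))
      refine h1.congr_deriv ?_
      ring
    · simp only [cutoff_of_not_le _ hkm, mul_zero]
      exact hasDerivAt_const _ _
  · intro k y hy
    rw [Real.norm_eq_abs, abs_mul, Nat.abs_cast]
    refine mul_le_mul ?_ (hb k _ (hle y hy k)) (abs_nonneg _) (sq_nonneg _)
    exact_mod_cast Nat.le_self_pow two_ne_zero k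

theorem IsAdmissible.bulkEnergy_convexity (hv : IsAdmissible v rhc zmin zmax α₁ α₂ s) {m : ℕ∞}
    (hm : 1 ≤ m) (p : ℝ) {x y t u : ℝ} (hx : x ∈ Set.Icc zmin zmax) (hy : y ∈ Set.Icc zmin zmax)
    (ht : 0 ≤ t) (hu : 0 ≤ u) (htu : t + u = 1) : bulkEnergy v m p (t * x + u * y)
      ≤ t * bulkEnergy v m p x + u * bulkEnergy v m p y
        - convexityModulus v zmin zmax / 2 * (t * u * (x - y) ^ 2) := by
  have hsum : ∀ x, zmin ≤ x → Summable fun k : ℕ => cutoff v m k (k * x) := fun x hx =>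
    hv.summable_cutoff m hv.rhc_lt_zmin fun k => mul_le_mul_of_nonneg_left hx (Nat.cast_nonneg k)
  have hxy : zmin ≤ t * x + u * y := by
    have h1 := mul_le_mul_of_nonneg_left hx.1 ht
    have h2 := mul_le_mul_of_nonneg_left hy.1 hu
    have h3 : t * zmin + u * zmin = zmin := by rw [← add_mul, htu, one_mul]
    linarith
  have hR := (((hsum x hx.1).hasSum.mul_left t).add ((hsum y hy.1).hasSum.mul_left u)).sub
    (hv.summable_convexityConst.hasSum.mul_right (t * u * (x - y) ^ 2 / 2))
  have hle := hasSum_le (fun k => ?_) (hsum _ hxy).hasSum hR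
  · simp only [bulkEnergy_eq]
    rw [convexityModulus]
    linarith
  · have h := hv.cutoff_convexity (k := k) hm ht hu htu
      (mul_le_mul_of_nonneg_left hx.1 (Nat.cast_nonneg k))
      (mul_le_mul_of_nonneg_left hx.2 (Nat.cast_nonneg k))
      (mul_le_mul_of_nonneg_left hy.1 (Nat.cast_nonneg k))
      (mul_le_mul_of_nonneg_left hy.2 (Nat.cast_nonneg k))
    have e1 : t * (k * x) + u * (k * y) = k * (t * x + u * y) := by ring
    rw [e1] at h
    refine h.trans (le_of_eq ?_)
    ring

theorem IsAdmissible.add_mul_zmax_neg (hv : IsAdmissible v rhc zmin zmax α₁ α₂ s) {p : ℝ}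
    (hp : p < |v zmax| / zmax) : v zmax + p * zmax < 0 := by
  rw [lt_div_iff₀ hv.zmax_pos, abs_of_neg hv.v_zmax_neg] at hp
  linarith

theorem IsAdmissible.bulkEnergy_zmax_neg (hv : IsAdmissible v rhc zmin zmax α₁ α₂ s) {m : ℕ∞}
    (hm : 1 ≤ m) {p : ℝ} (hp : p < |v zmax| / zmax) : bulkEnergy v m p zmax < 0 := by
  have hz := hv.zmax_pos
  have hs := hv.summable_cutoff m (hv.rhc_lt_zmin.trans hv.zmin_lt_zmax)
    (x := fun k : ℕ => k * zmax) fun k => le_rfl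
  rw [bulkEnergy_eq, ← hs.sum_add_tsum_nat_add 2]
  have h1 : ∑' k : ℕ, cutoff v m (k + 2) ((k + 2 : ℕ) * zmax) ≤ 0 := by
    refine tsum_nonpos fun k => ?_
    rcases cutoff_cases v m (k + 2) with h | h
    · rw [h]
      refine hv.nonpos_of_zmax_le ?_
      push_cast
      have : (0 : ℝ) ≤ k := Nat.cast_nonneg k
      nlinarith
    · rw [h]
  have h2 := hv.add_mul_zmax_neg hp
  simp only [Finset.sum_range_succ, Finset.sum_range_zero, cutoff_zero, cutoff_one v hm]
  simp only [Nat.cast_one, one_mul]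
  linarith

/-- The repulsion hypothesis is stronger than needed here: it covers two tails and `v zmax < 0`, of
which only one tail occurs. -/
theorem IsAdmissible.bulkEnergy_pos (hv : IsAdmissible v rhc zmin zmax α₁ α₂ s) {m : ℕ∞}
    (hm : 1 ≤ m) {p : ℝ} (hp : 0 ≤ p) {r : ℝ} (hr : rhc < r) (hr' : r < zmin) :
    0 < bulkEnergy v m p r := by
  have hr0 : 0 < r := lt_of_le_of_lt hv.rhc_nonneg hr
  have hs := hv.summable_cutoff m hr (x := fun k : ℕ => k * r) fun k => le_rfl
  have hsum : Summable fun n : ℕ => -α₁ * (((n : ℝ) + 2) * r) ^ (-s) := by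
    have h1 := (summable_nat_add_iff 2).2 (summable_pow_mul_rpow (C := -α₁) (d := 0) (t := s) hr0
      (by norm_num; linarith [hv.two_lt_s]))
    simpa using h1
  have hs2 : Summable fun k : ℕ => cutoff v m (k + 2) ((k + 2 : ℕ) * r) :=
    (summable_nat_add_iff (f := fun k : ℕ => cutoff v m k (k * r)) 2).2 hs
  have h1 : ∑' n : ℕ, -α₁ * (((n : ℝ) + 2) * r) ^ (-s)
      ≤ ∑' k : ℕ, cutoff v m (k + 2) ((k + 2 : ℕ) * r) := by
    refine hsum.tsum_le_tsum (fun k => ?_) hs2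
    rw [Nat.cast_add, Nat.cast_ofNat]
    rcases cutoff_cases v m (k + 2) with h | h
    · rw [h]
      refine hv.lower_bound _ ?_
      have : (0 : ℝ) ≤ k := Nat.cast_nonneg k
      nlinarith
    · rw [h]
      have : 0 ≤ α₁ * (((k : ℝ) + 2) * r) ^ (-s) := mul_nonneg hv.α₁_pos.le (by positivity)
      linarith
  rw [tsum_mul_left] at h1
  have h2 := hv.repulsion r hr hr'
  have h3 : 0 ≤ α₁ * ∑' n : ℕ, (((n : ℝ) + 2) * r) ^ (-s) :=
    mul_nonneg hv.α₁_pos.le (tsum_nonneg fun n => by positivity)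
  rw [bulkEnergy_eq, ← hs.sum_add_tsum_nat_add 2]
  simp only [Finset.sum_range_succ, Finset.sum_range_zero, cutoff_zero, cutoff_one v hm]
  simp only [Nat.cast_one, one_mul]
  have h4 := mul_nonneg hp hr0.le
  linarith [hv.v_zmax_neg]

theorem IsAdmissible.bulkEnergy_zmax_lt (hv : IsAdmissible v rhc zmin zmax α₁ α₂ s) {m : ℕ∞}
    (hm : 1 ≤ m) {p : ℝ} (hp : 0 ≤ p) {r : ℝ} (hr : zmax < r) :
    bulkEnergy v m p zmax < bulkEnergy v m p r := by
  have hz := hv.zmax_pos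
  have hrz := hv.rhc_lt_zmin.trans hv.zmin_lt_zmax
  have hlt : ∑' k : ℕ, cutoff v m k (k * zmax) < ∑' k : ℕ, cutoff v m k (k * r) := by
    refine Summable.tsum_lt_tsum (i := 1) (fun k => ?_) ?_
      (hv.summable_cutoff m hrz fun k => le_rfl)
      (hv.summable_cutoff m (hrz.trans hr) fun k => le_rfl)
    · rcases Nat.eq_zero_or_pos k with rfl | hk
      · simp [cutoff_zero]
      have hk1 : (1 : ℝ) ≤ k := by exact_mod_cast hk
      rcases cutoff_cases v m k with h | h
      · rw [h, h]
        exact hv.mono_of_zmax_le (by nlinarith) (by nlinarith)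
      · rw [h, h]
    · rw [cutoff_one v hm, cutoff_one v hm, Nat.cast_one, one_mul, one_mul]
      exact hv.zmax_unique_min r (hrz.trans hr) hr.ne'
  rw [bulkEnergy_eq, bulkEnergy_eq]
  have := mul_le_mul_of_nonneg_left hr.le hp
  linarith

/-- Below `zmin` the bulk energy is positive, at `zmax` it is negative and beyond `zmax` larger than
at `zmax`; inside the box it is strictly convex. -/
theorem IsAdmissible.exists_bulk_minimizer (hv : IsAdmissible v rhc zmin zmax α₁ α₂ s) {m : ℕ∞}
    (hm : 1 ≤ m) {p : ℝ} (hp₀ : 0 ≤ p) (hp : p < |v zmax| / zmax) :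
    ∃ a ∈ Set.Icc zmin zmax, (∀ r, rhc < r → r ≠ a → bulkEnergy v m p a < bulkEnergy v m p r) ∧
      p + ∑' k : ℕ, (k : ℝ) * cutoff (deriv v) m k (k * a) = 0 := by
  have hcont : ContinuousOn (bulkEnergy v m p) (Set.Icc zmin zmax) := fun x hx =>
    (hv.hasDerivAt_bulkEnergy m p
      (lt_of_lt_of_le hv.rhc_lt_zmin hx.1)).continuousAt.continuousWithinAt
  obtain ⟨a, ha, hmin⟩ := isCompact_Icc.exists_isMinOn
    (Set.nonempty_Icc.2 hv.zmin_lt_zmax.le) hcont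
  have hzmax : bulkEnergy v m p a ≤ bulkEnergy v m p zmax := hmin ⟨hv.zmin_lt_zmax.le, le_rfl⟩
  have hlt : ∀ r, rhc < r → r ≠ a → bulkEnergy v m p a < bulkEnergy v m p r := by
    intro r hr hra
    rcases lt_or_ge r zmin with h1 | h1
    · linarith [hv.bulkEnergy_pos hm hp₀ hr h1, hv.bulkEnergy_zmax_neg hm hp]
    rcases lt_or_ge zmax r with h2 | h2
    · linarith [hv.bulkEnergy_zmax_lt hm hp₀ h2]
    have h3 := hv.bulkEnergy_convexity hm p ha ⟨h1, h2⟩ (t := 1 / 2) (u := 1 / 2)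
      (by norm_num) (by norm_num) (by norm_num)
    have hmem : 1 / 2 * a + 1 / 2 * r ∈ Set.Icc zmin zmax :=
      ⟨by linarith [ha.1], by linarith [ha.2]⟩
    have h4 : bulkEnergy v m p a ≤ _ := hmin hmem
    have h5 : 0 < (a - r) ^ 2 := by
      have : a - r ≠ 0 := sub_ne_zero.2 (Ne.symm hra)
      positivity
    have h6 := mul_pos hv.convexityModulus_pos h5
    linarith
  refine ⟨a, ha, hlt, ?_⟩
  have harhc : rhc < a := lt_of_lt_of_le hv.rhc_lt_zmin ha.1
  -- Even if `a` is an endpoint of the box, it minimizes over all of `(rhc, ∞)`, so the derivative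
  -- vanishes.
  refine IsLocalMin.hasDerivAt_eq_zero ?_ (hv.hasDerivAt_bulkEnergy m p harhc)
  filter_upwards [Ioi_mem_nhds harhc] with r hr
  rcases eq_or_ne r a with rfl | h
  · exact le_rfl
  · exact (hlt r hr h).le

end

/-! ### Minimizers of finite chains -/

section
variable {v : ℝ → ℝ} {rhc zmin zmax α₁ α₂ s : ℝ}

theorem lt_win {z : ℕ → ℝ} {ρ : ℝ} (hρ : 0 ≤ ρ) {i k : ℕ} (hk : 1 ≤ k)
    (hz : ∀ l, l < k → ρ < z (i + l)) : ρ < win z i k := by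
  obtain ⟨k, rfl⟩ : ∃ k', k = 1 + k' := ⟨k - 1, by omega⟩
  rw [win_add, win_one]
  have h1 : (k : ℝ) * 0 ≤ win z (i + 1) k := mul_le_win fun l hl => by
    rw [add_assoc]
    exact hρ.trans (hz (1 + l) (by omega)).le
  have h2 := hz 0 (by omega)
  simp only [mul_zero, add_zero] at h1 h2
  linarith

theorem chainEnergy_eq_coe (hrhc : 0 ≤ rhc) (v : ℝ → ℝ) (m : ℕ∞) (p : ℝ) {N : ℕ} {z : ℕ → ℝ}
    (hz : ∀ l, l + 1 < N → rhc < z l) :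
    chainEnergy rhc v m p N z = (chain (cutoff v m) p N z : EReal) := by
  have hcoe : ∀ (S : Finset ℕ) (f : ℕ → ℝ), ((∑ i ∈ S, f i : ℝ) : EReal) = ∑ i ∈ S, (f i : EReal) :=
    fun S f => map_sum (⟨⟨Real.toEReal, EReal.coe_zero⟩, EReal.coe_add⟩ : ℝ →+ EReal) f S
  unfold chainEnergy chain
  rw [EReal.coe_add, hcoe]
  congr 1
  refine Finset.sum_congr rfl fun j hj => ?_
  rw [hcoe]
  refine Finset.sum_congr rfl fun i hi => ?_
  have hj' := Finset.mem_range.1 hj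
  have hi' := Finset.mem_range.1 hi
  have hw : ∑ l ∈ Finset.Ico i j, z l = win z i (j - i) := Finset.sum_Ico_eq_sum_range _ _ _
  rw [hw]
  by_cases h : ((j - i : ℕ) : ℕ∞) ≤ m
  · rw [if_pos h, cutoff_of_le v (by omega) h, pairPotential, if_neg]
    exact not_le.2 (lt_win hrhc (by omega) fun l hl => hz _ (by omega))
  · rw [if_neg h, cutoff_of_not_le v h, EReal.coe_zero]

theorem sum_ne_bot {ι : Type*} (S : Finset ι) {f : ι → EReal} (hf : ∀ i ∈ S, f i ≠ ⊥) :
    ∑ i ∈ S, f i ≠ ⊥ := by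
  classical
  induction S using Finset.induction_on with
  | empty => simp
  | insert a S ha ih =>
    rw [Finset.sum_insert ha]
    exact EReal.add_ne_bot_iff.2 ⟨hf a (Finset.mem_insert_self _ _),
      ih fun i hi => hf i (Finset.mem_insert_of_mem hi)⟩

theorem sum_eq_top {ι : Type*} {S : Finset ι} {f : ι → EReal} (hf : ∀ i ∈ S, f i ≠ ⊥) {i : ι}
    (hi : i ∈ S) (h : f i = ⊤) : ∑ i ∈ S, f i = ⊤ := by
  classical
  rw [← Finset.add_sum_erase S f hi, h]
  exact EReal.top_add_of_ne_bot (sum_ne_bot _ fun i hi => hf i (Finset.mem_of_mem_erase hi))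

theorem chainEnergy_eq_top (v : ℝ → ℝ) {m : ℕ∞} (hm : 1 ≤ m) (p : ℝ) {N l : ℕ} {z : ℕ → ℝ}
    (hl : l + 1 < N) (hz : z l ≤ rhc) : chainEnergy rhc v m p N z = ⊤ := by
  have hne : ∀ j i, (if ((j - i : ℕ) : ℕ∞) ≤ m then
      pairPotential rhc v (∑ l ∈ Finset.Ico i j, z l) else 0) ≠ ⊥ := by
    intro j i
    unfold pairPotential
    split_ifs <;> simp
  unfold chainEnergy
  rw [sum_eq_top (i := l + 1)]
  · exact EReal.top_add_coe _
  · exact fun j _ => sum_ne_bot _ fun i _ => hne j i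
  · exact Finset.mem_range.2 hl
  · refine sum_eq_top (i := l) (fun i _ => hne _ i) (by simp) ?_
    have h1 : ((l + 1 - l : ℕ) : ℕ∞) ≤ m := by simpa using hm
    rw [if_pos h1, pairPotential, if_pos (by simpa using hz)]

theorem le_chain (hv : IsAdmissible v rhc zmin zmax α₁ α₂ s) (m : ℕ∞) {p : ℝ} (hp : 0 ≤ p)
    (N : ℕ) {z : ℕ → ℝ} (hz : ∀ l, rhc < z l) :
    ∑ j ∈ Finset.range N, ∑ _i ∈ Finset.range j, v zmax ≤ chain (cutoff v m) p N z := by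
  have h1 : 0 ≤ p * ∑ l ∈ Finset.range (N - 1), z l :=
    mul_nonneg hp (Finset.sum_nonneg fun l _ => hv.rhc_nonneg.trans (hz l).le)
  have h2 : ∑ j ∈ Finset.range N, ∑ _i ∈ Finset.range j, v zmax
      ≤ ∑ j ∈ Finset.range N, ∑ i ∈ Finset.range j, cutoff v m (j - i) (win z i (j - i)) := by
    refine Finset.sum_le_sum fun j _ => Finset.sum_le_sum fun i hi => ?_
    have hi' := Finset.mem_range.1 hi
    rcases cutoff_cases v m (j - i) with h | h
    · rw [h]
      exact hv.zmax_le (lt_win hv.rhc_nonneg (by omega) fun l _ => hz _)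
    · rw [h]
      exact hv.v_zmax_neg.le
  unfold chain
  linarith

theorem continuousOn_chain (hv : IsAdmissible v rhc zmin zmax α₁ α₂ s) (m : ℕ∞) (p : ℝ) (N : ℕ) :
    ContinuousOn (chain (cutoff v m) p N) {z | ∀ l, rhc < z l} := by
  unfold chain
  refine ContinuousOn.add ?_ (Continuous.continuousOn (by fun_prop))
  refine continuousOn_finsetSum _ fun j _ => continuousOn_finsetSum _ fun i hi => ?_
  have hi' := Finset.mem_range.1 hi
  rcases cutoff_cases v m (j - i) with h | h
  · simp only [h]
    refine hv.continuousOn.comp (Continuous.continuousOn (by unfold win; fun_prop)) ?_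
    intro z hz
    exact lt_win hv.rhc_nonneg (by omega) fun l _ => hz _
  · simp only [h]
    exact continuousOn_const

/-- The box is compact, so a minimizer over the box exists. It is a global one because any
configuration close enough to the infimum can be clipped into the box. -/
theorem exists_chain_minimizer (hv : IsAdmissible v rhc zmin zmax α₁ α₂ s) {m : ℕ∞} (hm : 1 ≤ m)
    {p : ℝ} (hp₀ : 0 ≤ p) (hp : p < |v zmax| / zmax) {N : ℕ} (hN : 2 ≤ N) :
    ∃ z : ℕ → ℝ, (∀ l, z l ∈ Set.Icc zmin zmax) ∧
      ∀ w : ℕ → ℝ, (∀ l, rhc < w l) → chain (cutoff v m) p N z ≤ chain (cutoff v m) p N w := by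
  have hzz := hv.zmin_lt_zmax
  set K : Set (ℕ → ℝ) := Set.pi Set.univ fun _ => Set.Icc zmin zmax with hK
  have hKmem : ∀ z, z ∈ K ↔ ∀ l, z l ∈ Set.Icc zmin zmax := fun z => by
    simp only [hK, Set.mem_pi, Set.mem_univ, true_imp_iff]
  have hKc : IsCompact K := isCompact_univ_pi fun _ => isCompact_Icc
  have hKsub : K ⊆ {z | ∀ l, rhc < z l} := fun z hz l =>
    lt_of_lt_of_le hv.rhc_lt_zmin ((hKmem z).1 hz l).1
  obtain ⟨z, hzK, hmin⟩ := hKc.exists_isMinOn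
    ⟨fun _ => zmin, (hKmem _).2 fun _ => ⟨le_rfl, hzz.le⟩⟩
    ((continuousOn_chain hv m p N).mono hKsub)
  refine ⟨z, (hKmem z).1 hzK, ?_⟩
  set T : Set ℝ := chain (cutoff v m) p N '' {w | ∀ l, rhc < w l} with hT
  have hbdd : BddBelow T := ⟨_, by
    rintro _ ⟨w, hw, rfl⟩
    exact le_chain hv m hp₀ N hw⟩
  have hne : T.Nonempty := ⟨_, z, hKsub hzK, rfl⟩
  have hδ := hv.add_mul_zmax_neg hp
  suffices h : chain (cutoff v m) p N z ≤ sInf T from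
    fun w hw => h.trans (csInf_le hbdd ⟨w, hw, rfl⟩)
  refine le_of_forall_pos_lt_add fun ε hε => ?_
  obtain ⟨_, ⟨w, hw, rfl⟩, hwlt⟩ := exists_lt_of_csInf_lt hne
    -- The margin is also at most `-(v zmax + p * zmax)`: a short spacing would let relocation go
    -- below the infimum.
    (lt_add_of_pos_right (sInf T) (lt_min hε (neg_pos.2 hδ)))
  have hlow : ∀ l, l + 1 < N → zmin ≤ w l := by
    by_contra! hcon
    obtain ⟨l, hl, hlz⟩ := hcon
    obtain ⟨j, hj, hjmin⟩ := Finset.exists_min_image (Finset.range (N - 1)) w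
      ⟨l, Finset.mem_range.2 (by omega)⟩
    have hj' := Finset.mem_range.1 hj
    have h1 := exists_chain_add_le hv hm hp₀ (N := N) (j := j) (z := w) (by omega)
      (fun l _ => hw l) (fun l hl => hjmin l (Finset.mem_range.2 (by omega)))
      (lt_of_le_of_lt (hjmin l (Finset.mem_range.2 (by omega))) hlz)
    have h2 : sInf T ≤ chain (cutoff v m) p N (consSpacing zmax (removeParticle w j)) := by
      refine csInf_le hbdd ⟨_, fun l => ?_, rfl⟩
      match l with
      | 0 => exact hv.rhc_lt_zmin.trans hzz
      | l + 1 => exact lt_removeParticle hv.rhc_nonneg (hw l) (hw (l + 1))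
    have h3 := hwlt.trans_le (add_le_add_right (min_le_right ε _) _)
    linarith
  have h1 := chain_clip_le hv hm hp₀ hlow (j := 0) (by omega)
  have h2 : v (min (w 0) zmax) ≤ v (w 0) := by
    rcases le_total (w 0) zmax with h | h
    · rw [min_eq_left h]
    · rw [min_eq_right h]
      exact hv.zmax_le (hw 0)
  have h3 : chain (cutoff v m) p N (fun l => if l + 1 < N then min (w l) zmax else zmin)
      = chain (cutoff v m) p N (fun l => min (w l) zmax) :=
    chain_congr _ _ fun l hl => if_pos hl
  have h4 : chain (cutoff v m) p N z
      ≤ chain (cutoff v m) p N (fun l => if l + 1 < N then min (w l) zmax else zmin) := by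
    refine hmin ((hKmem _).2 fun l => ?_)
    split_ifs with hl
    · exact ⟨le_min (hlow l hl) hzz.le, min_le_right _ _⟩
    · exact ⟨le_rfl, hzz.le⟩
  have h5 := hwlt.trans_le (add_le_add_right (min_le_left ε _) _)
  linarith

theorem minEnergy_eq_coe (hv : IsAdmissible v rhc zmin zmax α₁ α₂ s) {m : ℕ∞} (hm : 1 ≤ m)
    {p : ℝ} {N : ℕ} {z : ℕ → ℝ} (hz : ∀ l, rhc < z l)
    (hmin : ∀ w : ℕ → ℝ, (∀ l, rhc < w l) →
      chain (cutoff v m) p N z ≤ chain (cutoff v m) p N w) :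
    minEnergy rhc v m p N = (chain (cutoff v m) p N z : EReal) := by
  refine le_antisymm ?_ ?_
  · refine (iInf₂_le z fun j => lt_of_le_of_lt hv.rhc_nonneg (hz j)).trans (le_of_eq ?_)
    exact chainEnergy_eq_coe hv.rhc_nonneg v m p fun l _ => hz l
  · refine le_iInf₂ fun w _ => ?_
    by_cases h : ∀ l, l + 1 < N → rhc < w l
    · rw [chainEnergy_eq_coe hv.rhc_nonneg v m p h, EReal.coe_le_coe_iff]
      rw [← chain_congr (z := fun l => if l + 1 < N then w l else zmin) _ _
        fun l hl => if_pos hl]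
      refine hmin _ fun l => ?_
      split_ifs with hl
      · exact h l hl
      · exact hv.rhc_lt_zmin
    · push Not at h
      obtain ⟨l, hl, hle⟩ := h
      rw [chainEnergy_eq_top v hm p hl hle]
      exact le_top

end

/-! ### Half-infinite chains -/

/-- The interaction energy across particle `n` of a half-infinite chain. -/
def crossEnergy (V : ℕ → ℝ → ℝ) (n : ℕ) (z : ℕ → ℝ) : ℝ :=
  ∑' x : ℕ × ℕ, if x.1 < n then V (x.1 + x.2 + 2) (win z (n - 1 - x.1) (x.1 + x.2 + 2)) else 0

/-- The interaction energy across a particle of the infinite chain with spacing `a`. -/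
def bulkCrossEnergy (V : ℕ → ℝ → ℝ) (a : ℝ) : ℝ :=
  ∑' x : ℕ × ℕ, V (x.1 + x.2 + 2) ((x.1 + x.2 + 2 : ℕ) * a)

theorem headEnergy_eq (v : ℝ → ℝ) (m : ℕ∞) (p : ℝ) (z : ℕ → ℝ) (j : ℕ) :
    headEnergy v m p (fun i => z (j + i)) = p * z j + ∑' k, cutoff v m k (win z j k) := rfl

theorem summable_nat_add_mul {G : ℕ → ℝ} (hG0 : ∀ k, 0 ≤ G k)
    (hG : Summable fun k : ℕ => (k : ℝ) * G k) :
    Summable fun n : ℕ => ((n : ℝ) + 1) * G (n + 2) := by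
  refine Summable.of_nonneg_of_le (fun n => mul_nonneg (by positivity) (hG0 _)) (fun n => ?_)
    ((summable_nat_add_iff 2).2 hG)
  push_cast
  nlinarith [hG0 (n + 2)]

theorem summable_antidiagonal {G : ℕ → ℝ} (hG0 : ∀ k, 0 ≤ G k)
    (hG : Summable fun k : ℕ => (k : ℝ) * G k) :
    Summable fun x : ℕ × ℕ => G (x.1 + x.2 + 2) :=
  (hasSum_antidiagonal (f := fun n => G (n + 2)) (summable_nat_add_mul hG0 hG)).summable

section
variable {v : ℝ → ℝ} {rhc zmin zmax α₁ α₂ s : ℝ}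

/-- Exactly `k - 1` pairs at label distance `k` straddle a given particle, so the cross energy is `∑
(k - 1) v(ka)`. -/
theorem bulkEnergy_add_bulkCrossEnergy (hv : IsAdmissible v rhc zmin zmax α₁ α₂ s) (m : ℕ∞)
    (p : ℝ) {a : ℝ} (ha : rhc < a) :
    bulkEnergy v m p a + bulkCrossEnergy (cutoff v m) a
      = p * a + sumTo m (fun k => k * v (k * a)) := by
  obtain ⟨G, hG0, hG, hb⟩ := hv.exists_decay m ha
  have hsum : Summable fun k : ℕ => (k : ℝ) * cutoff v m k (k * a) := by
    refine Summable.of_norm_bounded hG fun k => ?_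
    rw [Real.norm_eq_abs, abs_mul, Nat.abs_cast]
    exact mul_le_mul_of_nonneg_left (hb k _ le_rfl) (Nat.cast_nonneg k)
  have hs := hv.summable_cutoff m ha (x := fun k : ℕ => k * a) fun k => le_rfl
  have h1 : sumTo m (fun k => k * v (k * a)) = ∑' k : ℕ, (k : ℝ) * cutoff v m k (k * a) := by
    unfold sumTo cutoff
    refine tsum_congr fun k => ?_
    split_ifs <;> simp
  have hdiff : Summable fun k : ℕ => (k : ℝ) * cutoff v m k (k * a) - cutoff v m k (k * a) :=
    hsum.sub hs
  have h2 : bulkCrossEnergy (cutoff v m) a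
      = ∑' k : ℕ, (k : ℝ) * cutoff v m k (k * a) - ∑' k : ℕ, cutoff v m k (k * a) := by
    have h3 : HasSum (fun n : ℕ => ((n : ℝ) + 1) * cutoff v m (n + 2) ((n + 2 : ℕ) * a))
        (∑' k : ℕ, ((k : ℝ) * cutoff v m k (k * a) - cutoff v m k (k * a))) := by
      have h4 := (hasSum_nat_add_iff' 2).2 hdiff.hasSum
      simp only [Finset.sum_range_succ, Finset.sum_range_zero, cutoff_zero, Nat.cast_one, one_mul,
        mul_zero, sub_self, add_zero, sub_zero] at h4
      refine h4.congr_fun fun n => ?_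
      push_cast
      ring
    have h5 := hasSum_antidiagonal (f := fun n => cutoff v m (n + 2) ((n + 2 : ℕ) * a)) h3.summable
    rw [bulkCrossEnergy, h5.tsum_eq, h3.tsum_eq, hsum.tsum_sub hs]
  rw [h1, h2, bulkEnergy_eq]
  ring

theorem norm_cross_le {V : ℕ → ℝ → ℝ} {r : ℝ} {G : ℕ → ℝ} (hG0 : ∀ k, 0 ≤ G k)
    (hb : ∀ (k : ℕ) (x : ℝ), (k : ℝ) * r ≤ x → |V k x| ≤ G k) {z : ℕ → ℝ} (hz : ∀ l, r ≤ z l)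
    (P : Prop) [Decidable P] (i k : ℕ) : ‖if P then V k (win z i k) else 0‖ ≤ G k := by
  split_ifs
  · exact hb k _ (mul_le_win fun l _ => hz _)
  · simpa using hG0 k

/-- Only the first `n` head energies differ from the bulk value, and `sum_head` adds them up. -/
theorem surfaceEnergy_eq (hv : IsAdmissible v rhc zmin zmax α₁ α₂ s) (m : ℕ∞) (p : ℝ) {a r : ℝ}
    (hr : rhc < r) {z : ℕ → ℝ} (hz : ∀ l, r ≤ z l) {n : ℕ} (hn : ∀ l, n ≤ l → z l = a) :
    surfaceEnergy v m p (bulkEnergy v m p a) z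
      = chain (cutoff v m) p (n + 1) z + crossEnergy (cutoff v m) n z
        - n * bulkEnergy v m p a := by
  obtain ⟨G, hG0, hG, hb⟩ := hv.exists_decay m hr
  have hhead : ∀ j, n ≤ j → headEnergy v m p (fun i => z (j + i)) = bulkEnergy v m p a := by
    intro j hj
    rw [headEnergy_eq, bulkEnergy_eq, hn j hj]
    congr 1
    refine tsum_congr fun k => ?_
    rw [← win_const a j k]
    congr 1
    exact win_congr fun l _ => hn _ (by omega)
  have h1 : surfaceEnergy v m p (bulkEnergy v m p a) z
      = ∑ j ∈ Finset.range n, (headEnergy v m p (fun i => z (j + i)) - bulkEnergy v m p a) := by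
    refine tsum_eq_sum fun j hj => ?_
    rw [hhead j (by simpa using hj), sub_self]
  have hsm : Summable fun x : ℕ × ℕ => if x.1 < n then
      cutoff v m (x.1 + x.2 + 2) (win z (n - 1 - x.1) (x.1 + x.2 + 2)) else 0 :=
    Summable.of_norm_bounded (summable_antidiagonal hG0 hG) fun x => norm_cross_le hG0 hb hz _ _ _
  have h2 : crossEnergy (cutoff v m) n z = ∑ i ∈ Finset.range n,
      ∑' q, cutoff v m (i + q + 2) (win z (n - 1 - i) (i + q + 2)) := by
    rw [crossEnergy, hsm.tsum_prod, tsum_eq_sum (s := Finset.range n)]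
    · refine Finset.sum_congr rfl fun i hi => tsum_congr fun q => ?_
      exact if_pos (Finset.mem_range.1 hi)
    · intro i hi
      have hi' : ¬ i < n := by simpa using hi
      simp [hi']
  rw [h1, Finset.sum_sub_distrib, h2]
  simp only [headEnergy_eq]
  rw [sum_head (cutoff_zero v m) p n z fun j => hv.summable_cutoff m hr fun k =>
    mul_le_win fun l _ => hz _]
  simp

/-- Each fixed pair eventually sees only spacings `a`, and `G` gives a summable dominating function.
-/
theorem tendsto_crossEnergy (hv : IsAdmissible v rhc zmin zmax α₁ α₂ s) (m : ℕ∞) {a r : ℝ}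
    (hr : rhc < r) {z : ℕ → ℕ → ℝ} (hz : ∀ N l, r ≤ z N l) {n : ℕ → ℕ}
    (hn : ∀ i, ∀ᶠ N in atTop, i < n N ∧ ∀ l, n N ≤ l + 1 + i → z N l = a) :
    Tendsto (fun N => crossEnergy (cutoff v m) (n N) (z N)) atTop
      (𝓝 (bulkCrossEnergy (cutoff v m) a)) := by
  obtain ⟨G, hG0, hG, hb⟩ := hv.exists_decay m hr
  refine tendsto_tsum_of_dominated_convergence (summable_antidiagonal hG0 hG) ?_
    (Eventually.of_forall fun N x => norm_cross_le hG0 hb (hz N) _ _ _)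
  intro x
  refine tendsto_const_nhds.congr' ?_
  filter_upwards [hn x.1] with N hN
  rw [if_pos hN.1, ← win_const a 0]
  congr 1
  exact win_congr fun l _ => (hN.2 _ (by omega)).symm

theorem tendsto_chain_sub (hv : IsAdmissible v rhc zmin zmax α₁ α₂ s) (m : ℕ∞) (p : ℝ) {a r : ℝ}
    (hr : rhc < r) {z : ℕ → ℝ} (hz : ∀ l, r ≤ z l) {n₀ : ℕ} (hn : ∀ l, n₀ ≤ l → z l = a) :
    Tendsto (fun n : ℕ => chain (cutoff v m) p (n + 1) z - n * bulkEnergy v m p a) atTop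
      (𝓝 (surfaceEnergy v m p (bulkEnergy v m p a) z - bulkCrossEnergy (cutoff v m) a)) := by
  have h1 := tendsto_crossEnergy hv m (a := a) hr (z := fun _ => z) (fun _ => hz) (n := id)
    (fun i => by
      filter_upwards [eventually_gt_atTop (n₀ + i)] with N hN
      exact ⟨by simp only [id]; omega, fun l hl => hn l (by simp only [id] at hl; omega)⟩)
  refine (tendsto_const_nhds.sub h1).congr' ?_
  filter_upwards [eventually_ge_atTop n₀] with N hN
  rw [surfaceEnergy_eq hv m p hr hz (n := N) fun l hl => hn l (hN.trans hl)]
  simp only [id]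
  ring

/-- The interaction across the cut tends to the bulk value `Q`. Each surface energy contains in
addition the interaction of its half with the continuation by `a`, also tending to `Q`. The balance
is `Q - Q - Q = -Q`. -/
theorem tendsto_chain_glue (hv : IsAdmissible v rhc zmin zmax α₁ α₂ s) (m : ℕ∞) (p : ℝ) {a r : ℝ}
    (hr : rhc < r) (hra : r ≤ a) {y : ℕ → ℕ → ℝ} (hy : ∀ N l, r ≤ y N l) {n n' : ℕ → ℕ}
    (hn : ∀ i, ∀ᶠ N in atTop, i < n N ∧ i < n' N ∧
      ∀ l, n N ≤ l + 1 + i → l ≤ n N + i → y N l = a) :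
    Tendsto (fun N => chain (cutoff v m) p (n N + n' N + 1) (y N)
      - ((n N : ℝ) + n' N) * bulkEnergy v m p a
      - surfaceEnergy v m p (bulkEnergy v m p a) (fun l => if l < n N then y N l else a)
      - surfaceEnergy v m p (bulkEnergy v m p a)
        (fun l => if l < n' N then y N (n N + (n' N - 1 - l)) else a)) atTop
      (𝓝 (-bulkCrossEnergy (cutoff v m) a)) := by
  obtain ⟨G, hG0, hG, hb⟩ := hv.exists_decay m hr
  set w : ℕ → ℕ → ℝ := fun N l => if l < n N then y N l else a with hw
  set w' : ℕ → ℕ → ℝ := fun N l => if l < n' N then y N (n N + (n' N - 1 - l)) else a with hw'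
  have hwr : ∀ N l, r ≤ w N l := fun N l => by
    simp only [hw]; split_ifs; exacts [hy _ _, hra]
  have hwr' : ∀ N l, r ≤ w' N l := fun N l => by
    simp only [hw']; split_ifs; exacts [hy _ _, hra]
  have h1 := tendsto_crossEnergy hv m (a := a) hr (z := w) hwr (n := n) (fun i => by
    filter_upwards [hn i] with N hN
    refine ⟨hN.1, fun l hl => ?_⟩
    simp only [hw]
    split_ifs with h
    · exact hN.2.2 l hl (by omega)
    · rfl)
  have h2 := tendsto_crossEnergy hv m (a := a) hr (z := w') hwr' (n := n') (fun i => by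
    filter_upwards [hn i] with N hN
    refine ⟨hN.2.1, fun l hl => ?_⟩
    simp only [hw']
    split_ifs with h
    · exact hN.2.2 _ (by omega) (by omega)
    · rfl)
  have h3 : Tendsto (fun N => ∑' x : ℕ × ℕ, if x.1 < n N ∧ x.2 < n' N then
      cutoff v m (x.1 + x.2 + 2) (win (y N) (n N - 1 - x.1) (x.1 + x.2 + 2)) else 0) atTop
      (𝓝 (bulkCrossEnergy (cutoff v m) a)) := by
    refine tendsto_tsum_of_dominated_convergence (summable_antidiagonal hG0 hG) ?_
      (Eventually.of_forall fun N x => norm_cross_le hG0 hb (hy N) _ _ _)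
    intro x
    refine tendsto_const_nhds.congr' ?_
    filter_upwards [hn (max x.1 x.2)] with N hN
    have hx1 := le_max_left x.1 x.2
    have hx2 := le_max_right x.1 x.2
    rw [if_pos ⟨by omega, by omega⟩, ← win_const a 0]
    congr 1
    exact win_congr fun l hl => (hN.2.2 _ (by omega) (by omega)).symm
  have h4 := (h3.sub h1).sub h2
  have h5 : bulkCrossEnergy (cutoff v m) a - bulkCrossEnergy (cutoff v m) a
      - bulkCrossEnergy (cutoff v m) a = -bulkCrossEnergy (cutoff v m) a := by ring
  rw [h5] at h4
  refine h4.congr fun N => ?_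
  rw [surfaceEnergy_eq hv m p hr (hwr N) (n := n N) fun l hl => by
      simp only [hw]; exact if_neg (by omega),
    surfaceEnergy_eq hv m p hr (hwr' N) (n := n' N) fun l hl => by
      simp only [hw']; exact if_neg (by omega),
    chain_split, ← chain_reflect (cutoff_zero v m) p (n' N) (fun l => y N (n N + l)),
    chain_congr (cutoff v m) p (N := n N + 1) (z := w N) (w := y N) fun l hl => by
      simp only [hw]; exact if_pos (by omega),
    chain_congr (cutoff v m) p (N := n' N + 1) (z := w' N)
      (w := fun l => y N (n N + (n' N - 1 - l))) fun l hl => by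
      simp only [hw']; exact if_pos (by omega)]
  have h6 : (∑' x : ℕ × ℕ, if x.1 < n N ∧ x.2 < n' N then
      cutoff v m (x.1 + x.2 + 2) (win (y N) (n N - 1 - x.1) (x.1 + x.2 + 2)) else 0)
      = ∑ i ∈ Finset.range (n N), ∑ q ∈ Finset.range (n' N),
        cutoff v m (i + q + 2) (win (y N) (n N - 1 - i) (i + q + 2)) := by
    rw [tsum_eq_sum (s := Finset.range (n N) ×ˢ Finset.range (n' N)), Finset.sum_product]
    · refine Finset.sum_congr rfl fun i hi => Finset.sum_congr rfl fun q hq => ?_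
      exact if_pos ⟨Finset.mem_range.1 hi, Finset.mem_range.1 hq⟩
    · intro x hx
      refine if_neg fun h => hx ?_
      exact Finset.mem_product.2 ⟨Finset.mem_range.2 h.1, Finset.mem_range.2 h.2⟩
  rw [h6]
  ring

end

/-! ### Extension of the surface functional -/

/-- Replace all spacings from the index `n` on by `a`. -/
def truncation (a : ℝ) (n : ℕ) (z : ℕ → ℝ) (l : ℕ) : ℝ := if l < n then z l else a

/-- The extension of the surface functional from finite strains to square summable ones. -/
def extSurfaceEnergy (v : ℝ → ℝ) (m : ℕ∞) (p a : ℝ) (z : ℕ → ℝ) : ℝ :=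
  limUnder atTop fun n => surfaceEnergy v m p (bulkEnergy v m p a) (truncation a n z)

theorem truncation_of_le (a : ℝ) {n l : ℕ} (h : n ≤ l) (z : ℕ → ℝ) : truncation a n z l = a :=
  if_neg (by omega)

theorem truncation_of_lt (a : ℝ) {n l : ℕ} (h : l < n) (z : ℕ → ℝ) : truncation a n z l = z l :=
  if_pos h

theorem truncation_mem {a : ℝ} {A : Set ℝ} (ha : a ∈ A) {z : ℕ → ℝ} (hz : ∀ l, z l ∈ A)
    (n l : ℕ) : truncation a n z l ∈ A := by
  unfold truncation; split_ifs; exacts [hz l, ha]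

theorem sum_truncation_le (a : ℝ) (n : ℕ) (z w : ℕ → ℝ) (L : ℕ) :
    ∑ l ∈ Finset.range L, (truncation a n z l - truncation a n w l) ^ 2
      ≤ ∑ l ∈ Finset.range L, (z l - w l) ^ 2 := by
  refine Finset.sum_le_sum fun l _ => ?_
  unfold truncation
  split_ifs
  · exact le_rfl
  · simpa using sq_nonneg (z l - w l)

theorem sum_truncation_sub_le (a : ℝ) (n : ℕ) (z : ℕ → ℝ) (L : ℕ) :
    ∑ l ∈ Finset.range L, (truncation a n z l - a) ^ 2
      ≤ ∑ l ∈ Finset.range L, (z l - a) ^ 2 := by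
  have := sum_truncation_le a n z (fun _ => a) L
  have h : truncation a n (fun _ => a) = fun _ => a := by funext l; simp [truncation]
  rwa [h] at this

theorem mem_finiteStrains_iff {rhc a : ℝ} {z : ℕ → ℝ} :
    z ∈ finiteStrains rhc a ↔ (∀ j, rhc < z j) ∧ ∃ n, ∀ l, n ≤ l → z l = a := by
  refine and_congr_right fun _ => ⟨fun h => ?_, fun ⟨n, hn⟩ => ?_⟩
  · obtain ⟨n, hn⟩ := h.bddAbove
    refine ⟨n + 1, fun l hl => ?_⟩
    by_contra hne
    have : l ≤ n := hn hne
    omega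
  · refine (Set.finite_Iio n).subset fun l hl => ?_
    by_contra hne
    exact hl (hn l (by simpa using hne))

theorem finiteStrains_subset (rhc a : ℝ) : finiteStrains rhc a ⊆ squareSummableStrains rhc a := by
  intro z hz
  obtain ⟨h1, n, hn⟩ := mem_finiteStrains_iff.1 hz
  refine ⟨h1, summable_of_ne_finset_zero (s := Finset.range n) fun l hl => ?_⟩
  rw [hn l (by simpa using hl)]
  ring

theorem truncation_mem_finiteStrains {rhc a : ℝ} (ha : rhc < a) {z : ℕ → ℝ}
    (hz : ∀ j, rhc < z j) (n : ℕ) : truncation a n z ∈ finiteStrains rhc a :=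
  mem_finiteStrains_iff.2 ⟨truncation_mem (A := Set.Ioi rhc) ha hz n,
    n, fun _ hl => truncation_of_le a hl z⟩

/-- The spacings tend to `a > rhc`, so only finitely many can come near `rhc`. -/
theorem exists_lower_bound {rhc a : ℝ} (ha : rhc < a) {z : ℕ → ℝ}
    (hz : z ∈ squareSummableStrains rhc a) : ∃ r, rhc < r ∧ r ≤ a ∧ ∀ l, r ≤ z l := by
  have hlim : Tendsto z atTop (𝓝 a) := by
    have h1 := hz.2.tendsto_atTop_zero.sqrt
    simp only [Real.sqrt_sq_eq_abs, Real.sqrt_zero] at h1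
    exact tendsto_sub_nhds_zero_iff.1 ((tendsto_zero_iff_abs_tendsto_zero _).2 h1)
  obtain ⟨b, hb, hba⟩ := exists_between ha
  obtain ⟨n, hn⟩ := eventually_atTop.1 (hlim.eventually (lt_mem_nhds hba))
  have hfin : ∀ n, ∃ r, rhc < r ∧ r ≤ b ∧ ∀ l, l < n → r ≤ z l := by
    intro n
    induction n with
    | zero => exact ⟨b, hb, le_rfl, fun l hl => by omega⟩
    | succ n ih =>
      obtain ⟨r, h1, h2, h3⟩ := ih
      refine ⟨min r (z n), lt_min h1 (hz.1 n), (min_le_left _ _).trans h2, fun l hl => ?_⟩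
      rcases Nat.lt_succ_iff_lt_or_eq.1 hl with h | rfl
      · exact (min_le_left _ _).trans (h3 l h)
      · exact min_le_right _ _
  obtain ⟨r, h1, h2, h3⟩ := hfin n
  refine ⟨r, h1, h2.trans hba.le, fun l => ?_⟩
  rcases Nat.lt_or_ge l n with h | h
  · exact h3 l h
  · exact h2.trans (hn l h).le

section
variable {v : ℝ → ℝ} {rhc zmin zmax α₁ α₂ s : ℝ}

theorem exists_chain_lipschitz (hv : IsAdmissible v rhc zmin zmax α₁ α₂ s) {m : ℕ∞} {p a : ℝ}
    (hcrit : p + ∑' k : ℕ, (k : ℝ) * cutoff (deriv v) m k (k * a) = 0) {r : ℝ} (hr : rhc < r)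
    (hra : r ≤ a) {M : ℝ} (hM : 0 ≤ M) : ∃ K, 0 ≤ K ∧ ∀ (L : ℕ) (z w : ℕ → ℝ),
      (∀ l, l < L → r ≤ z l) → (∀ l, l < L → r ≤ w l) →
      ∑ l ∈ Finset.range L, (z l - a) ^ 2 ≤ M ^ 2 → ∑ l ∈ Finset.range L, (w l - a) ^ 2 ≤ M ^ 2 →
      |chain (cutoff v m) p (L + 1) z - chain (cutoff v m) p (L + 1) w|
        ≤ K * √(∑ l ∈ Finset.range L, (z l - w l) ^ 2) := by
  obtain ⟨B, hB0, hB, hBt⟩ := hv.exists_taylor m hr hra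
  obtain ⟨G, hG0, hG, hGb⟩ := hv.exists_decay_deriv m hr
  have hD : Summable fun k : ℕ => (k : ℝ) ^ 2 * |cutoff (deriv v) m k (k * a)| :=
    Summable.of_nonneg_of_le (fun k => by positivity) (fun k => mul_le_mul_of_nonneg_left
      (hGb k _ (mul_le_mul_of_nonneg_left hra (Nat.cast_nonneg k))) (sq_nonneg _)) hG
  refine ⟨_, ?_, fun L z w hz hw hzM hwM => chain_lipschitz (cutoff_zero v m)
    (D := fun k => cutoff (deriv v) m k (k * a)) hB0 hD hB hcrit hM hzM hwM fun k i hk hik => ?_⟩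
  · have h1 : 0 ≤ ∑' k : ℕ, (k : ℝ) ^ 2 * |cutoff (deriv v) m k (k * a)| :=
      tsum_nonneg fun k => by positivity
    have h2 : 0 ≤ ∑' k : ℕ, (k : ℝ) ^ 2 * B k :=
      tsum_nonneg fun k => mul_nonneg (sq_nonneg _) (hB0 k)
    positivity
  · exact hBt k _ _ hk (mul_le_win fun l hl => hz _ (by omega))
      (mul_le_win fun l hl => hw _ (by omega))

/-- Normalized finite chains converge to the surface energy minus the same constant `Q`, so
comparisons of chains pass to the limit. -/
theorem surfaceEnergy_le_of_chain_le (hv : IsAdmissible v rhc zmin zmax α₁ α₂ s) (m : ℕ∞)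
    (p : ℝ) {a : ℝ} (ha : rhc < a) {z w : ℕ → ℝ} (hz : z ∈ finiteStrains rhc a)
    (hw : w ∈ finiteStrains rhc a) {c : ℝ}
    (h : ∀ᶠ n : ℕ in atTop, chain (cutoff v m) p (n + 1) z + c ≤ chain (cutoff v m) p (n + 1) w) :
    surfaceEnergy v m p (bulkEnergy v m p a) z + c
      ≤ surfaceEnergy v m p (bulkEnergy v m p a) w := by
  obtain ⟨r, hr, -, hzr⟩ := exists_lower_bound ha (finiteStrains_subset _ _ hz)
  obtain ⟨r', hr', -, hwr⟩ := exists_lower_bound ha (finiteStrains_subset _ _ hw)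
  obtain ⟨-, n, hn⟩ := mem_finiteStrains_iff.1 hz
  obtain ⟨-, n', hn'⟩ := mem_finiteStrains_iff.1 hw
  have h1 := (tendsto_chain_sub hv m p hr hzr hn).add_const c
  have h2 := tendsto_chain_sub hv m p hr' hwr hn'
  have := le_of_tendsto_of_tendsto h1 h2 (h.mono fun n hn => by dsimp only; linarith)
  linarith

theorem exists_surfaceEnergy_lipschitz (hv : IsAdmissible v rhc zmin zmax α₁ α₂ s) {m : ℕ∞}
    {p a : ℝ} (hcrit : p + ∑' k : ℕ, (k : ℝ) * cutoff (deriv v) m k (k * a) = 0) {r : ℝ}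
    (hr : rhc < r) (hra : r ≤ a) {M : ℝ} (hM : 0 ≤ M) : ∃ K, 0 ≤ K ∧
      ∀ z ∈ finiteStrains rhc a, ∀ w ∈ finiteStrains rhc a, (∀ l, r ≤ z l) → (∀ l, r ≤ w l) →
      (∀ L, ∑ l ∈ Finset.range L, (z l - a) ^ 2 ≤ M ^ 2) →
      (∀ L, ∑ l ∈ Finset.range L, (w l - a) ^ 2 ≤ M ^ 2) →
      ∀ d, 0 ≤ d → (∀ L, ∑ l ∈ Finset.range L, (z l - w l) ^ 2 ≤ d ^ 2) →
      |surfaceEnergy v m p (bulkEnergy v m p a) z - surfaceEnergy v m p (bulkEnergy v m p a) w|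
        ≤ K * d := by
  obtain ⟨K, hK, hlip⟩ := exists_chain_lipschitz hv hcrit hr hra hM
  refine ⟨K, hK, fun z hz w hw hzr hwr hzM hwM d hd hzw => ?_⟩
  have key : ∀ n : ℕ, |chain (cutoff v m) p (n + 1) z - chain (cutoff v m) p (n + 1) w| ≤ K * d :=
    fun n => (hlip n z w (fun l _ => hzr l) (fun l _ => hwr l) (hzM n) (hwM n)).trans
      (mul_le_mul_of_nonneg_left (Real.sqrt_le_iff.2 ⟨hd, hzw n⟩) hK)
  have ha := lt_of_lt_of_le hr hra
  have h1 := surfaceEnergy_le_of_chain_le hv m p ha hz hw (c := -(K * d))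
    (Eventually.of_forall fun n => by linarith [(abs_le.1 (key n)).2])
  have h2 := surfaceEnergy_le_of_chain_le hv m p ha hw hz (c := -(K * d))
    (Eventually.of_forall fun n => by linarith [(abs_le.1 (key n)).1])
  exact abs_le.2 ⟨by linarith, by linarith⟩

theorem sum_le_of_squareSummable {a : ℝ} {z : ℕ → ℝ} (hz : Summable fun j => (z j - a) ^ 2)
    (L : ℕ) : ∑ l ∈ Finset.range L, (z l - a) ^ 2 ≤ √(∑' l, (z l - a) ^ 2) ^ 2 := by
  rw [Real.sq_sqrt (tsum_nonneg fun _ => sq_nonneg _)]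
  exact hz.sum_le_tsum _ fun _ _ => sq_nonneg _

/-- Two truncations beyond `N` differ in `ℓ²` by at most the tail of the strain, so the Lipschitz
bound makes their energies Cauchy. -/
theorem tendsto_extSurfaceEnergy (hv : IsAdmissible v rhc zmin zmax α₁ α₂ s) {m : ℕ∞}
    {p a : ℝ} (hcrit : p + ∑' k : ℕ, (k : ℝ) * cutoff (deriv v) m k (k * a) = 0) (ha : rhc < a)
    {z : ℕ → ℝ} (hz : z ∈ squareSummableStrains rhc a) :
    Tendsto (fun n => surfaceEnergy v m p (bulkEnergy v m p a) (truncation a n z)) atTop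
      (𝓝 (extSurfaceEnergy v m p a z)) := by
  obtain ⟨r, hr, hra, hzr⟩ := exists_lower_bound ha hz
  obtain ⟨K, hK, hlip⟩ := exists_surfaceEnergy_lipschitz hv hcrit hr hra
    (Real.sqrt_nonneg (∑' l, (z l - a) ^ 2))
  set T := ∑' l, (z l - a) ^ 2 with hT
  have htail : ∀ N, 0 ≤ T - ∑ l ∈ Finset.range N, (z l - a) ^ 2 := fun N =>
    sub_nonneg.2 (hz.2.sum_le_tsum _ fun _ _ => sq_nonneg _)
  have hb : Tendsto (fun N => K * √(T - ∑ l ∈ Finset.range N, (z l - a) ^ 2)) atTop (𝓝 0) := by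
    have h1 : Tendsto (fun N => T - ∑ l ∈ Finset.range N, (z l - a) ^ 2) atTop (𝓝 (T - T)) :=
      tendsto_const_nhds.sub hz.2.hasSum.tendsto_sum_nat
    have h2 := h1.sqrt.const_mul K
    simpa using h2
  suffices hc : CauchySeq fun n =>
      surfaceEnergy v m p (bulkEnergy v m p a) (truncation a n z) from hc.tendsto_limUnder
  refine cauchySeq_of_le_tendsto_0 _ (fun n n' N hn hn' => ?_) hb
  rw [Real.dist_eq]
  have hmem := truncation_mem_finiteStrains ha hz.1
  refine hlip _ (hmem n) _ (hmem n') (truncation_mem (A := Set.Ici r) hra hzr n)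
    (truncation_mem (A := Set.Ici r) hra hzr n')
    (fun L => (sum_truncation_sub_le a n z L).trans (sum_le_of_squareSummable hz.2 L))
    (fun L => (sum_truncation_sub_le a n' z L).trans (sum_le_of_squareSummable hz.2 L))
    _ (Real.sqrt_nonneg _) fun L => ?_
  rw [Real.sq_sqrt (htail N), le_sub_iff_add_le]
  have h1 : ∑ l ∈ Finset.range L, (truncation a n z l - truncation a n' z l) ^ 2
      ≤ ∑ l ∈ (Finset.range L).filter (fun l => ¬ l < N), (z l - a) ^ 2 := by
    rw [Finset.sum_filter]
    refine Finset.sum_le_sum fun l _ => ?_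
    unfold truncation
    split_ifs <;> first | omega | simp | skip
    · positivity
    · rw [← neg_sub, neg_sq]
    · positivity
  have h2 : Disjoint ((Finset.range L).filter (fun l => ¬ l < N)) (Finset.range N) := by
    rw [Finset.disjoint_left]
    intro l hl hl'
    exact (Finset.mem_filter.1 hl).2 (Finset.mem_range.1 hl')
  calc _ ≤ ∑ l ∈ (Finset.range L).filter (fun l => ¬ l < N), (z l - a) ^ 2
        + ∑ l ∈ Finset.range N, (z l - a) ^ 2 := by linarith
    _ ≤ T := by
      rw [← Finset.sum_union h2]
      exact hz.2.sum_le_tsum _ fun _ _ => sq_nonneg _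

theorem extSurfaceEnergy_eq {m : ℕ∞} {p a : ℝ} {z : ℕ → ℝ} (hz : z ∈ finiteStrains rhc a) :
    extSurfaceEnergy v m p a z = surfaceEnergy v m p (bulkEnergy v m p a) z := by
  obtain ⟨-, n, hn⟩ := mem_finiteStrains_iff.1 hz
  refine Tendsto.limUnder_eq (tendsto_const_nhds.congr' ?_)
  filter_upwards [eventually_ge_atTop n] with N hN
  congr 1
  funext l
  unfold truncation
  split_ifs with h
  · rfl
  · exact hn l (by omega)

theorem exists_extSurfaceEnergy_lipschitz (hv : IsAdmissible v rhc zmin zmax α₁ α₂ s) {m : ℕ∞}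
    {p a : ℝ} (hcrit : p + ∑' k : ℕ, (k : ℝ) * cutoff (deriv v) m k (k * a) = 0) {r : ℝ}
    (hr : rhc < r) (hra : r ≤ a) {M : ℝ} (hM : 0 ≤ M) : ∃ K, 0 ≤ K ∧
      ∀ z ∈ squareSummableStrains rhc a, ∀ w ∈ squareSummableStrains rhc a,
      (∀ l, r ≤ z l) → (∀ l, r ≤ w l) →
      (∀ L, ∑ l ∈ Finset.range L, (z l - a) ^ 2 ≤ M ^ 2) →
      (∀ L, ∑ l ∈ Finset.range L, (w l - a) ^ 2 ≤ M ^ 2) →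
      ∀ d, 0 ≤ d → (∀ L, ∑ l ∈ Finset.range L, (z l - w l) ^ 2 ≤ d ^ 2) →
      |extSurfaceEnergy v m p a z - extSurfaceEnergy v m p a w| ≤ K * d := by
  obtain ⟨K, hK, hlip⟩ := exists_surfaceEnergy_lipschitz hv hcrit hr hra hM
  refine ⟨K, hK, fun z hz w hw hzr hwr hzM hwM d hd hzw => ?_⟩
  have ha := lt_of_lt_of_le hr hra
  refine le_of_tendsto ((tendsto_extSurfaceEnergy hv hcrit ha hz).sub
    (tendsto_extSurfaceEnergy hv hcrit ha hw)).abs (Eventually.of_forall fun n => ?_)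
  exact hlip _ (truncation_mem_finiteStrains ha hz.1 n) _
    (truncation_mem_finiteStrains ha hw.1 n) (truncation_mem (A := Set.Ici r) hra hzr n)
    (truncation_mem (A := Set.Ici r) hra hwr n)
    (fun L => (sum_truncation_sub_le a n z L).trans (hzM L))
    (fun L => (sum_truncation_sub_le a n w L).trans (hwM L)) d hd
    (fun L => (sum_truncation_le a n z w L).trans (hzw L))

theorem sum_sq_le_norm_sq (f : lp (fun _ : ℕ => ℝ) 2) (S : Finset ℕ) :
    ∑ l ∈ S, f l ^ 2 ≤ ‖f‖ ^ 2 := by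
  have := lp.sum_rpow_le_norm_rpow (p := 2) (by norm_num) f S
  simpa using this

theorem sum_sq_le_dist_sq {a : ℝ} (z w : StrainSpace rhc a) (S : Finset ℕ) :
    ∑ l ∈ S, (z.1 l - w.1 l) ^ 2 ≤ dist z w ^ 2 := by
  have h1 : dist z w = ‖z.strain - w.strain‖ := dist_eq_norm z.strain w.strain
  rw [h1]
  refine le_trans (le_of_eq (Finset.sum_congr rfl fun l _ => ?_))
    (sum_sq_le_norm_sq (z.strain - w.strain) S)
  have : (z.strain - w.strain) l = (z.1 l - a) - (w.1 l - a) := rfl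
  rw [this]
  ring

theorem continuous_extSurfaceEnergy (hv : IsAdmissible v rhc zmin zmax α₁ α₂ s) {m : ℕ∞}
    {p a : ℝ} (hcrit : p + ∑' k : ℕ, (k : ℝ) * cutoff (deriv v) m k (k * a) = 0) (ha : rhc < a) :
    Continuous fun z : StrainSpace rhc a => extSurfaceEnergy v m p a z.1 := by
  refine continuous_iff_continuousAt.2 fun z => ?_
  obtain ⟨r, hr, hra, hzr⟩ := exists_lower_bound ha z.2
  -- In the ball of radius `(r - rhc) / 2` every spacing stays above the midpoint of `rhc` and `r`,
  -- and the strain norm grows by at most the radius.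
  obtain ⟨K, hK, hlip⟩ := exists_extSurfaceEnergy_lipschitz hv hcrit (r := (rhc + r) / 2)
    (by linarith) (by linarith) (M := ‖z.strain‖ + (r - rhc) / 2)
    (by have := norm_nonneg z.strain; linarith)
  refine continuousAt_of_locally_lipschitz (r := (r - rhc) / 2) (by linarith) K fun w hw => ?_
  have hM : ∀ y : StrainSpace rhc a, dist y z < (r - rhc) / 2 →
      ∀ L, ∑ l ∈ Finset.range L, (y.1 l - a) ^ 2 ≤ (‖z.strain‖ + (r - rhc) / 2) ^ 2 := by
    intro y hy L
    have h1 : ‖y.strain - z.strain‖ < (r - rhc) / 2 := by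
      rw [← dist_eq_norm]; exact hy
    have h2 : ‖y.strain‖ ≤ ‖z.strain‖ + (r - rhc) / 2 := by
      have := norm_add_le (y.strain - z.strain) z.strain
      rw [sub_add_cancel] at this
      linarith
    refine (sum_sq_le_norm_sq y.strain (Finset.range L)).trans ?_
    exact pow_le_pow_left₀ (norm_nonneg _) h2 2
  rw [Real.dist_eq]
  refine hlip w.1 w.2 z.1 z.2 (fun l => ?_) (fun l => by linarith [hzr l]) (hM w hw)
    (hM z (by rw [dist_self]; linarith)) _ dist_nonneg
    fun L => sum_sq_le_dist_sq w z (Finset.range L)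
  have h1 := sum_sq_le_dist_sq w z {l}
  rw [Finset.sum_singleton] at h1
  have h2 := abs_le_of_sq_le_sq' h1 dist_nonneg
  linarith [h2.1, hzr l]

end

/-! ### Convexity, coercivity and minimizers of the surface functional -/

section
variable {v : ℝ → ℝ} {rhc zmin zmax α₁ α₂ s : ℝ}

theorem surfaceEnergy_convexity (hv : IsAdmissible v rhc zmin zmax α₁ α₂ s) {m : ℕ∞} (hm : 1 ≤ m)
    (p : ℝ) {a : ℝ} {z w : ℕ → ℝ} (hz : z ∈ finiteStrains rhc a)
    (hw : w ∈ finiteStrains rhc a) (hzb : ∀ l, z l ∈ Set.Icc zmin zmax)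
    (hwb : ∀ l, w l ∈ Set.Icc zmin zmax) {t u : ℝ} (ht : 0 ≤ t) (hu : 0 ≤ u) (htu : t + u = 1)
    (L : ℕ) : surfaceEnergy v m p (bulkEnergy v m p a) (fun l => t * z l + u * w l)
      ≤ t * surfaceEnergy v m p (bulkEnergy v m p a) z
        + u * surfaceEnergy v m p (bulkEnergy v m p a) w
        - convexityModulus v zmin zmax / 2
          * (t * u * ∑ l ∈ Finset.range L, (z l - w l) ^ 2) := by
  obtain ⟨-, n, hn⟩ := mem_finiteStrains_iff.1 hz
  obtain ⟨-, n', hn'⟩ := mem_finiteStrains_iff.1 hw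
  have hzw : ∀ l, zmin ≤ t * z l + u * w l := fun l =>
    ((convex_Icc zmin zmax) (hzb l) (hwb l) ht hu htu).1
  have h1 := tendsto_chain_sub hv m p hv.rhc_lt_zmin (fun l => (hzb l).1) hn
  have h2 := tendsto_chain_sub hv m p hv.rhc_lt_zmin (fun l => (hwb l).1) hn'
  have h3 := tendsto_chain_sub hv m p (a := a) hv.rhc_lt_zmin hzw (n₀ := max n n') (fun l hl => by
    rw [hn l ((le_max_left _ _).trans hl), hn' l ((le_max_right _ _).trans hl), ← add_mul, htu,
      one_mul])
  have h4 := ((h1.const_mul t).add (h2.const_mul u)).sub_const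
    (convexityModulus v zmin zmax / 2 * (t * u * ∑ l ∈ Finset.range L, (z l - w l) ^ 2))
  have hle := le_of_tendsto_of_tendsto h3 h4 ?_
  · have hu' : u = 1 - t := by linarith
    subst hu'
    linarith
  filter_upwards [eventually_ge_atTop L] with N hN
  have h5 := chain_box_convexity hv hm p (L := N) ht hu htu (fun l _ => hzb l) (fun l _ => hwb l)
  have h6 : ∑ l ∈ Finset.range L, (z l - w l) ^ 2 ≤ ∑ l ∈ Finset.range N, (z l - w l) ^ 2 :=
    Finset.sum_le_sum_of_subset_of_nonneg (Finset.range_mono hN) fun _ _ _ => sq_nonneg _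
  have h7 := mul_le_mul_of_nonneg_left (mul_le_mul_of_nonneg_left h6 (mul_nonneg ht hu))
    (half_pos hv.convexityModulus_pos).le
  have hu' : u = 1 - t := by linarith
  subst hu'
  linarith

theorem extSurfaceEnergy_convexity (hv : IsAdmissible v rhc zmin zmax α₁ α₂ s) {m : ℕ∞}
    (hm : 1 ≤ m) {p a : ℝ} (ha : a ∈ Set.Icc zmin zmax)
    (hcrit : p + ∑' k : ℕ, (k : ℝ) * cutoff (deriv v) m k (k * a) = 0) {z w y : ℕ → ℝ}
    (hz : z ∈ squareSummableStrains rhc a) (hw : w ∈ squareSummableStrains rhc a)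
    (hzb : ∀ l, z l ∈ Set.Icc zmin zmax) (hwb : ∀ l, w l ∈ Set.Icc zmin zmax) {t u : ℝ}
    (ht : 0 ≤ t) (hu : 0 ≤ u) (htu : t + u = 1) (hy : y ∈ squareSummableStrains rhc a)
    (hyzw : ∀ l, y l = t * z l + u * w l) (L : ℕ) :
    extSurfaceEnergy v m p a y
      ≤ t * extSurfaceEnergy v m p a z + u * extSurfaceEnergy v m p a w
        - convexityModulus v zmin zmax / 2
          * (t * u * ∑ l ∈ Finset.range L, (z l - w l) ^ 2) := by
  have ha' : rhc < a := lt_of_lt_of_le hv.rhc_lt_zmin ha.1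
  refine le_of_tendsto_of_tendsto (tendsto_extSurfaceEnergy hv hcrit ha' hy)
    ((((tendsto_extSurfaceEnergy hv hcrit ha' hz).const_mul t).add
      ((tendsto_extSurfaceEnergy hv hcrit ha' hw).const_mul u)).sub_const _) ?_
  filter_upwards [eventually_ge_atTop L] with n hn
  have h1 := surfaceEnergy_convexity hv hm p (truncation_mem_finiteStrains ha' hz.1 n)
    (truncation_mem_finiteStrains ha' hw.1 n) (truncation_mem ha hzb n) (truncation_mem ha hwb n)
    ht hu htu L
  have h2 : (fun l => t * truncation a n z l + u * truncation a n w l) = truncation a n y := by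
    funext l
    unfold truncation
    split_ifs
    · exact (hyzw l).symm
    · rw [← add_mul, htu, one_mul]
  have h3 : ∑ l ∈ Finset.range L, (truncation a n z l - truncation a n w l) ^ 2
      = ∑ l ∈ Finset.range L, (z l - w l) ^ 2 := by
    refine Finset.sum_congr rfl fun l hl => ?_
    have hl' := Finset.mem_range.1 hl
    rw [truncation_of_lt a (by omega), truncation_of_lt a (by omega)]
  rwa [h2, h3] at h1

/-- For `ℓ²` distance `d ≤ 1` from the constant chain the Lipschitz bound suffices. For `d > 1` it
is applied at distance one on the segment, and uniform convexity extrapolates the value to `d`. -/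
theorem exists_chain_coercive (hv : IsAdmissible v rhc zmin zmax α₁ α₂ s) {m : ℕ∞} (hm : 1 ≤ m)
    {p a : ℝ} (ha : a ∈ Set.Icc zmin zmax)
    (hcrit : p + ∑' k : ℕ, (k : ℝ) * cutoff (deriv v) m k (k * a) = 0) :
    ∃ K, 0 ≤ K ∧ ∀ (L : ℕ) (z : ℕ → ℝ), (∀ l, l < L → z l ∈ Set.Icc zmin zmax) →
      chain (cutoff v m) p (L + 1) (fun _ => a) - K * √(∑ l ∈ Finset.range L, (z l - a) ^ 2)
        + convexityModulus v zmin zmax / 2 * (∑ l ∈ Finset.range L, (z l - a) ^ 2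
          - √(∑ l ∈ Finset.range L, (z l - a) ^ 2)) ≤ chain (cutoff v m) p (L + 1) z := by
  obtain ⟨K, hK, hlip⟩ := exists_chain_lipschitz hv hcrit hv.rhc_lt_zmin ha.1 zero_le_one
  refine ⟨K, hK, fun L z hz => ?_⟩
  have hκ := hv.convexityModulus_pos
  set κ := convexityModulus v zmin zmax
  set S := ∑ l ∈ Finset.range L, (z l - a) ^ 2 with hS
  have hS0 : 0 ≤ S := Finset.sum_nonneg fun _ _ => sq_nonneg _
  set d := √S with hd
  have hd0 : 0 ≤ d := Real.sqrt_nonneg _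
  have hdS : d ^ 2 = S := Real.sq_sqrt hS0
  have hconst : ∑ l ∈ Finset.range L, (a - a) ^ 2 ≤ (1 : ℝ) ^ 2 := by simp
  rcases le_or_gt d 1 with h1 | h1
  · have h2 := hlip L z (fun _ => a) (fun l hl => (hz l hl).1) (fun _ _ => ha.1)
      (by rw [← hS, ← hdS]; exact pow_le_pow_left₀ hd0 h1 2) hconst
    have h3 := (abs_le.1 h2).1
    have h4 : S - d ≤ 0 := by nlinarith
    have h5 := mul_nonpos_of_nonneg_of_nonpos (half_pos hκ).le h4
    linarith
  · set t := d⁻¹ with ht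
    have hdpos : 0 < d := by linarith
    have ht0 : 0 ≤ t := by positivity
    have ht1 : t ≤ 1 := inv_le_one_of_one_le₀ h1.le
    have htd : t * d = 1 := inv_mul_cancel₀ hdpos.ne'
    have hconv := chain_box_convexity hv hm p (L := L) (z := z) (w := fun _ => a) (t := t)
      (u := 1 - t) ht0 (by linarith) (by ring) hz (fun _ _ => ha)
    have hsum : ∑ l ∈ Finset.range L, (t * z l + (1 - t) * a - a) ^ 2 = 1 := by
      have : ∀ l ∈ Finset.range L, (t * z l + (1 - t) * a - a) ^ 2 = t ^ 2 * (z l - a) ^ 2 :=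
        fun l _ => by ring
      rw [Finset.sum_congr rfl this, ← Finset.mul_sum, ← hS, ← hdS, ← mul_pow, htd, one_pow]
    have h2 := hlip L (fun l => t * z l + (1 - t) * a) (fun _ => a)
      (fun l hl => ((convex_Icc zmin zmax) (hz l hl) ha ht0 (by linarith) (by ring)).1)
      (fun _ _ => ha.1) (by rw [hsum]; norm_num) hconst
    rw [hsum, Real.sqrt_one, mul_one] at h2
    have h3 := (abs_le.1 h2).1
    rw [← hS, ← hdS] at hconv
    set A := chain (cutoff v m) p (L + 1) fun _ => a
    set Z := chain (cutoff v m) p (L + 1) z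
    have h4 : -K ≤ t * (Z - A) - κ / 2 * (t * (1 - t) * d ^ 2) := by linarith
    have h5 := mul_le_mul_of_nonneg_right h4 hd0
    have h6 : (t * (Z - A) - κ / 2 * (t * (1 - t) * d ^ 2)) * d
        = (t * d) * (Z - A) - κ / 2 * ((t * d) * (d ^ 2 - (t * d) * d)) := by ring
    rw [h6, htd] at h5
    rw [← hdS]
    linarith

/-- Coercivity of the finite minimizers bounds all chains from below uniformly in length; the
constant comes from completing the square in `d`. -/
theorem surfaceEnergy_bddBelow (hv : IsAdmissible v rhc zmin zmax α₁ α₂ s) {m : ℕ∞} (hm : 1 ≤ m)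
    {p a : ℝ} (hp₀ : 0 ≤ p) (hp : p < |v zmax| / zmax) (ha : a ∈ Set.Icc zmin zmax)
    (hcrit : p + ∑' k : ℕ, (k : ℝ) * cutoff (deriv v) m k (k * a) = 0) :
    BddBelow (surfaceEnergy v m p (bulkEnergy v m p a) '' finiteStrains rhc a) := by
  have ha' : rhc < a := lt_of_lt_of_le hv.rhc_lt_zmin ha.1
  obtain ⟨K, hK, hco⟩ := exists_chain_coercive hv hm ha hcrit
  have hκ := hv.convexityModulus_pos
  set κ := convexityModulus v zmin zmax with hκdef
  refine ⟨surfaceEnergy v m p (bulkEnergy v m p a) (fun _ => a) + -((K + κ / 2) ^ 2 / (2 * κ)), ?_⟩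
  rintro _ ⟨w, hw, rfl⟩
  refine surfaceEnergy_le_of_chain_le hv m p ha'
    (mem_finiteStrains_iff.2 ⟨fun _ => ha', 0, fun _ _ => rfl⟩) hw ?_
  filter_upwards [eventually_ge_atTop 1] with n hn
  obtain ⟨z, hzb, hz⟩ := exists_chain_minimizer hv hm hp₀ hp (N := n + 1) (by omega)
  refine le_trans ?_ (hz w hw.1)
  refine le_trans ?_ (hco n z fun l _ => hzb l)
  set S := ∑ l ∈ Finset.range n, (z l - a) ^ 2
  have hS0 : 0 ≤ S := Finset.sum_nonneg fun _ _ => sq_nonneg _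
  rw [← Real.sq_sqrt hS0]
  simp only [Real.sqrt_sq (Real.sqrt_nonneg S)]
  set d := √S
  have h1 : 0 ≤ (κ * d - (K + κ / 2)) ^ 2 / (2 * κ) := by positivity
  have h2 : (κ * d - (K + κ / 2)) ^ 2 / (2 * κ)
      = κ / 2 * d ^ 2 - (K + κ / 2) * d + (K + κ / 2) ^ 2 / (2 * κ) := by
    field_simp
    ring
  linarith

theorem surfaceEnergy_of_lt_zmin (hv : IsAdmissible v rhc zmin zmax α₁ α₂ s) {m : ℕ∞}
    (hm : 1 ≤ m) {p a : ℝ} (hp₀ : 0 ≤ p) (ha : a ∈ Set.Icc zmin zmax) {w : ℕ → ℝ}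
    (hw : w ∈ finiteStrains rhc a) {i : ℕ} (hi : w i < zmin) : ∃ z ∈ finiteStrains rhc a,
      surfaceEnergy v m p (bulkEnergy v m p a) z + -(v zmax + p * zmax)
        ≤ surfaceEnergy v m p (bulkEnergy v m p a) w := by
  have ha' : rhc < a := lt_of_lt_of_le hv.rhc_lt_zmin ha.1
  obtain ⟨hwr, n, hn⟩ := mem_finiteStrains_iff.1 hw
  obtain ⟨j, -, hjmin⟩ := Finset.exists_min_image (Finset.range (max n (i + 1))) w
    ⟨i, Finset.mem_range.2 (by omega)⟩
  have hji : w j ≤ w i := hjmin i (Finset.mem_range.2 (by omega))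
  have hmin : ∀ l, w j ≤ w l := by
    intro l
    rcases Nat.lt_or_ge l n with h | h
    · exact hjmin l (Finset.mem_range.2 (by omega))
    · rw [hn l h]; linarith [ha.1]
  have hz : consSpacing zmax (removeParticle w j) ∈ finiteStrains rhc a := by
    refine mem_finiteStrains_iff.2 ⟨fun l => ?_, max j n + 1, fun l hl => ?_⟩
    · match l with
      | 0 => exact hv.rhc_lt_zmin.trans hv.zmin_lt_zmax
      | l + 1 => exact lt_removeParticle hv.rhc_nonneg (hwr l) (hwr (l + 1))
    · match l with
      | 0 => omega
      | l + 1 =>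
        change removeParticle w j l = a
        rw [removeParticle_of_le w (by omega), hn _ (by omega)]
  refine ⟨_, hz, surfaceEnergy_le_of_chain_le hv m p ha' hz hw ?_⟩
  filter_upwards [eventually_gt_atTop j] with N hN
  have := exists_chain_add_le hv hm hp₀ (N := N + 1) (j := j) (by omega) (fun l _ => hwr l)
    (fun l _ => hmin l) (lt_of_le_of_lt hji hi)
  linarith

theorem surfaceEnergy_clip_le (hv : IsAdmissible v rhc zmin zmax α₁ α₂ s) {m : ℕ∞}
    (hm : 1 ≤ m) {p a : ℝ} (hp₀ : 0 ≤ p) (ha : a ∈ Set.Icc zmin zmax) {w : ℕ → ℝ}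
    (hw : w ∈ finiteStrains rhc a) (hwz : ∀ l, zmin ≤ w l) :
    (fun l => min (w l) zmax) ∈ finiteStrains rhc a ∧ ∀ j,
      surfaceEnergy v m p (bulkEnergy v m p a) (fun l => min (w l) zmax)
        + (v (w j) - v (min (w j) zmax)) ≤ surfaceEnergy v m p (bulkEnergy v m p a) w := by
  have ha' : rhc < a := lt_of_lt_of_le hv.rhc_lt_zmin ha.1
  obtain ⟨hwr, n, hn⟩ := mem_finiteStrains_iff.1 hw
  have hz : (fun l => min (w l) zmax) ∈ finiteStrains rhc a :=
    mem_finiteStrains_iff.2 ⟨fun l => lt_min (hwr l) (hv.rhc_lt_zmin.trans hv.zmin_lt_zmax), n,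
      fun l hl => by rw [hn l hl, min_eq_left ha.2]⟩
  refine ⟨hz, fun j => surfaceEnergy_le_of_chain_le hv m p ha' hz hw ?_⟩
  filter_upwards [eventually_gt_atTop j] with N hN
  exact chain_clip_le hv hm hp₀ (fun l _ => hwz l) (by omega)

/-- The gap argument of `exists_chain_minimizer`, now for half-infinite chains. -/
theorem exists_box_lt (hv : IsAdmissible v rhc zmin zmax α₁ α₂ s) {m : ℕ∞} (hm : 1 ≤ m)
    {p a : ℝ} (hp₀ : 0 ≤ p) (hp : p < |v zmax| / zmax) (ha : a ∈ Set.Icc zmin zmax)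
    (hcrit : p + ∑' k : ℕ, (k : ℝ) * cutoff (deriv v) m k (k * a) = 0) {ε : ℝ} (hε : 0 < ε) :
    ∃ z ∈ finiteStrains rhc a, (∀ l, z l ∈ Set.Icc zmin zmax) ∧
      surfaceEnergy v m p (bulkEnergy v m p a) z
        < sInf (surfaceEnergy v m p (bulkEnergy v m p a) '' finiteStrains rhc a) + ε := by
  have ha' : rhc < a := lt_of_lt_of_le hv.rhc_lt_zmin ha.1
  have hbdd := surfaceEnergy_bddBelow hv hm hp₀ hp ha hcrit
  set T := surfaceEnergy v m p (bulkEnergy v m p a) '' finiteStrains rhc a with hT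
  have hδ := hv.add_mul_zmax_neg hp
  have hne : T.Nonempty :=
    ⟨_, fun _ => a, mem_finiteStrains_iff.2 ⟨fun _ => ha', 0, fun _ _ => rfl⟩, rfl⟩
  obtain ⟨_, ⟨w, hw, rfl⟩, hlt⟩ := exists_lt_of_csInf_lt hne
    (lt_add_of_pos_right (sInf T) (lt_min hε (neg_pos.2 hδ)))
  have hwz : ∀ l, zmin ≤ w l := by
    by_contra! hcon
    obtain ⟨i, hi⟩ := hcon
    obtain ⟨z, hz, hle⟩ := surfaceEnergy_of_lt_zmin hv hm hp₀ ha hw hi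
    have h1 : sInf T ≤ _ := csInf_le hbdd ⟨z, hz, rfl⟩
    have h2 := min_le_right ε (-(v zmax + p * zmax))
    linarith
  obtain ⟨hc, hle⟩ := surfaceEnergy_clip_le hv hm hp₀ ha hw hwz
  refine ⟨_, hc, fun l => ⟨le_min (hwz l) hv.zmin_lt_zmax.le, min_le_right _ _⟩, ?_⟩
  have h1 := hle 0
  have h2 : v (min (w 0) zmax) ≤ v (w 0) := by
    rcases le_total (w 0) zmax with h | h
    · rw [min_eq_left h]
    · rw [min_eq_right h]
      exact hv.zmax_le (hw.1 0)
  have h3 := min_le_left ε (-(v zmax + p * zmax))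
  linarith

end

/-- The infimum of the surface functional over finite strains. -/
def surfaceInf (v : ℝ → ℝ) (m : ℕ∞) (p rhc a : ℝ) : ℝ :=
  sInf (surfaceEnergy v m p (bulkEnergy v m p a) '' finiteStrains rhc a)

/-! ### Existence, uniqueness and strict convexity on square summable strains -/

section
variable {v : ℝ → ℝ} {rhc zmin zmax α₁ α₂ s : ℝ}

theorem surfaceInf_le (hv : IsAdmissible v rhc zmin zmax α₁ α₂ s) {m : ℕ∞} (hm : 1 ≤ m)
    {p a : ℝ} (hp₀ : 0 ≤ p) (hp : p < |v zmax| / zmax) (ha : a ∈ Set.Icc zmin zmax)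
    (hcrit : p + ∑' k : ℕ, (k : ℝ) * cutoff (deriv v) m k (k * a) = 0) {z : ℕ → ℝ}
    (hz : z ∈ finiteStrains rhc a) :
    surfaceInf v m p rhc a ≤ surfaceEnergy v m p (bulkEnergy v m p a) z :=
  csInf_le (surfaceEnergy_bddBelow hv hm hp₀ hp ha hcrit) ⟨z, hz, rfl⟩

theorem exists_extSurfaceEnergy_eq_inf (hv : IsAdmissible v rhc zmin zmax α₁ α₂ s) {m : ℕ∞}
    (hm : 1 ≤ m) {p a : ℝ} (hp₀ : 0 ≤ p) (hp : p < |v zmax| / zmax) (ha : a ∈ Set.Icc zmin zmax)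
    (hcrit : p + ∑' k : ℕ, (k : ℝ) * cutoff (deriv v) m k (k * a) = 0) :
    ∃ z ∈ squareSummableStrains rhc a, (∀ l, z l ∈ Set.Icc zmin zmax) ∧
      extSurfaceEnergy v m p a z = surfaceInf v m p rhc a := by
  have ha' : rhc < a := lt_of_lt_of_le hv.rhc_lt_zmin ha.1
  have hκ := hv.convexityModulus_pos
  set κ := convexityModulus v zmin zmax with hκdef
  set μ := surfaceInf v m p rhc a with hμ
  choose w hw hwb hwlt using fun k : ℕ =>
    exists_box_lt hv hm hp₀ hp ha hcrit (Nat.one_div_pos_of_nat (α := ℝ) (n := k))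
  have hwD : ∀ k, w k ∈ squareSummableStrains rhc a := fun k => finiteStrains_subset _ _ (hw k)
  set W : ℕ → StrainSpace rhc a := fun k => ⟨w k, hwD k⟩ with hW
  -- At the midpoint convexity gains `κ / 8` times the squared distance, which cannot exceed the
  -- excess `1 / (N + 1)` over the infimum.
  have hb : Tendsto (fun N : ℕ => √(8 / κ * (1 / ((N : ℝ) + 1)))) atTop (𝓝 0) := by
    have := (tendsto_one_div_add_atTop_nhds_zero_nat (𝕜 := ℝ)).const_mul (8 / κ)
    simpa using this.sqrt
  have hcauchy : CauchySeq fun k => (W k).strain := by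
    refine cauchySeq_of_le_tendsto_0 _ (fun j k N hj hk => ?_) hb
    rw [dist_eq_norm]
    refine lp.norm_le_of_forall_sum_le (by norm_num) (Real.sqrt_nonneg _) fun S => ?_
    have hpos : 0 ≤ 8 / κ * (1 / ((N : ℝ) + 1)) := by positivity
    have h0 : ∑ l ∈ S, ‖((W j).strain - (W k).strain) l‖ ^ (2 : ENNReal).toReal
        = ∑ l ∈ S, (w j l - w k l) ^ 2 := by
      refine Finset.sum_congr rfl fun l _ => ?_
      have : ((W j).strain - (W k).strain) l = (w j l - a) - (w k l - a) := rfl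
      rw [this]
      simp
    rw [h0, ENNReal.toReal_ofNat, Real.rpow_ofNat, Real.sq_sqrt hpos]
    obtain ⟨L, hL⟩ : ∃ L, S ⊆ Finset.range L := S.exists_nat_subset_range
    refine (Finset.sum_le_sum_of_subset_of_nonneg hL fun _ _ _ => sq_nonneg _).trans ?_
    have hconv := surfaceEnergy_convexity hv hm p (hw j) (hw k) (hwb j) (hwb k)
      (t := 1 / 2) (u := 1 / 2) (by norm_num) (by norm_num) (by norm_num) L
    have hmid : (fun l => 1 / 2 * w j l + 1 / 2 * w k l) ∈ finiteStrains rhc a := by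
      obtain ⟨h1, n, hn⟩ := mem_finiteStrains_iff.1 (hw j)
      obtain ⟨h2, n', hn'⟩ := mem_finiteStrains_iff.1 (hw k)
      refine mem_finiteStrains_iff.2 ⟨fun l => by linarith [h1 l, h2 l], max n n', fun l hl => ?_⟩
      rw [hn l ((le_max_left _ _).trans hl), hn' l ((le_max_right _ _).trans hl)]
      ring
    have h1 : μ ≤ _ := surfaceInf_le hv hm hp₀ hp ha hcrit hmid
    have hmono : ∀ i : ℕ, N ≤ i → surfaceEnergy v m p (bulkEnergy v m p a) (w i)
        ≤ μ + 1 / ((N : ℝ) + 1) := fun i hi =>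
      (hwlt i).le.trans (add_le_add_right (Nat.one_div_le_one_div hi) _)
    have h2 := hmono j hj
    have h3 := hmono k hk
    have h4 : κ * ∑ l ∈ Finset.range L, (w j l - w k l) ^ 2 ≤ 8 * (1 / ((N : ℝ) + 1)) := by
      linarith
    calc ∑ l ∈ Finset.range L, (w j l - w k l) ^ 2
        = (κ * ∑ l ∈ Finset.range L, (w j l - w k l) ^ 2) / κ := by field_simp
      _ ≤ (8 * (1 / ((N : ℝ) + 1))) / κ := div_le_div_of_nonneg_right h4 hκ.le
      _ = _ := by ring
  obtain ⟨f, hf⟩ := cauchySeq_tendsto_of_complete hcauchy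
  have hcoord : ∀ l, Tendsto (fun k => w k l) atTop (𝓝 (a + f l)) := by
    intro l
    rw [tendsto_iff_dist_tendsto_zero] at hf ⊢
    refine squeeze_zero (fun _ => dist_nonneg) (fun k => ?_) hf
    rw [dist_eq_norm, dist_eq_norm]
    refine le_trans (le_of_eq ?_) (lp.norm_apply_le_norm (by norm_num) ((W k).strain - f) l)
    congr 1
    have : ((W k).strain - f) l = (w k l - a) - f l := rfl
    rw [this]
    ring
  have hbox : ∀ l, a + f l ∈ Set.Icc zmin zmax := fun l =>
    isClosed_Icc.mem_of_tendsto (hcoord l) (Eventually.of_forall fun k => hwb k l)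
  have hzD : (fun l => a + f l) ∈ squareSummableStrains rhc a := by
    refine ⟨fun l => lt_of_lt_of_le hv.rhc_lt_zmin (hbox l).1, ?_⟩
    have := (lp.memℓp f).summable (by norm_num)
    simpa using this
  refine ⟨_, hzD, hbox, ?_⟩
  have hstrain : StrainSpace.strain (⟨fun l => a + f l, hzD⟩ : StrainSpace rhc a) = f := by
    ext l
    exact add_sub_cancel_left a (f l)
  have hWlim : Tendsto W atTop (𝓝 ⟨fun l => a + f l, hzD⟩) := by
    refine tendsto_iff_dist_tendsto_zero.2 ?_
    refine (tendsto_iff_dist_tendsto_zero.1 hf).congr fun k => ?_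
    exact congrArg (dist (W k).strain) hstrain.symm
  have h1 := ((continuous_extSurfaceEnergy hv hcrit ha').tendsto _).comp hWlim
  refine tendsto_nhds_unique h1 ?_
  have h2 : Tendsto (fun k : ℕ => μ + 1 / ((k : ℝ) + 1)) atTop (𝓝 (μ + 0)) :=
    tendsto_const_nhds.add tendsto_one_div_add_atTop_nhds_zero_nat
  rw [add_zero] at h2
  refine tendsto_of_tendsto_of_tendsto_of_le_of_le tendsto_const_nhds h2 (fun k => ?_) fun k => ?_
  · change μ ≤ extSurfaceEnergy v m p a (w k)
    rw [extSurfaceEnergy_eq (hw k)]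
    exact surfaceInf_le hv hm hp₀ hp ha hcrit (hw k)
  · change extSurfaceEnergy v m p a (w k) ≤ _
    rw [extSurfaceEnergy_eq (hw k)]
    exact (hwlt k).le

/-- Outside the box there is a definite gap that survives the limit of truncations: the relocation
gain for a short spacing, `v (w j) - v zmax` for a long one. Inside it the midpoint with the
minimizer decides. -/
theorem surfaceInf_lt (hv : IsAdmissible v rhc zmin zmax α₁ α₂ s) {m : ℕ∞}
    (hm : 1 ≤ m) {p a : ℝ} (hp₀ : 0 ≤ p) (hp : p < |v zmax| / zmax) (ha : a ∈ Set.Icc zmin zmax)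
    (hcrit : p + ∑' k : ℕ, (k : ℝ) * cutoff (deriv v) m k (k * a) = 0) {z w : ℕ → ℝ}
    (hz : z ∈ squareSummableStrains rhc a) (hzb : ∀ l, z l ∈ Set.Icc zmin zmax)
    (hzμ : extSurfaceEnergy v m p a z = surfaceInf v m p rhc a)
    (hw : w ∈ squareSummableStrains rhc a) (hwz : w ≠ z) :
    surfaceInf v m p rhc a < extSurfaceEnergy v m p a w := by
  have ha' : rhc < a := lt_of_lt_of_le hv.rhc_lt_zmin ha.1
  have hlim : ∀ y ∈ squareSummableStrains rhc a, Tendsto (fun n =>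
      surfaceEnergy v m p (bulkEnergy v m p a) (truncation a n y)) atTop
      (𝓝 (extSurfaceEnergy v m p a y)) := fun y hy => tendsto_extSurfaceEnergy hv hcrit ha' hy
  have hinf : ∀ y ∈ finiteStrains rhc a, surfaceInf v m p rhc a
      ≤ surfaceEnergy v m p (bulkEnergy v m p a) y := fun y hy =>
    surfaceInf_le hv hm hp₀ hp ha hcrit hy
  have hmem := truncation_mem_finiteStrains ha' hw.1
  by_cases h1 : ∃ i, w i < zmin
  · obtain ⟨i, hi⟩ := h1
    have hδ := hv.add_mul_zmax_neg hp
    have : surfaceInf v m p rhc a + -(v zmax + p * zmax) ≤ extSurfaceEnergy v m p a w := by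
      refine ge_of_tendsto (hlim w hw) ?_
      filter_upwards [eventually_gt_atTop i] with n hn
      obtain ⟨y, hy, hle⟩ := surfaceEnergy_of_lt_zmin hv hm hp₀ ha (hmem n) (i := i)
        (by rwa [truncation_of_lt a hn])
      linarith [hinf y hy]
    linarith
  push Not at h1
  by_cases h2 : ∃ j, zmax < w j
  · obtain ⟨j, hj⟩ := h2
    have hgap := hv.zmax_unique_min (w j) (hw.1 j) hj.ne'
    have : surfaceInf v m p rhc a + (v (w j) - v zmax) ≤ extSurfaceEnergy v m p a w := by
      refine ge_of_tendsto (hlim w hw) ?_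
      filter_upwards [eventually_gt_atTop j] with n hn
      obtain ⟨hc, hle⟩ := surfaceEnergy_clip_le hv hm hp₀ ha (hmem n)
        (truncation_mem (A := Set.Ici zmin) ha.1 h1 n)
      have h3 := hle j
      rw [truncation_of_lt a hn, min_eq_right hj.le] at h3
      linarith [hinf _ hc]
    linarith
  push Not at h2
  have hwb : ∀ l, w l ∈ Set.Icc zmin zmax := fun l => ⟨h1 l, h2 l⟩
  obtain ⟨l, hl⟩ : ∃ l, w l ≠ z l := by
    by_contra! h
    exact hwz (funext h)
  have hy : (fun l => 1 / 2 * z l + 1 / 2 * w l) ∈ squareSummableStrains rhc a := by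
    refine ⟨fun l => by linarith [hz.1 l, hw.1 l], ?_⟩
    refine Summable.of_nonneg_of_le (fun _ => sq_nonneg _) (fun l => ?_) (hz.2.add hw.2)
    nlinarith [sq_nonneg (z l - a - (w l - a)), sq_nonneg (z l - a), sq_nonneg (w l - a)]
  have h3 := extSurfaceEnergy_convexity hv hm ha hcrit hz hw hzb hwb (t := 1 / 2) (u := 1 / 2)
    (by norm_num) (by norm_num) (by norm_num) hy (fun _ => rfl) (l + 1)
  have h4 : surfaceInf v m p rhc a ≤ extSurfaceEnergy v m p a fun l => 1 / 2 * z l + 1 / 2 * w l :=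
    ge_of_tendsto (hlim _ hy) (Eventually.of_forall fun n =>
      hinf _ (truncation_mem_finiteStrains ha' hy.1 n))
  have h5 : 0 < ∑ i ∈ Finset.range (l + 1), (z i - w i) ^ 2 :=
    Finset.sum_pos' (fun _ _ => sq_nonneg _) ⟨l, by simp, by
      have : z l - w l ≠ 0 := sub_ne_zero.2 hl.symm
      positivity⟩
  have h6 := mul_pos hv.convexityModulus_pos h5
  rw [hzμ] at h3
  linarith

theorem strictConvexOn_extSurfaceEnergy (hv : IsAdmissible v rhc zmin zmax α₁ α₂ s) {m : ℕ∞}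
    (hm : 1 ≤ m) {p a : ℝ} (ha : a ∈ Set.Icc zmin zmax)
    (hcrit : p + ∑' k : ℕ, (k : ℝ) * cutoff (deriv v) m k (k * a) = 0) :
    StrictConvexOn ℝ (squareSummableStrains rhc a ∩ {z | ∀ j, z j ∈ Set.Icc zmin zmax})
      (extSurfaceEnergy v m p a) := by
  have hconv : ∀ z ∈ squareSummableStrains rhc a ∩ {z | ∀ j, z j ∈ Set.Icc zmin zmax},
      ∀ w ∈ squareSummableStrains rhc a ∩ {z | ∀ j, z j ∈ Set.Icc zmin zmax}, ∀ t u : ℝ,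
      0 ≤ t → 0 ≤ u → t + u = 1 →
      t • z + u • w ∈ squareSummableStrains rhc a ∩ {z | ∀ j, z j ∈ Set.Icc zmin zmax} := by
    intro z hz w hw t u ht hu htu
    have hbox : ∀ l, t * z l + u * w l ∈ Set.Icc zmin zmax := fun l =>
      (convex_Icc zmin zmax) (hz.2 l) (hw.2 l) ht hu htu
    refine ⟨⟨fun l => lt_of_lt_of_le hv.rhc_lt_zmin (hbox l).1, ?_⟩, hbox⟩
    refine Summable.of_nonneg_of_le (fun _ => sq_nonneg _) (fun l => ?_) (hz.1.2.add hw.1.2)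
    have hu' : u = 1 - t := by linarith
    have h1 : (t • z + u • w) l - a = t * (z l - a) + u * (w l - a) := by
      simp only [Pi.add_apply, Pi.smul_apply, smul_eq_mul, hu']
      ring
    rw [h1, hu']
    have ht1 : t ≤ 1 := by linarith
    nlinarith [sq_nonneg (z l - a - (w l - a)), sq_nonneg (z l - a), sq_nonneg (w l - a),
      mul_nonneg (mul_nonneg ht (by linarith : 0 ≤ 1 - t)) (sq_nonneg (z l - a - (w l - a))),
      mul_nonneg (by linarith : 0 ≤ 1 - t) (sq_nonneg (z l - a)),
      mul_nonneg ht (sq_nonneg (w l - a))]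
  refine ⟨fun z hz w hw t u ht hu htu => hconv z hz w hw t u ht hu htu, ?_⟩
  intro z hz w hw hzw t u ht hu htu
  obtain ⟨l, hl⟩ : ∃ l, z l ≠ w l := by
    by_contra! h
    exact hzw (funext h)
  have h1 := extSurfaceEnergy_convexity hv hm ha hcrit hz.1 hw.1 hz.2 hw.2 ht.le hu.le htu
    (hconv z hz w hw t u ht.le hu.le htu).1 (fun _ => rfl) (l + 1)
  have h2 : 0 < ∑ i ∈ Finset.range (l + 1), (z i - w i) ^ 2 :=
    Finset.sum_pos' (fun _ _ => sq_nonneg _) ⟨l, by simp, by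
      have : z l - w l ≠ 0 := sub_ne_zero.2 hl
      positivity⟩
  have h3 := mul_pos (half_pos hv.convexityModulus_pos) (mul_pos (mul_pos ht hu) h2)
  simp only [smul_eq_mul]
  linarith

end

/-! ### The surface energy of long finite chains -/

section
variable {v : ℝ → ℝ} {rhc zmin zmax α₁ α₂ s : ℝ}

theorem sum_blocks (f : ℕ → ℝ) (q B : ℕ) :
    ∑ b ∈ Finset.range B, ∑ i ∈ Finset.range q, f (b * q + i)
      = ∑ l ∈ Finset.range (B * q), f l := by
  induction B with
  | zero => simp
  | succ B ih => rw [Finset.sum_range_succ, ih, Nat.succ_mul, Finset.sum_range_add]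

/-- A chain with bounded strain contains a block of length `√L` with small strain, in which the
spacings can be replaced by `a`. -/
theorem exists_cut {a M : ℝ} {A : Set ℝ} (ha : a ∈ A) {L : ℕ} (hL : 1 ≤ L) {z : ℕ → ℝ}
    (hz : ∀ l, z l ∈ A) (hM : ∑ l ∈ Finset.range L, (z l - a) ^ 2 ≤ M ^ 2) :
    ∃ (n n' : ℕ) (y : ℕ → ℝ), n + n' = L ∧ (∀ l, y l ∈ A) ∧ L.sqrt / 2 ≤ n ∧ L.sqrt / 2 ≤ n' ∧
      (∀ l, n ≤ l + L.sqrt / 2 → l < n + L.sqrt / 2 → y l = a) ∧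
      ∑ l ∈ Finset.range L, (y l - z l) ^ 2 ≤ M ^ 2 / L.sqrt ∧
      ∑ l ∈ Finset.range L, (y l - a) ^ 2 ≤ M ^ 2 := by
  set q := L.sqrt with hq
  have hq1 : 1 ≤ q := Nat.sqrt_pos.2 hL
  have hq2 : q * q ≤ L := Nat.sqrt_le L
  have hq0 : (0 : ℝ) < q := by exact_mod_cast hq1
  set f : ℕ → ℝ := fun l => (z l - a) ^ 2 with hf
  -- Pigeonhole over `q` disjoint blocks of length `q`, which fit because `q * q ≤ L`. The cut is
  -- placed in the middle of the chosen block.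
  obtain ⟨b, hb, hbf⟩ : ∃ b ∈ Finset.range q,
      ∑ i ∈ Finset.range q, f (b * q + i) ≤ M ^ 2 / q := by
    refine Finset.exists_le_of_sum_le ⟨0, Finset.mem_range.2 hq1⟩ ?_
    rw [sum_blocks, Finset.sum_const, Finset.card_range, nsmul_eq_mul, mul_div_cancel₀ _ hq0.ne']
    exact (Finset.sum_le_sum_of_subset_of_nonneg (Finset.range_mono hq2)
      fun _ _ _ => sq_nonneg _).trans hM
  have hbq : b * q + q ≤ q * q := by
    have := Finset.mem_range.1 hb
    calc b * q + q = (b + 1) * q := by ring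
      _ ≤ q * q := Nat.mul_le_mul_right q this
  refine ⟨b * q + q / 2, L - (b * q + q / 2),
    fun l => if b * q ≤ l ∧ l < b * q + q then a else z l, by omega, fun l => ?_, by omega,
    by omega, fun l h1 h2 => if_pos ⟨by omega, by omega⟩, ?_, ?_⟩
  · dsimp only
    split_ifs
    exacts [ha, hz l]
  · refine le_trans ?_ hbf
    have h1 : ∑ i ∈ Finset.range q, f (b * q + i) = ∑ l ∈ Finset.Ico (b * q) (b * q + q), f l := by
      rw [Finset.sum_Ico_eq_sum_range, Nat.add_sub_cancel_left]
    have h2 : ∑ l ∈ Finset.range L, ((if b * q ≤ l ∧ l < b * q + q then a else z l) - z l) ^ 2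
        = ∑ l ∈ (Finset.range L).filter (fun l => b * q ≤ l ∧ l < b * q + q), f l := by
      rw [Finset.sum_filter]
      refine Finset.sum_congr rfl fun l _ => ?_
      split_ifs
      · rw [hf]; ring
      · ring
    rw [h1, h2]
    refine Finset.sum_le_sum_of_subset_of_nonneg (fun l hl => ?_) fun _ _ _ => sq_nonneg _
    exact Finset.mem_Ico.2 (Finset.mem_filter.1 hl).2
  · refine le_trans (Finset.sum_le_sum fun l _ => ?_) hM
    dsimp only
    split_ifs
    · simpa using sq_nonneg (z l - a)
    · exact le_rfl

/-- Coercivity forces `κ / 2 * (d ^ 2 - d) ≤ K * d`, that is `d ≤ 1 + 2 * K / κ`, whatever the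
length. -/
theorem exists_strain_bound (hv : IsAdmissible v rhc zmin zmax α₁ α₂ s) {m : ℕ∞} (hm : 1 ≤ m)
    {p a : ℝ} (ha : a ∈ Set.Icc zmin zmax)
    (hcrit : p + ∑' k : ℕ, (k : ℝ) * cutoff (deriv v) m k (k * a) = 0) :
    ∃ M, 0 ≤ M ∧ ∀ (L : ℕ) (z : ℕ → ℝ), (∀ l, z l ∈ Set.Icc zmin zmax) →
      chain (cutoff v m) p (L + 1) z ≤ chain (cutoff v m) p (L + 1) (fun _ => a) →
      ∑ l ∈ Finset.range L, (z l - a) ^ 2 ≤ M ^ 2 := by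
  obtain ⟨K, hK, hco⟩ := exists_chain_coercive hv hm ha hcrit
  have hκ := hv.convexityModulus_pos
  set κ := convexityModulus v zmin zmax
  refine ⟨1 + 2 * K / κ, by positivity, fun L z hz hle => ?_⟩
  have h1 := hco L z fun l _ => hz l
  set S := ∑ l ∈ Finset.range L, (z l - a) ^ 2
  have hS0 : 0 ≤ S := Finset.sum_nonneg fun _ _ => sq_nonneg _
  have hdS : √S ^ 2 = S := Real.sq_sqrt hS0
  rw [← hdS]
  refine pow_le_pow_left₀ (Real.sqrt_nonneg _) ?_ 2
  set d := √S
  have hd0 : 0 ≤ d := Real.sqrt_nonneg _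
  by_contra! hcon
  have hdpos : 0 < d := lt_of_le_of_lt (by positivity) hcon
  have h2 : κ / 2 * (d ^ 2 - d) ≤ K * d := by rw [hdS]; linarith
  have h3 : d * (κ / 2 * (d - 1)) ≤ d * K := by linarith
  have h4 := le_of_mul_le_mul_left h3 hdpos
  have h5 : κ * (1 + 2 * K / κ) = κ + 2 * K := by field_simp
  have h6 := mul_lt_mul_of_pos_left hcon hκ
  linarith

theorem tendsto_chain_minimum (hv : IsAdmissible v rhc zmin zmax α₁ α₂ s) {m : ℕ∞} (hm : 1 ≤ m)
    {p a : ℝ} (hp₀ : 0 ≤ p) (hp : p < |v zmax| / zmax) (ha : a ∈ Set.Icc zmin zmax)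
    (hcrit : p + ∑' k : ℕ, (k : ℝ) * cutoff (deriv v) m k (k * a) = 0) {ζ : ℕ → ℕ → ℝ}
    (hζb : ∀ N l, ζ N l ∈ Set.Icc zmin zmax)
    (hζ : ∀ N (w : ℕ → ℝ), (∀ l, rhc < w l) →
      chain (cutoff v m) p (N + 2) (ζ N) ≤ chain (cutoff v m) p (N + 2) w) :
    Tendsto (fun N : ℕ => chain (cutoff v m) p (N + 2) (ζ N)
      - ((N : ℝ) + 2) * bulkEnergy v m p a) atTop
      (𝓝 (2 * surfaceInf v m p rhc a
        - (bulkEnergy v m p a + bulkCrossEnergy (cutoff v m) a))) := by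
  have ha' : rhc < a := lt_of_lt_of_le hv.rhc_lt_zmin ha.1
  set e := bulkEnergy v m p a with he
  set Q := bulkCrossEnergy (cutoff v m) a with hQ
  set μ := surfaceInf v m p rhc a with hμ
  refine tendsto_order.2 ⟨fun c hc => ?_, fun c hc => ?_⟩
  -- Lower bound: flatten a block of the minimizer, cut there, and bound both surface energies below
  -- by `μ`. There are `N + 1` spacings but `N + 2` particles, whence the extra `-e`.
  · obtain ⟨M, hM0, hM⟩ := exists_strain_bound hv hm ha hcrit
    obtain ⟨K, hK, hlip⟩ := exists_chain_lipschitz hv hcrit hv.rhc_lt_zmin ha.1 hM0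
    have hS : ∀ N, ∑ l ∈ Finset.range (N + 1), (ζ N l - a) ^ 2 ≤ M ^ 2 := fun N =>
      hM (N + 1) (ζ N) (hζb N) (hζ N _ fun _ => ha')
    choose n n' y hnn hyA hn hn' hya hyζ hyM using fun N =>
      exists_cut ha (Nat.le_add_left 1 N) (hζb N) (hS N)
    have hsqrt : Tendsto (fun N : ℕ => (N + 1).sqrt) atTop atTop :=
      tendsto_atTop.2 fun i => by
        filter_upwards [eventually_ge_atTop (i * i)] with N hN
        exact Nat.le_sqrt.2 (by omega)
    have hglue := tendsto_chain_glue hv m p (a := a) hv.rhc_lt_zmin ha.1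
      (fun N l => (hyA N l).1) (n := n) (n' := n') (fun i => by
        filter_upwards [hsqrt.eventually_ge_atTop (2 * (i + 1))] with N hN
        have h1 := hn N
        have h2 := hn' N
        refine ⟨by omega, by omega, fun l hl hl' => hya N l (by omega) (by omega)⟩)
    have herr : Tendsto (fun N : ℕ => K * √(M ^ 2 / ((N + 1).sqrt : ℝ))) atTop (𝓝 0) := by
      have h1 : Tendsto (fun N : ℕ => M ^ 2 / ((N + 1).sqrt : ℝ)) atTop (𝓝 0) :=
        tendsto_const_nhds.div_atTop (tendsto_natCast_atTop_atTop.comp hsqrt)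
      simpa using h1.sqrt.const_mul K
    have hlow := (hglue.sub herr).const_add (2 * μ - e)
    have hlt : c < 2 * μ - e + (-Q - 0) := by linarith
    filter_upwards [hlow.eventually (lt_mem_nhds hlt)] with N hN
    have h1 := hlip (N + 1) (y N) (ζ N) (fun l _ => (hyA N l).1) (fun l _ => (hζb N l).1)
      (hyM N) (hS N)
    have h2 : K * √(∑ l ∈ Finset.range (N + 1), (y N l - ζ N l) ^ 2)
        ≤ K * √(M ^ 2 / ((N + 1).sqrt : ℝ)) :=
      mul_le_mul_of_nonneg_left (Real.sqrt_le_sqrt (hyζ N)) hK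
    have h3 := (abs_le.1 (h1.trans h2)).2
    have hfin : ∀ (k : ℕ) (g : ℕ → ℝ), (∀ l, rhc < g l) →
        (fun l => if l < k then g l else a) ∈ finiteStrains rhc a := fun k g hg =>
      truncation_mem_finiteStrains ha' hg k
    have hy : ∀ l, rhc < y N l := fun l => lt_of_lt_of_le hv.rhc_lt_zmin (hyA N l).1
    have h4 : μ ≤ _ := surfaceInf_le hv hm hp₀ hp ha hcrit (hfin (n N) (y N) hy)
    have h5 : μ ≤ _ := surfaceInf_le hv hm hp₀ hp ha hcrit
      (hfin (n' N) (fun l => y N (n N + (n' N - 1 - l))) fun l => hy _)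
    have h6 : (n N : ℝ) + n' N = N + 1 := by exact_mod_cast hnn N
    rw [hnn N, h6] at hN
    linarith
  -- Upper bound: the trial chain carries a near-minimizer at the left end and its mirror image at
  -- the right end. The two surface errors use `2 * ε` of the available `4 * ε`.
  · set ε := (c - (2 * μ - (e + Q))) / 4 with hε
    have hε0 : 0 < ε := by rw [hε]; linarith
    obtain ⟨z, hz, hzb, hzlt⟩ := exists_box_lt hv hm hp₀ hp ha hcrit hε0
    obtain ⟨hzr, n₀, hn₀⟩ := mem_finiteStrains_iff.1 hz
    set y : ℕ → ℕ → ℝ := fun N l => if l < (N + 1) / 2 then z l else z (N - l) with hy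
    have hyb : ∀ N l, y N l ∈ Set.Icc zmin zmax := fun N l => by
      simp only [hy]; split_ifs; exacts [hzb _, hzb _]
    have hglue := tendsto_chain_glue hv m p (a := a) hv.rhc_lt_zmin ha.1
      (fun N l => (hyb N l).1) (n := fun N => (N + 1) / 2) (n' := fun N => N + 1 - (N + 1) / 2)
      (fun i => by
        filter_upwards [eventually_ge_atTop (2 * (n₀ + i + 2))] with N hN
        refine ⟨by omega, by omega, fun l hl hl' => ?_⟩
        simp only [hy]
        split_ifs
        · exact hn₀ l (by omega)
        · exact hn₀ _ (by omega))
    have hup := (hglue.add_const (2 * (μ + ε) - e))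
    have hlt : -Q + (2 * (μ + ε) - e) < c := by
      have : c = 2 * μ - (e + Q) + 4 * ε := by rw [hε]; ring
      linarith
    filter_upwards [hup.eventually (gt_mem_nhds hlt), eventually_ge_atTop (2 * (n₀ + 2))]
      with N hN hNn
    have hw1 : (fun l => if l < (N + 1) / 2 then y N l else a) = z := by
      funext l
      split_ifs with h
      · simp only [hy]
        exact if_pos h
      · exact (hn₀ l (by omega)).symm
    have hw2 : (fun l => if l < N + 1 - (N + 1) / 2 then
        y N ((N + 1) / 2 + (N + 1 - (N + 1) / 2 - 1 - l)) else a) = z := by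
      funext l
      split_ifs with h
      · simp only [hy]
        rw [if_neg (by omega)]
        congr 1
        omega
      · exact (hn₀ l (by omega)).symm
    have hcard : (N + 1) / 2 + (N + 1 - (N + 1) / 2) = N + 1 := by omega
    have hcast : (((N + 1) / 2 : ℕ) : ℝ) + ((N + 1 - (N + 1) / 2 : ℕ) : ℝ) = N + 1 := by
      exact_mod_cast hcard
    rw [hw1, hw2, hcard, hcast] at hN
    have h1 := hζ N (y N) fun l => lt_of_lt_of_le hv.rhc_lt_zmin (hyb N l).1
    change surfaceEnergy v m p e z < μ + ε at hzlt
    linarith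

end

end AtomChain

end

/-! ### The main theorem -/

theorem mainTheorem3 (v : ℝ → ℝ) (rhc zmin zmax α₁ α₂ s : ℝ)
    (hv : AtomChain.IsAdmissible v rhc zmin zmax α₁ α₂ s)
    (m : ℕ∞) (hm : 1 ≤ m) (p : ℝ) (hp₀ : 0 ≤ p) (hp : p < |v zmax| / zmax) :
    ∃ a e₀ : ℝ,
      -- `a` is the unique minimizer of `r ↦ p r + ∑_{k=1}^m v(k r)` on `(0, ∞)`
      (0 < a ∧ ∀ r, 0 < r → r ≠ a →
        AtomChain.bulkEnergyExt rhc v m p a < AtomChain.bulkEnergyExt rhc v m p r) ∧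
      -- `e₀` is the energy per particle
      e₀ = AtomChain.bulkEnergy v m p a ∧
      Tendsto (fun N : ℕ => AtomChain.minEnergy rhc v m p N / (N : EReal)) atTop
        (𝓝 (e₀ : EReal)) ∧
      ∃ E : (ℕ → ℝ) → ℝ,
        -- continuous extension of the surface functional
        (∀ z ∈ AtomChain.finiteStrains rhc a, E z = AtomChain.surfaceEnergy v m p e₀ z) ∧
        Continuous (fun z : AtomChain.StrainSpace rhc a => E z.1) ∧
        -- strict convexity
        StrictConvexOn ℝ
          (AtomChain.squareSummableStrains rhc a ∩ {z | ∀ j, z j ∈ Set.Icc zmin zmax}) E ∧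
        -- unique minimizer `z`, and the surface energy
        ∃ z ∈ AtomChain.squareSummableStrains rhc a ∩ {z | ∀ j, z j ∈ Set.Icc zmin zmax},
          (∀ w ∈ AtomChain.squareSummableStrains rhc a, w ≠ z → E z < E w) ∧
          Tendsto
            (fun N : ℕ => AtomChain.minEnergy rhc v m p N - (((N : ℝ) * e₀ : ℝ) : EReal)) atTop
            (𝓝 ((2 * E z - p * a - AtomChain.sumTo m (fun k => k * v (k * a)) : ℝ) : EReal)) := by
  obtain ⟨a, ha, hmin, hcrit⟩ := hv.exists_bulk_minimizer hm hp₀ hp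
  have ha' : rhc < a := lt_of_lt_of_le hv.rhc_lt_zmin ha.1
  have hconst := AtomChain.bulkEnergy_add_bulkCrossEnergy hv m p ha'
  choose ζ hζb hζ using fun N : ℕ =>
    AtomChain.exists_chain_minimizer hv hm hp₀ hp (N := N + 2) (by omega)
  have hE : ∀ N : ℕ, AtomChain.minEnergy rhc v m p (N + 2)
      = (AtomChain.chain (AtomChain.cutoff v m) p (N + 2) (ζ N) : EReal) := fun N =>
    AtomChain.minEnergy_eq_coe hv hm (fun l => lt_of_lt_of_le hv.rhc_lt_zmin (hζb N l).1) (hζ N)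
  have hlim := AtomChain.tendsto_chain_minimum hv hm hp₀ hp ha hcrit hζb hζ
  obtain ⟨z, hz, hzb, hzinf⟩ :=
    AtomChain.exists_extSurfaceEnergy_eq_inf hv hm hp₀ hp ha hcrit
  refine ⟨a, AtomChain.bulkEnergy v m p a, ⟨lt_of_le_of_lt hv.rhc_nonneg ha', fun r _ hra => ?_⟩,
    rfl, ?_, AtomChain.extSurfaceEnergy v m p a, fun w hw => AtomChain.extSurfaceEnergy_eq hw,
    AtomChain.continuous_extSurfaceEnergy hv hcrit ha',
    AtomChain.strictConvexOn_extSurfaceEnergy hv hm ha hcrit, z, ⟨hz, hzb⟩, fun w hw hwz => ?_, ?_⟩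
  · unfold AtomChain.bulkEnergyExt
    rw [if_neg (not_le.2 ha')]
    split_ifs with h
    · exact EReal.coe_lt_top _
    · exact EReal.coe_lt_coe_iff.2 (hmin r (not_le.1 h) hra)
  -- The energy per particle follows from the convergence of `E_N - N * e₀` after division by `N`;
  -- the shift by two is there because minimizers were constructed for `N ≥ 2`.
  · rw [← tendsto_add_atTop_iff_nat 2]
    have hinv : Tendsto (fun N : ℕ => ((N : ℝ) + 2)⁻¹) atTop (𝓝 0) :=
      (tendsto_atTop_add_const_right _ 2 tendsto_natCast_atTop_atTop).inv_tendsto_atTop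
    have h1 := (hlim.mul hinv).const_add (AtomChain.bulkEnergy v m p a)
    rw [mul_zero, add_zero] at h1
    refine ((continuous_coe_real_ereal.tendsto _).comp h1).congr fun N => ?_
    rw [hE, ← EReal.coe_coe_eq_natCast, ← EReal.coe_div, Function.comp_apply, EReal.coe_eq_coe_iff]
    have h2 : (N : ℝ) + 2 ≠ 0 := by positivity
    push_cast
    field_simp
    ring
  · rw [hzinf]
    exact AtomChain.surfaceInf_lt hv hm hp₀ hp ha hcrit hz hzb hzinf hw hwz
  · rw [← tendsto_add_atTop_iff_nat 2, hzinf]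
    rw [hconst, ← sub_sub] at hlim
    refine ((continuous_coe_real_ereal.tendsto _).comp hlim).congr fun N => ?_
    rw [hE, ← EReal.coe_sub, Function.comp_apply]
    push_cast
    rfl
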